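/- **Setting.** Let $d\in\mathbb N$, $d\ge 1$, $\tau\in\mathbb N=\{0,1,2,\dots\}$, and let $D\subset\mathbb R^d$ be a non-empty open set. Let $\square=[-1,1]^{\mathbb N^*}$ carry the law $\mathbb P$ under which the coordinates $y_k$ are independent and uniformly distributed on $[-1,1]$. Vectors carry the Euclidean norm and matrices the spectral norm. Write $$\|v\|_{W^{\eta,p}(D)}=\sum_{|\beta|\le\eta}\frac1{\beta!}\|\partial_x^\beta v\|_{L^p(D)},\qquad \|v\|_{C^{\tau,1}(\overline D)}=\sum_{|\beta|\le\tau}\sup_D\|\partial_x^\beta v\|+\sum_{|\beta|=\tau}\mathrm{Lip}_D(\partial_x^\beta v),$$ with weak derivatives on the left; $H^\eta=W^{\eta,2}$ and $H^{-1}(D)=H_0^1(D)'$. Here $C^{\tau,1}(\overline D)$ is the space of functions in $C^\tau(D)$ of finite norm whose partial derivatives of order at most $\tau$ extend continuously to $\overline D$. Let $\psi_k\in C^{\tau,1}(\overline D;\mathbb R^d)$ and $\sigma_k\in\mathbb R$ for $k\ge0$, $\sigma_0=1$, let $\gamma_k=\|\sigma_k\psi_k\|_{C^{\tau,1}(\overline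 D;\mathbb R^d)}$ with $\gamma=(\gamma_k)_{k\ge0}\in\ell^1$, and put $$V[y](x)=\sigma_0\psi_0(x)+\sum_{k\ge1}\sigma_k\psi_k(x)\,y_k,\qquad J[y]=D_xV[y]\qquad(y\in\square).$$ Let $0<\underline\sigma\le1\le\overline\sigma$ be such that, for almost every $y\in\square$, $$\underline\sigma\|x-x'\|\le\|V[y](x)-V[y](x')\|\le\overline\sigma\|x-x'\|\qquad(x,x'\in D).$$ Let $\mathcal D\subset\mathbb R^d$ be a bounded open set (hold-all domain) with $V[y](D)\subset\mathcal D$ for all $y\in\square$. Let $f$ be real analytic on $\mathcal D$ and let $k_f,c_f$ be constants such that $\|D^rf(v)\|\le r!\,k_f\,c_f^{\,r}$ for all $v\in\mathcal D$ and $r\in\mathbb N$. Set $$\hat A[y]=(J[y]^{\mathsf T}J[y])^{-1}\det J[y],\qquad \hat f[y]=(f\circ V[y])\det J[y].$$ **Constants.** Let $c_\tau$ be the norm of the embedding $C^{\tau,1}(\overline D;\mathbb R^d)\hookrightarrow W^{\tau+1,\infty}(D;\mathbb R^d)$ (which exists), and let $$c_\gamma=\max\{\|\gamma\|_{\ell^1},1\},\qquad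 k_{VJ}=[1+(\tau+1)d]\,c_\tau c_\gamma,$$ $$k_T=\underline\sigma^{-2}(2\overline\sigma)^d,\quad c_T=4(\underline\sigma^{-2}\overline\sigma^2+1),\quad k_s=(2\overline\sigma)^dk_f,\quad c_s=2\max\Bigl\{c_f\max\bigl\{1,\sup_{x\in\mathcal D}\|x\|\bigr\},\overline\sigma\Bigr\}+2,$$ $$k_{\hat A}=k_T\sum_{r=0}^\tau c_T^rk_{VJ}^r,\quad c_{\hat A}=2c_Tk_{VJ}+1,\quad k_{\hat f}=\sqrt{\frac{|\mathcal D|}{\underline\sigma^d}}\;k_s\sum_{r=0}^\tau c_s^rk_{VJ}^r,\quad c_{\hat f}=2c_sk_{VJ}+1.$$ **Theorem.** All parametric derivatives $\partial_y^\alpha\hat A$ and $\partial_y^\alpha\hat f$, for finitely supported multi-indices $\alpha\in\mathbb N^{\mathbb N^*}$, exist on $\square$ (one-sidedly on its faces) as limits of difference quotients in $W^{\tau,\infty}(D;\mathbb R^{d\times d}_{\mathrm{symm}})$ and in $H^{\tau-1}(D)$, respectively. As functions of $y$ they are strongly measurable, and for all $\alpha$ $$\|\partial_y^\alpha\hat A\|_{L^\infty_{\mathbb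 P}(\square;W^{\tau,\infty}(D;\mathbb R^{d\times d}_{\mathrm{symm}}))}\le|\alpha|!\,k_{\hat A}\,c_{\hat A}^{|\alpha|}\gamma^\alpha\quad\text{and}\quad\|\partial_y^\alpha\hat f\|_{L^\infty_{\mathbb P}(\square;H^{\tau-1}(D))}\le|\alpha|!\,k_{\hat f}\,c_{\hat f}^{|\alpha|}\gamma^\alpha,$$ where $\gamma^\alpha=\prod_{k\ge1}\gamma_k^{\alpha_k}$. -/

import Mathlib

open MeasureTheory Set Filter Topology
open scoped ENNReal

noncomputable section

namespace DomainMapping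

/-- `ℝ^d` with the Euclidean norm. -/
abbrev Rd (d : ℕ) : Type := EuclideanSpace ℝ (Fin d)

/-- `ℝ^{d×d}` as the linear endomorphisms of `ℝ^d`. The norm is the operator norm induced by the
Euclidean norm, that is, the spectral norm of the matrix. -/
abbrev Mat (d : ℕ) : Type := Rd d →L[ℝ] Rd d

/-! ### Spatial derivatives and function spaces -/

section Spaces

variable {d : ℕ} {F : Type*} [NormedAddCommGroup F] [NormedSpace ℝ F]

/-- The classical partial derivative in the `i`-th coordinate direction. -/
def pderiv (i : Fin d) (v : Rd d → F) : Rd d → F :=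
  fun x => fderiv ℝ v x (EuclideanSpace.single i (1 : ℝ))

/-- The classical partial derivative `∂^β v` for a spatial multi-index `β`. -/
def pderivs (β : Fin d → ℕ) (v : Rd d → F) : Rd d → F :=
  (List.finRange d).foldr (fun i g => (pderiv i)^[β i] g) v

/-- The order `|β|` of a spatial multi-index. -/
def order (β : Fin d → ℕ) : ℕ := ∑ i, β i

/-- The factorial `β!` of a spatial multi-index. -/
def mfact (β : Fin d → ℕ) : ℕ := ∏ i, (β i).factorial

variable (d) in
/-- The finite set of the spatial multi-indices `β` with `|β| ≤ η`. -/
def multiIdx (η : ℕ) : Finset (Fin d → ℕ) :=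
  (Fintype.piFinset fun _ => Finset.range (η + 1)).filter fun β => order β ≤ η

/-- The norm of `C^{k,1}(closure D)`, with the value `∞` allowed: the suprema over `D` of the
partial derivatives of order at most `k`, plus the Lipschitz constants on `D` of those of
order `k`. -/
def c1Norm (D : Set (Rd d)) (k : ℕ) (v : Rd d → F) : ℝ≥0∞ :=
  (∑ β ∈ multiIdx d k, ⨆ x ∈ D, ‖pderivs β v x‖ₑ) +
    ∑ β ∈ (multiIdx d k).filter (fun β => order β = k), eHolderNorm 1 (D.domRestrict (pderivs β v))

/-- `v ∈ C^{k,1}(closure D)` for an open set `D`: on `D`, the function is `k` times continuously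
differentiable, its partial derivatives of order at most `k` extend continuously to the closure
of `D`, and the `C^{k,1}`-norm is finite. -/
structure MemC1 (D : Set (Rd d)) (k : ℕ) (v : Rd d → F) : Prop where
  contDiffOn : ContDiffOn ℝ k v D
  extends_closure : ∀ β ∈ multiIdx d k, ∃ g : Rd d → F,
    ContinuousOn g (closure D) ∧ EqOn g (pderivs β v) D
  norm_lt_top : c1Norm D k v < ∞

/-- `φ ∈ C_c^∞(D)`. -/
structure IsTest (D : Set (Rd d)) (φ : Rd d → ℝ) : Prop where
  smooth : ContDiff ℝ (⊤ : ℕ∞) φ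
  compact : HasCompactSupport φ
  supp : tsupport φ ⊆ D

/-- `w` is the weak derivative `∂^β v` on the open set `D`. -/
structure HasWeakDeriv (D : Set (Rd d)) (β : Fin d → ℕ) (v w : Rd d → F) : Prop where
  locInt : LocallyIntegrableOn v D
  locInt' : LocallyIntegrableOn w D
  integral_eq : ∀ φ : Rd d → ℝ, IsTest D φ →
    ∫ x in D, pderivs β φ x • v x = (-1 : ℝ) ^ order β • ∫ x in D, φ x • w x

/-- The norm `∑_{|β| ≤ η} (1/β!) ‖∂^β v‖_{L^p(D)}` of `W^{η,p}(D; F)`. Weak derivatives are unique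
up to null sets, so the infimum only selects the weak derivative; it is `∞` if there is none. Thus
the norm is finite exactly for the elements of `W^{η,p}(D; F)`. -/
def sobolevNorm (D : Set (Rd d)) (η : ℕ) (p : ℝ≥0∞) (v : Rd d → F) : ℝ≥0∞ :=
  ∑ β ∈ multiIdx d η, ((mfact β : ℕ) : ℝ≥0∞)⁻¹ *
    ⨅ (w : Rd d → F) (_ : HasWeakDeriv D β v w), eLpNorm w p (volume.restrict D)

open Classical in
/-- The norm of `H^{-1}(D)`, the dual of `H_0^1(D)`, of the functional `φ ↦ ∫_D g φ` given by a
locally integrable function `g`. Since `C_c^∞(D)` is dense in `H_0^1(D)`, the dual norm is the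
supremum over test functions. -/
def dualSobolevNorm (D : Set (Rd d)) (g : Rd d → ℝ) : ℝ≥0∞ :=
  if LocallyIntegrableOn g D then
    ⨆ (φ : Rd d → ℝ) (_ : IsTest D φ) (_ : sobolevNorm D 1 2 φ ≤ 1), ‖∫ x in D, g x * φ x‖ₑ
  else ∞

/-- The norm of `H^{τ-1}(D)`, where `H^{-1}(D)` is the dual of `H_0^1(D)`. -/
def predSobolevNorm (D : Set (Rd d)) : ℕ → (Rd d → ℝ) → ℝ≥0∞
  | 0, g => dualSobolevNorm D g
  | m + 1, g => sobolevNorm D m 2 g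

end Spaces

/-! ### The parameter space -/

/-- The parameter sequences `y = (y_k)_{k ≥ 1}`. -/
abbrev Param : Type := ℕ+ → ℝ

/-- The cube `□ = [-1,1]^{ℕ*}`. -/
def box : Set Param := Set.univ.pi fun _ => Icc (-1) 1

/-- The uniform distribution on `[-1,1]`. -/
def uniformLaw : Measure ℝ := ProbabilityTheory.cond volume (Icc (-1) 1)

instance : IsProbabilityMeasure uniformLaw :=
  ProbabilityTheory.cond_isProbabilityMeasure_of_finite (by simp) (by simp)

/-- The law of `y` when the `y_k` are independent and uniformly distributed on `[-1,1]`; it is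
concentrated on `□`. -/
def law : Measure Param := Measure.infinitePi fun _ : ℕ+ => uniformLaw

/-- `γ^α` for a finitely supported multi-index `α = (α_k)_{k ≥ 1}`. -/
def gpow (γ : ℕ → ℝ) (α : ℕ+ →₀ ℕ) : ℝ := α.prod fun k a => γ (k : ℕ) ^ a

section Parametric

/-! Here `N` is the norm (with the value `∞` allowed) of a Banach space of functions on a domain,
and `u` is a family of functions indexed by the parameter. -/

variable {d : ℕ} {F : Type*} [NormedAddCommGroup F] [NormedSpace ℝ F]

/-- Strong measurability of `u` as a map from `□` to the space with norm `N`: it is almost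
everywhere the limit of countably-valued measurable maps. -/
def StronglyMeas (N : (Rd d → F) → ℝ≥0∞) (u : Param → Rd d → F) : Prop :=
  ∃ s : ℕ → Param → Rd d → F,
    (∀ n, (range (s n)).Countable ∧ (∀ g, NullMeasurableSet (s n ⁻¹' {g}) law) ∧
      ∀ y, N (s n y) < ∞) ∧
    ∀ᵐ y ∂law, Tendsto (fun n => N (fun x => s n y x - u y x)) atTop (𝓝 0)

open Classical in
/-- The Bochner norm of `L^∞(□; X)`, where `X` is the space with norm `N`; it is `∞` if `u` is
not strongly measurable. -/
def bochnerNorm (N : (Rd d → F) → ℝ≥0∞) (u : Param → Rd d → F) : ℝ≥0∞ :=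
  if StronglyMeas N u then essSup (fun y => N (u y)) law else ∞

/-- `U α` is the parametric derivative `∂_y^α u` for every multi-index `α`: `U 0 = u` on `□`, and
at every `y ∈ □` the difference quotients of `U α` in the variable `y_i` converge, in the norm `N`,
to `U (α + e_i)` (one-sidedly where `y` is on a face of `□`). -/
structure IsParamDeriv (N : (Rd d → F) → ℝ≥0∞) (u : Param → Rd d → F)
    (U : (ℕ+ →₀ ℕ) → Param → Rd d → F) : Prop where
  zero : ∀ y ∈ box, U 0 y = u y
  step : ∀ (α : ℕ+ →₀ ℕ) (i : ℕ+), ∀ y ∈ box,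
    Tendsto (fun t : ℝ => N (fun x =>
        t⁻¹ • (U α (y + Pi.single i t) x - U α y x) - U (α + Finsupp.single i 1) y x))
      (𝓝[{t : ℝ | t ≠ 0 ∧ y + Pi.single i t ∈ box}] 0) (𝓝 0)

end Parametric

/-! ### The domain mapping and the pulled-back data -/

section Data

variable {d : ℕ}

/-- The domain mapping `V[y] = σ_0 ψ_0 + ∑_{k ≥ 1} σ_k ψ_k y_k`; here `σ_0 = 1` and `ψ_0` is the
mean of `V`. -/
def mapV (σ : ℕ → ℝ) (ψ : ℕ → Rd d → Rd d) (y : Param) (x : Rd d) : Rd d :=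
  σ 0 • ψ 0 x + ∑' k : ℕ+, y k • σ k • ψ k x

/-- The Jacobian `J[y] = D_x V[y]`. -/
def jac (σ : ℕ → ℝ) (ψ : ℕ → Rd d → Rd d) (y : Param) (x : Rd d) : Mat d :=
  fderiv ℝ (mapV σ ψ y) x

/-- The pulled-back diffusion matrix `Â[y] = (J[y]ᵀ J[y])⁻¹ det J[y]`. -/
def hatA (σ : ℕ → ℝ) (ψ : ℕ → Rd d → Rd d) (y : Param) (x : Rd d) : Mat d :=
  (jac σ ψ y x).det • Ring.inverse (ContinuousLinearMap.adjoint (jac σ ψ y x) * jac σ ψ y x)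

/-- The pulled-back loading `(f ∘ V[y]) det J[y]`. -/
def hatF (f : Rd d → ℝ) (σ : ℕ → ℝ) (ψ : ℕ → Rd d → Rd d) (y : Param) (x : Rd d) : ℝ :=
  f (mapV σ ψ y x) * (jac σ ψ y x).det

/-- `γ_k = ‖σ_k ψ_k‖` in the norm of `C^{τ,1}(closure D; ℝ^d)`. -/
def gam (D : Set (Rd d)) (τ : ℕ) (σ : ℕ → ℝ) (ψ : ℕ → Rd d → Rd d) (k : ℕ) : ℝ :=
  (c1Norm D τ (fun x => σ k • ψ k x)).toReal

end Data

/-! ### The constants -/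

/-- `c_γ = max {‖γ‖_{ℓ¹}, 1}`. -/
def cGam (γ : ℕ → ℝ) : ℝ := max (∑' k, γ k) 1

/-- The norm `c_τ` of the embedding of `C^{τ,1}(closure D; ℝ^d)` into `W^{τ+1,∞}(D; ℝ^d)`. -/
def cEmb {d : ℕ} (D : Set (Rd d)) (τ : ℕ) : ℝ :=
  sInf {c : ℝ | 0 ≤ c ∧ ∀ v : Rd d → Rd d, MemC1 D τ v →
    sobolevNorm D (τ + 1) ∞ v ≤ ENNReal.ofReal c * c1Norm D τ v}

/-- `k_{VJ} = (1 + (τ+1) d) c_τ c_γ`. -/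
def kVJ {d : ℕ} (D : Set (Rd d)) (τ : ℕ) (γ : ℕ → ℝ) : ℝ :=
  (1 + ((τ : ℝ) + 1) * d) * cEmb D τ * cGam γ

/-- `k_T = σ_low^{-2} (2 σ_up)^d`. -/
def kT (d : ℕ) (σlow σup : ℝ) : ℝ := (σlow ^ 2)⁻¹ * (2 * σup) ^ d

/-- `c_T = 4 (σ_low^{-2} σ_up^2 + 1)`. -/
def cT (σlow σup : ℝ) : ℝ := 4 * ((σlow ^ 2)⁻¹ * σup ^ 2 + 1)

/-- `k_s = (2 σ_up)^d k_f`. -/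
def kS (d : ℕ) (σup kf : ℝ) : ℝ := (2 * σup) ^ d * kf

/-- `c_s = 2 max {c_f max {1, sup_{x ∈ H} ‖x‖}, σ_up} + 2` for the hold-all domain `H`. -/
def cS {d : ℕ} (H : Set (Rd d)) (σup cf : ℝ) : ℝ :=
  2 * max (cf * max 1 (sSup ((fun x => ‖x‖) '' H))) σup + 2

/-- The constant `k_Â`. -/
def kA {d : ℕ} (D : Set (Rd d)) (τ : ℕ) (γ : ℕ → ℝ) (σlow σup : ℝ) : ℝ :=
  kT d σlow σup * ∑ r ∈ Finset.range (τ + 1), cT σlow σup ^ r * kVJ D τ γ ^ r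

/-- The constant `c_Â`. -/
def cA {d : ℕ} (D : Set (Rd d)) (τ : ℕ) (γ : ℕ → ℝ) (σlow σup : ℝ) : ℝ :=
  2 * cT σlow σup * kVJ D τ γ + 1

/-- The constant `k_f̂`; `H` is the hold-all domain. -/
def kF {d : ℕ} (D H : Set (Rd d)) (τ : ℕ) (γ : ℕ → ℝ) (σlow σup kf cf : ℝ) : ℝ :=
  √((volume H).toReal / σlow ^ d) * kS d σup kf *
    ∑ r ∈ Finset.range (τ + 1), cS H σup cf ^ r * kVJ D τ γ ^ r

/-- The constant `c_f̂`; `H` is the hold-all domain. -/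
def cF {d : ℕ} (D H : Set (Rd d)) (τ : ℕ) (γ : ℕ → ℝ) (σup cf : ℝ) : ℝ :=
  2 * cS H σup cf * kVJ D τ γ + 1

end DomainMapping

end

/-!
The pair `(V[y], J[y])` is affine in the parameter `y`, and `Â[y]` and `f̂[y]` arise from it
pointwise, by composition with the fixed maps `J ↦ (JᵀJ)⁻¹ det J` (`diffusion`) and `(v, J) ↦ f(v)
det J` (`loading`). The chain rule for an affine inner function involves first derivatives only,
so `∂_y^α (g ∘ A[y]) = D^n g(A[y])(e_{k_1}, …, e_{k_n})` with `n = |α|`, where `A[y]` is the jet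
and `e_k` is the jet of `σ_k ψ_k` (`paramDeriv`). There are three things to be done with this
formula.

*Cauchy estimates.* By continuity in `y`, the bi-Lipschitz bounds hold for every `y ∈ □`
(`biLipschitz_mapV`), hence all jets have values in the set `K` of the pairs of a point of `H` and
a matrix with singular values in `[σlow, σup]`, and so have all segments between them. On `K` both
maps satisfy `‖D^n g‖ ≤ n! k c^n`: the derivatives of the inversion are those of a Neumann series,
the determinant is a multilinear function of norm one of the columns by Hadamard's inequality, and
products are governed by Leibniz's rule for divided derivatives
(`norm_iteratedFDeriv_diffusion_le`, `norm_iteratedFDeriv_loading_le`).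

*Spatial norms.* A function `v` is majorized by a power series `p` when `∑_{|β| = j} ‖∂^β v‖_∞ /
β! ≤ p_j` (`HasMajorant`). With the weights `1/β!`, products of functions are majorized by
products of series, and composite functions by composite series (`HasMajorant.bilinear`,
`HasMajorant.comp`), so that Faà di Bruno's formula is never written out. The norm of `W^{τ,∞}` is
at most the sum of the coefficients up to order `τ`, which is submultiplicative. Functions of
class `C^{τ,1}` have explicit majorants up to order `τ + 1` (`exists_majorant_of_c1Norm_le`):
their derivatives of order `τ` are Lipschitz, hence almost everywhere differentiable, and a locally
Lipschitz function may be integrated by parts. Together this bounds `∂_y^α (g ∘ A[y])`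
(`AffineFamily.sobolevNorm_paramDeriv_le`).

*Limits.* For nearby parameters Taylor's series of `D^n g` converges in `W^{τ,∞}`, its terms being
bounded by a geometric series with the same method (`sobolevNorm_taylor_remainder_le`). The
remainder of second order shows that the difference quotients converge, that of first order that
the derivatives are Lipschitz continuous for a weighted `ℓ¹`-distance of parameters, whence
rounding the parameters to a grid gives strong measurability.

For `f̂` the volume of `D`, which is at most `σlow^{-d} |H|`, controls the norm of `H^{τ-1}` by
that of `W^{τ,∞}`. For `τ = 0` the Jacobian exists almost everywhere only, and all pointwise
statements are made accordingly.
-/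

noncomputable section

namespace DomainMapping

open scoped NNReal

/-! ### Iterated partial derivatives -/

section Words

variable {d : ℕ} {F : Type*} [NormedAddCommGroup F] [NormedSpace ℝ F]

/-- The iterated classical partial derivative along a word of coordinate directions, the head of
the word being applied first. -/
def wordDeriv : List (Fin d) → (Rd d → F) → Rd d → F
  | [], v => v
  | i :: w, v => wordDeriv w (pderiv i v)

theorem wordDeriv_append (w w' : List (Fin d)) (v : Rd d → F) :
    wordDeriv (w ++ w') v = wordDeriv w' (wordDeriv w v) := by
  induction w generalizing v with
  | nil => rfl
  | cons i w ih => exact ih _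

theorem wordDeriv_replicate (n : ℕ) (i : Fin d) (v : Rd d → F) :
    wordDeriv (List.replicate n i) v = (pderiv i)^[n] v := by
  induction n generalizing v with
  | zero => rfl
  | succ n ih => simpa [List.replicate_succ, wordDeriv] using ih _

/-- The word in which `pderivs` differentiates, restricted to the directions in a given list. -/
def wordOn (β : Fin d → ℕ) : List (Fin d) → List (Fin d)
  | [] => []
  | i :: l => wordOn β l ++ List.replicate (β i) i

/-- The word of directions in which `pderivs β` differentiates. -/
def word (β : Fin d → ℕ) : List (Fin d) := wordOn β (List.finRange d)

theorem pderivs_eq_wordDeriv (β : Fin d → ℕ) (v : Rd d → F) :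
    pderivs β v = wordDeriv (word β) v := by
  unfold pderivs word
  induction List.finRange d with
  | nil => rfl
  | cons i l ih => simp [wordOn, wordDeriv_append, wordDeriv_replicate, ih]

theorem count_wordOn (β : Fin d → ℕ) (j : Fin d) (l : List (Fin d)) :
    (wordOn β l).count j = l.count j * β j := by
  induction l with
  | nil => simp [wordOn]
  | cons i l ih =>
    rw [wordOn, List.count_append, ih, List.count_replicate, List.count_cons]
    by_cases h : i = j
    · subst h; simp [add_mul]
    · simp [h]

theorem count_word (β : Fin d → ℕ) (j : Fin d) : (word β).count j = β j := by
  rw [word, count_wordOn, List.count_eq_one_of_mem (List.nodup_finRange d) (List.mem_finRange j),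
    one_mul]

theorem length_word (β : Fin d → ℕ) : (word β).length = order β := by
  have := Multiset.toFinset_sum_count_eq (word β : Multiset (Fin d))
  rw [Multiset.coe_card] at this
  rw [← this, order, ← Finset.sum_subset (Finset.subset_univ (word β : Multiset _).toFinset)]
  · simp [count_word]
  · intro x _ hx
    rw [← count_word β x]
    simpa [List.count_eq_zero] using hx

theorem word_append_perm (β : Fin d → ℕ) (i : Fin d) :
    (word β ++ [i]).Perm (word (β + Pi.single i 1)) := by
  rw [List.perm_iff_count]
  intro j
  rw [List.count_append, count_word, count_word, List.count_singleton]
  by_cases h : j = i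
  · subst h; simp
  · simp [h, Ne.symm h]

theorem word_zero : word (0 : Fin d → ℕ) = [] := by
  rw [← List.length_eq_zero_iff, length_word]; simp [order]

theorem pderivs_zero (v : Rd d → F) : pderivs 0 v = v := by
  rw [pderivs_eq_wordDeriv, word_zero, wordDeriv]

theorem word_single (i : Fin d) : word (Pi.single i 1 : Fin d → ℕ) = [i] := by
  have := word_append_perm (0 : Fin d → ℕ) i
  rw [word_zero, zero_add, List.nil_append] at this
  exact List.singleton_perm.mp this |>.symm

theorem pderivs_single (i : Fin d) (v : Rd d → F) : pderivs (Pi.single i 1) v = pderiv i v := by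
  rw [pderivs_eq_wordDeriv, word_single]; rfl

theorem order_add_single (β : Fin d → ℕ) (i : Fin d) :
    order (β + Pi.single i 1) = order β + 1 := by
  simp [order, Finset.sum_add_distrib]

variable {D : Set (Rd d)}

theorem pderiv_congr (hD : IsOpen D) {u v : Rd d → F} (h : EqOn u v D) (i : Fin d) :
    EqOn (pderiv i u) (pderiv i v) D := by
  intro x hx
  have : u =ᶠ[𝓝 x] v := h.eventuallyEq_of_mem (hD.mem_nhds hx)
  simp only [pderiv, this.fderiv_eq]

theorem wordDeriv_congr (hD : IsOpen D) {u v : Rd d → F} (h : EqOn u v D) (w : List (Fin d)) :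
    EqOn (wordDeriv w u) (wordDeriv w v) D := by
  induction w generalizing u v with
  | nil => exact h
  | cons i w ih => exact ih (pderiv_congr hD h i)

theorem contDiffOn_pderiv (hD : IsOpen D) {n : ℕ} {v : Rd d → F}
    (hv : ContDiffOn ℝ (n + 1 : ℕ) v D) (i : Fin d) : ContDiffOn ℝ n (pderiv i v) D := by
  have hv' : ContDiffOn ℝ ((n : WithTop ℕ∞) + 1) v D := by exact_mod_cast hv
  have := ((contDiffOn_succ_iff_fderiv_of_isOpen hD).1 hv').2.2
  exact this.clm_apply contDiffOn_const

theorem contDiffOn_wordDeriv (hD : IsOpen D) {n : ℕ} {v : Rd d → F} (w : List (Fin d))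
    (hv : ContDiffOn ℝ (n + w.length : ℕ) v D) : ContDiffOn ℝ n (wordDeriv w v) D := by
  induction w generalizing v with
  | nil => exact hv
  | cons i w ih => exact ih (contDiffOn_pderiv hD hv i)

/-- Second partial derivatives commute. -/
theorem pderiv_comm (hD : IsOpen D) {v : Rd d → F} (hv : ContDiffOn ℝ 2 v D) (i j : Fin d) :
    EqOn (pderiv i (pderiv j v)) (pderiv j (pderiv i v)) D := by
  intro x hx
  have hvx : ContDiffAt ℝ 2 v x := hv.contDiffAt (hD.mem_nhds hx)
  have hs : IsSymmSndFDerivAt ℝ v x := hvx.isSymmSndFDerivAt (by simp)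
  have hd : DifferentiableAt ℝ (fderiv ℝ v) x :=
    (hvx.fderiv_right (m := 1) (by norm_num)).differentiableAt (by norm_num)
  have key : ∀ a b : Fin d, pderiv a (pderiv b v) x
      = fderiv ℝ (fderiv ℝ v) x (EuclideanSpace.single a 1) (EuclideanSpace.single b 1) := by
    intro a b
    have := hd.hasFDerivAt.clm_apply (hasFDerivAt_const (EuclideanSpace.single b (1 : ℝ)) x)
    change fderiv ℝ (fun y => fderiv ℝ v y (EuclideanSpace.single b 1)) x _ = _
    rw [this.fderiv]
    simp
  rw [key, key]
  exact hs.eq _ _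

theorem wordDeriv_perm (hD : IsOpen D) {w w' : List (Fin d)} (hw : w.Perm w') {v : Rd d → F}
    (hv : ContDiffOn ℝ (w.length : ℕ) v D) : EqOn (wordDeriv w v) (wordDeriv w' v) D := by
  induction hw generalizing v with
  | nil => exact fun _ _ => rfl
  | cons i _ ih => exact ih (contDiffOn_pderiv hD hv i)
  | swap i j l =>
    refine wordDeriv_congr hD (pderiv_comm hD (hv.of_le ?_) i j) l
    simp only [List.length_cons]
    exact_mod_cast (by omega : 2 ≤ l.length + 1 + 1)
  | trans h₁ _ ih₁ ih₂ => exact (ih₁ hv).trans (ih₂ (by rwa [← h₁.length_eq]))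

theorem pderiv_pderivs (hD : IsOpen D) {v : Rd d → F} {β : Fin d → ℕ}
    (hv : ContDiffOn ℝ (order β + 1 : ℕ) v D) (i : Fin d) :
    EqOn (pderiv i (pderivs β v)) (pderivs (β + Pi.single i 1) v) D := by
  rw [pderivs_eq_wordDeriv, pderivs_eq_wordDeriv]
  have := wordDeriv_perm hD (word_append_perm β i) (v := v) (by simpa [length_word] using hv)
  rwa [wordDeriv_append] at this

theorem contDiffOn_pderivs (hD : IsOpen D) {n : ℕ} {v : Rd d → F} {β : Fin d → ℕ}
    (hv : ContDiffOn ℝ (n + order β : ℕ) v D) : ContDiffOn ℝ n (pderivs β v) D := by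
  rw [pderivs_eq_wordDeriv]
  exact contDiffOn_wordDeriv hD _ (by rwa [length_word])

theorem norm_le_sum_single (L : Rd d →L[ℝ] F) :
    ‖L‖ ≤ ∑ i, ‖L (EuclideanSpace.single i 1)‖ := by
  refine L.opNorm_le_bound (by positivity) fun x => ?_
  have hx : L x = ∑ i, x i • L (EuclideanSpace.single i 1) := by
    conv_lhs => rw [← (EuclideanSpace.basisFun (Fin d) ℝ).sum_repr x]
    simp
  rw [hx, Finset.sum_mul]
  refine (norm_sum_le _ _).trans (Finset.sum_le_sum fun i _ => ?_)
  rw [norm_smul, mul_comm]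
  gcongr
  exact PiLp.norm_apply_le x i

/-- The linear map `c ↦ (ξ ↦ ξ_i c)`. -/
def coordSmul (i : Fin d) : F →L[ℝ] Rd d →L[ℝ] F :=
  ContinuousLinearMap.smulRightL ℝ (Rd d) F (EuclideanSpace.proj i)

theorem norm_coordSmul_le (i : Fin d) : ‖(coordSmul i : F →L[ℝ] Rd d →L[ℝ] F)‖ ≤ 1 := by
  refine ContinuousLinearMap.opNorm_le_bound _ zero_le_one fun c => ?_
  refine ContinuousLinearMap.opNorm_le_bound _ (by positivity) fun x => ?_
  change ‖x i • c‖ ≤ _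
  rw [norm_smul, one_mul, mul_comm]
  gcongr
  exact PiLp.norm_apply_le x i

theorem sum_coordSmul (L : Rd d →L[ℝ] F) :
    ∑ i, coordSmul i (L (EuclideanSpace.single i 1)) = L := by
  ext x
  conv_rhs => rw [← (EuclideanSpace.basisFun (Fin d) ℝ).sum_repr x]
  simp [coordSmul]

/-- Differentiability of `v` itself has to be assumed: the partial derivatives are defined by means
of `fderiv`, which vanishes at points where `v` is not differentiable. -/
theorem contDiffOn_succ_of_pderiv (hD : IsOpen D) {n : ℕ} {v : Rd d → F}
    (hd : DifferentiableOn ℝ v D) (hv : ∀ i, ContDiffOn ℝ n (pderiv i v) D) :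
    ContDiffOn ℝ (n + 1 : ℕ) v D := by
  have : ContDiffOn ℝ n (fderiv ℝ v) D := by
    have h : fderiv ℝ v = fun x => ∑ i, coordSmul i (pderiv i v x) := by
      funext x; exact (sum_coordSmul (fderiv ℝ v x)).symm
    rw [h]
    exact ContDiffOn.sum fun i _ => (coordSmul (F := F) i).contDiff.comp_contDiffOn (hv i)
  exact_mod_cast (contDiffOn_succ_iff_fderiv_of_isOpen hD).2 ⟨hd, by simp, this⟩

end Words

/-! ### Sums over multi-indices -/

section MultiIndex

variable {d : ℕ}

theorem mfact_add_single (β : Fin d → ℕ) (i : Fin d) :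
    mfact (β + Pi.single i 1) = (β i + 1) * mfact β := by
  unfold mfact
  rw [← Finset.mul_prod_erase _ _ (Finset.mem_univ i),
    ← Finset.mul_prod_erase _ (fun i => (β i).factorial) (Finset.mem_univ i)]
  simp only [Pi.add_apply, Pi.single_eq_same, Nat.factorial_succ]
  rw [mul_assoc]
  congr 2
  refine Finset.prod_congr rfl fun j hj => ?_
  simp [Finset.ne_of_mem_erase hj]

theorem mfact_pos (β : Fin d → ℕ) : 0 < mfact β :=
  Finset.prod_pos fun _ _ => Nat.factorial_pos _

/-- Euler's identity for weighted sums over the multi-indices of order `j + 1`. -/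
theorem sum_sum_add_single {R : Type*} [CommSemiring R] (c G : (Fin d → ℕ) → R)
    (hc : ∀ β i, ((β i : R) + 1) * c (β + Pi.single i 1) = c β) (j : ℕ) :
    ∑ i, ∑ β ∈ Finset.piAntidiag Finset.univ j, c β * G (β + Pi.single i 1)
      = ((j : R) + 1) * ∑ β ∈ Finset.piAntidiag (Finset.univ : Finset (Fin d)) (j + 1),
          c β * G β := by
  have h1 : ((j : R) + 1) * ∑ β ∈ Finset.piAntidiag (Finset.univ : Finset (Fin d)) (j + 1),
      c β * G β = ∑ i, ∑ β ∈ Finset.piAntidiag (Finset.univ : Finset (Fin d)) (j + 1),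
        (β i : R) * (c β * G β) := by
    rw [Finset.sum_comm, Finset.mul_sum]
    refine Finset.sum_congr rfl fun β hβ => ?_
    rw [← Finset.sum_mul]
    have := (Finset.mem_piAntidiag.1 hβ).1
    rw [← Nat.cast_sum, this]
    push_cast; ring
  rw [h1]
  refine Finset.sum_congr rfl fun i _ => ?_
  have h2 : ∑ β ∈ Finset.piAntidiag (Finset.univ : Finset (Fin d)) (j + 1),
        (β i : R) * (c β * G β) = ∑ β ∈ (Finset.piAntidiag (Finset.univ : Finset (Fin d))
          (j + 1)).filter (fun β => β i ≠ 0), (β i : R) * (c β * G β) := by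
    rw [Finset.sum_filter]
    refine Finset.sum_congr rfl fun β _ => ?_
    by_cases h : β i = 0 <;> simp [h]
  rw [h2]
  -- `β ↦ β + e_i` maps the multi-indices of order `j` onto those of order `j + 1` with `β_i ≠ 0`.
  refine Finset.sum_bij (fun β _ => β + Pi.single i 1) ?_ ?_ ?_ ?_
  · intro β hβ
    have := (Finset.mem_piAntidiag.1 hβ).1
    simp [Finset.mem_piAntidiag, Finset.sum_add_distrib, this]
  · intro a _ b _ h
    exact add_right_cancel h
  · intro β hβ
    rw [Finset.mem_filter] at hβ
    have hle : Pi.single i 1 ≤ β := by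
      intro k
      by_cases h : k = i
      · subst h; simp; omega
      · simp [h]
    refine ⟨β - Pi.single i 1, ?_, tsub_add_cancel_of_le hle⟩
    have hs := (Finset.mem_piAntidiag.1 hβ.1).1
    have : β = (β - Pi.single i 1) + Pi.single i 1 := (tsub_add_cancel_of_le hle).symm
    rw [this] at hs
    rw [Finset.mem_piAntidiag]
    simp only [Pi.add_apply, Finset.sum_add_distrib, Finset.sum_pi_single', Finset.mem_univ,
      if_true] at hs
    exact ⟨by simpa using hs, by simp⟩
  · intro β _
    rw [← mul_assoc, ← hc β i]
    simp

theorem sum_multiIdx {R : Type*} [AddCommMonoid R] (η : ℕ) (f : (Fin d → ℕ) → R) :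
    ∑ β ∈ multiIdx d η, f β =
      ∑ j ∈ Finset.range (η + 1), ∑ β ∈ Finset.piAntidiag Finset.univ j, f β := by
  rw [Finset.sum_sigma']
  refine Finset.sum_bij' (fun β _ => ⟨order β, β⟩) (fun x _ => x.2) ?_ ?_ ?_ ?_ ?_
  · intro β hβ
    simp only [multiIdx, Finset.mem_filter] at hβ
    simp only [Finset.mem_sigma, Finset.mem_range, Finset.mem_piAntidiag]
    exact ⟨by omega, rfl, by simp⟩
  · rintro ⟨j, β⟩ h
    simp only [Finset.mem_sigma, Finset.mem_range, Finset.mem_piAntidiag] at h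
    simp only [multiIdx, Finset.mem_filter, Fintype.mem_piFinset, Finset.mem_range]
    have h1 : order β = j := h.2.1
    refine ⟨fun i => ?_, by omega⟩
    have : β i ≤ order β := Finset.single_le_sum (fun _ _ => Nat.zero_le _) (Finset.mem_univ i)
    omega
  · intro β _; rfl
  · rintro ⟨j, β⟩ h
    simp only [Finset.mem_sigma, Finset.mem_range, Finset.mem_piAntidiag] at h
    have h1 : order β = j := h.2.1
    simp [h1]
  · intro β _; rfl

theorem mem_multiIdx {η : ℕ} {β : Fin d → ℕ} : β ∈ multiIdx d η ↔ order β ≤ η := by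
  simp only [multiIdx, Finset.mem_filter, Fintype.mem_piFinset, Finset.mem_range,
    and_iff_right_iff_imp]
  intro h i
  have : β i ≤ order β := Finset.single_le_sum (fun _ _ => Nat.zero_le _) (Finset.mem_univ i)
  omega

end MultiIndex

/-! ### Integrals of derivatives of Lipschitz functions -/

section Lipschitz

variable {d : ℕ} {F : Type*} [NormedAddCommGroup F] [NormedSpace ℝ F]

/-- Nearby points are compared in a compact neighbourhood of the support, distant points by the
boundedness of `h`. -/
theorem exists_lipschitzWith_of_hasCompactSupport {G : Type*} [NormedAddCommGroup G]
    {h : Rd d → G} (hl : LocallyLipschitz h)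
    (hc : HasCompactSupport h) : ∃ C, LipschitzWith C h := by
  set K := Metric.cthickening 1 (tsupport h) with hK
  have hKc : IsCompact K := IsCompact.cthickening hc
  obtain ⟨C, hC⟩ := (hl.locallyLipschitzOn (s := K)).exists_lipschitzOnWith_of_compact hKc
  obtain ⟨M, hM⟩ := hl.continuous.norm.bounded_above_of_compact_support hc.norm
  have hM' : ∀ x, ‖h x‖ ≤ max M 0 := fun x => by
    have := hM x; rw [norm_norm] at this; exact this.trans (le_max_left _ _)
  have key : ∀ x y, x ∈ tsupport h → dist (h x) (h y) ≤ (C + 2 * max M 0) * dist x y := by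
    intro x y hx
    have hm : (0 : ℝ) ≤ max M 0 := le_max_right _ _
    by_cases hxy : dist x y ≤ 1
    · have hxK : x ∈ K := Metric.self_subset_cthickening _ hx
      have hyK : y ∈ K := Metric.mem_cthickening_of_dist_le y x 1 _ hx (by rwa [dist_comm])
      have := hC.dist_le_mul x hxK y hyK
      nlinarith [dist_nonneg (x := x) (y := y)]
    · push Not at hxy
      have h1 : dist (h x) (h y) ≤ 2 * max M 0 := by
        rw [dist_eq_norm]
        have := norm_sub_le (h x) (h y)
        linarith [hM' x, hM' y]
      have h2 : (2 * max M 0) * 1 ≤ (2 * max M 0) * dist x y := by gcongr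
      have h3 : 0 ≤ (C : ℝ) * dist x y := by positivity
      linarith
  refine ⟨C + 2 * (max M 0).toNNReal, LipschitzWith.of_dist_le_mul fun x y => ?_⟩
  have hcast : ((C + 2 * (max M 0).toNNReal : ℝ≥0) : ℝ) = C + 2 * max M 0 := by
    push_cast; rw [Real.coe_toNNReal _ (le_max_right _ _)]
  rw [hcast]
  by_cases hx : x ∈ tsupport h
  · exact key x y hx
  by_cases hy : y ∈ tsupport h
  · rw [dist_comm, dist_comm x]; exact key y x hy
  · rw [image_eq_zero_of_notMem_tsupport hx, image_eq_zero_of_notMem_tsupport hy, dist_self]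
    have : (0 : ℝ) ≤ max M 0 := le_max_right _ _
    positivity

/-- The directional derivative of a compactly supported Lipschitz function is integrable with
vanishing integral: it is the dominated limit of difference quotients of vanishing integral. -/
theorem integral_fderiv_apply_eq_zero {h : Rd d → F} {C : ℝ≥0} (hl : LipschitzWith C h)
    (hc : HasCompactSupport h) (hd : ∀ᵐ x, DifferentiableAt ℝ h x) (e : Rd d) :
    Integrable (fun x => fderiv ℝ h x e) ∧ ∫ x, fderiv ℝ h x e = 0 := by
  set q : ℕ → Rd d → F := fun n x => ((n : ℝ) + 1) • (h (x + ((n : ℝ) + 1)⁻¹ • e) - h x) with hq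
  set K := Metric.cthickening ‖e‖ (tsupport h) with hK
  have hKc : IsCompact K := IsCompact.cthickening hc
  have hcont : ∀ n, Continuous (q n) := fun n => by
    have := hl.continuous
    simp only [hq]; fun_prop
  have hint : ∀ n, ∫ x, q n x = 0 := by
    intro n
    simp only [hq]
    have hi : Integrable h := hl.continuous.integrable_of_hasCompactSupport hc
    rw [integral_smul, integral_sub (hi.comp_add_right _) hi, integral_add_right_eq_self, sub_self,
      smul_zero]
  have hbd : ∀ n x, ‖q n x‖ ≤ K.indicator (fun _ => (C : ℝ) * ‖e‖) x := by
    intro n x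
    have hn : (0 : ℝ) < (n : ℝ) + 1 := by positivity
    by_cases hx : x ∈ K
    · rw [indicator_of_mem hx, hq, norm_smul, Real.norm_of_nonneg hn.le]
      have := hl.norm_sub_le (x + ((n : ℝ) + 1)⁻¹ • e) x
      rw [add_sub_cancel_left, norm_smul, Real.norm_of_nonneg (inv_nonneg.2 hn.le)] at this
      calc ((n : ℝ) + 1) * ‖h (x + ((n : ℝ) + 1)⁻¹ • e) - h x‖
          ≤ ((n : ℝ) + 1) * (C * (((n : ℝ) + 1)⁻¹ * ‖e‖)) := by gcongr
        _ = C * ‖e‖ := by field_simp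
    · rw [indicator_of_notMem hx]
      have h0 : x ∉ tsupport h := fun hx' => hx (Metric.self_subset_cthickening _ hx')
      have h1 : x + ((n : ℝ) + 1)⁻¹ • e ∉ tsupport h := fun hx' => by
        refine hx (Metric.mem_cthickening_of_dist_le x _ _ _ hx' ?_)
        rw [dist_eq_norm, sub_add_cancel_left, norm_neg, norm_smul,
          Real.norm_of_nonneg (inv_nonneg.2 hn.le)]
        exact mul_le_of_le_one_left (norm_nonneg _)
          (inv_le_one_of_one_le₀ (by linarith [n.cast_nonneg (α := ℝ)]))
      simp only [hq]
      rw [image_eq_zero_of_notMem_tsupport h0, image_eq_zero_of_notMem_tsupport h1]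
      simp
  have hbi : Integrable (K.indicator (fun _ => (C : ℝ) * ‖e‖)) := by
    rw [integrable_indicator_iff hKc.measurableSet]
    exact integrableOn_const hKc.measure_lt_top.ne
  have hlim : ∀ᵐ x, Tendsto (fun n => q n x) atTop (𝓝 (fderiv ℝ h x e)) := by
    filter_upwards [hd] with x hx
    have hn : Tendsto (fun n : ℕ => ‖((n : ℝ) + 1)‖) atTop atTop := by
      refine tendsto_norm_atTop_atTop.comp ?_
      exact tendsto_atTop_add_const_right _ _ tendsto_natCast_atTop_atTop
    have := hx.hasFDerivAt.lim e hn (c := fun n : ℕ => (n : ℝ) + 1)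
    exact this
  refine ⟨?_, ?_⟩
  · refine hbi.mono' (aestronglyMeasurable_of_tendsto_ae atTop
      (fun n => (hcont n).aestronglyMeasurable) hlim) ?_
    filter_upwards [hlim] with x hx
    exact le_of_tendsto hx.norm (Eventually.of_forall fun n => hbd n x)
  · have := tendsto_integral_of_dominated_convergence _
      (fun n => (hcont n).aestronglyMeasurable) hbi (fun n => ae_of_all _ (hbd n)) hlim
    simp only [hint] at this
    exact (tendsto_nhds_unique tendsto_const_nhds this).symm

end Lipschitz

/-! ### Weak derivatives and Sobolev norms -/

section WeakDeriv

variable {d : ℕ} {F : Type*} [NormedAddCommGroup F] [NormedSpace ℝ F] {D : Set (Rd d)}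

theorem IsTest.pderiv {φ : Rd d → ℝ} (hφ : IsTest D φ) (i : Fin d) : IsTest D (pderiv i φ) := by
  have hsub : tsupport (DomainMapping.pderiv i φ) ⊆ tsupport φ :=
    (closure_mono (fun x hx => by
      simp only [DomainMapping.pderiv, Function.mem_support] at hx ⊢
      intro h; rw [h] at hx; simp at hx)).trans (tsupport_fderiv_subset ℝ)
  refine ⟨?_, hφ.compact.of_isClosed_subset (isClosed_tsupport _) hsub, hsub.trans hφ.supp⟩
  exact (hφ.smooth.fderiv_right (m := (⊤ : ℕ∞)) (by simp)).clm_apply contDiff_const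

theorem IsTest.pderivs {φ : Rd d → ℝ} (hφ : IsTest D φ) (β : Fin d → ℕ) :
    IsTest D (pderivs β φ) := by
  rw [pderivs_eq_wordDeriv]
  induction word β generalizing φ with
  | nil => exact hφ
  | cons i w ih => exact ih (hφ.pderiv i)

theorem IsTest.smul_eq_zero {φ : Rd d → ℝ} (hφ : IsTest D φ) (v : Rd d → F) {x : Rd d}
    (hx : x ∉ D) : φ x • v x = 0 := by
  rw [image_eq_zero_of_notMem_tsupport fun h => hx (hφ.supp h), zero_smul]

theorem IsTest.integrableOn_smul {φ : Rd d → ℝ} (hφ : IsTest D φ) {v : Rd d → F}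
    (hv : LocallyIntegrableOn v D) : IntegrableOn (fun x => φ x • v x) D := by
  have h1 : IntegrableOn v (tsupport φ) := hv.integrableOn_compact_subset hφ.supp hφ.compact
  have h2 : IntegrableOn (fun x => φ x • v x) (tsupport φ) :=
    h1.continuousOn_smul hφ.smooth.continuous.continuousOn hφ.compact
  have hs : Function.support (fun x => φ x • v x) ⊆ tsupport φ := fun x hx => by
    by_contra h
    exact hx (by simp [image_eq_zero_of_notMem_tsupport h])
  exact ((integrableOn_iff_integrable_of_support_subset hs).1 h2).integrableOn

theorem locallyLipschitzOn_comp {E G : Type*} [NormedAddCommGroup E] [NormedSpace ℝ E]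
    [NormedAddCommGroup G] [NormedSpace ℝ G] {X : Type*} [PseudoEMetricSpace X] {s : Set X}
    {Φ : E → G} {A : X → E} (hA : LocallyLipschitzOn s A)
    (hΦ : ∀ x ∈ s, ContDiffAt ℝ 1 Φ (A x)) : LocallyLipschitzOn s (fun x => Φ (A x)) := by
  intro x hx
  obtain ⟨K, t, ht, hK⟩ := hA hx
  obtain ⟨K', t', ht', hK'⟩ := (hΦ x hx).exists_lipschitzOnWith
  have hcont : ContinuousWithinAt A s x := hA.continuousOn x hx
  refine ⟨K' * K, t ∩ A ⁻¹' t', inter_mem ht (hcont ht'), ?_⟩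
  exact hK'.comp (hK.mono inter_subset_left) (fun y hy => hy.2)

theorem locallyLipschitzOn_prodMk {E G X : Type*} [PseudoEMetricSpace X] [PseudoEMetricSpace E]
    [PseudoEMetricSpace G] {s : Set X} {u : X → E} {v : X → G} (hu : LocallyLipschitzOn s u)
    (hv : LocallyLipschitzOn s v) : LocallyLipschitzOn s (fun x => (u x, v x)) := by
  intro x hx
  obtain ⟨K, t, ht, hK⟩ := hu hx
  obtain ⟨K', t', ht', hK'⟩ := hv hx
  exact ⟨max K K', t ∩ t', inter_mem ht ht',
    (hK.mono inter_subset_left).prodMk (hK'.mono inter_subset_right)⟩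

/-- Integration by parts of a locally Lipschitz function against a test function. -/
theorem integral_pderiv_smul (hD : IsOpen D) {v w : Rd d → F} {i : Fin d}
    (hv : LocallyLipschitzOn D v)
    (hw : ∀ᵐ x ∂volume.restrict D, DifferentiableAt ℝ v x ∧
      fderiv ℝ v x (EuclideanSpace.single i 1) = w x)
    {φ : Rd d → ℝ} (hφ : IsTest D φ) :
    ∫ x in D, pderiv i φ x • v x = - ∫ x in D, φ x • w x := by
  set e : Rd d := EuclideanSpace.single i 1 with he
  set h : Rd d → F := fun x => φ x • v x with hh
  have hdφ : Differentiable ℝ φ := hφ.smooth.differentiable (by simp)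
  have hout : ∀ x ∉ tsupport φ, h =ᶠ[𝓝 x] fun _ => 0 := fun x hx => by
    filter_upwards [(isClosed_tsupport φ).isOpen_compl.mem_nhds hx] with y hy
    simp [hh, image_eq_zero_of_notMem_tsupport hy]
  have hlip : LocallyLipschitz h := by
    intro x
    by_cases hx : x ∈ tsupport φ
    · have hxD := hφ.supp hx
      have hpair : LocallyLipschitzOn D (fun x => (φ x, v x)) :=
        locallyLipschitzOn_prodMk
          ((hφ.smooth.of_le (by simp)).locallyLipschitz.locallyLipschitzOn) hv
      have := locallyLipschitzOn_comp (Φ := fun p : ℝ × F => p.1 • p.2) hpair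
        (fun x _ => (contDiff_fst.smul contDiff_snd).contDiffAt)
      obtain ⟨K, t, ht, hK⟩ := this hxD
      rw [nhdsWithin_eq_nhds.2 (hD.mem_nhds hxD)] at ht
      exact ⟨K, t, ht, hK⟩
    · refine ⟨0, _, hout x hx, ?_⟩
      intro a ha b hb
      rw [mem_ofPred_eq] at ha hb
      rw [ha, hb]; simp
  have hcs : HasCompactSupport h := hφ.compact.smul_right
  obtain ⟨C, hC⟩ := exists_lipschitzWith_of_hasCompactSupport hlip hcs
  have hprod : ∀ᵐ x ∂volume.restrict D, DifferentiableAt ℝ h x ∧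
      fderiv ℝ h x e = pderiv i φ x • v x + φ x • w x := by
    filter_upwards [hw] with x hx
    have := (hdφ x).hasFDerivAt.smul hx.1.hasFDerivAt
    refine ⟨this.differentiableAt, ?_⟩
    have h2 : fderiv ℝ h x = _ := this.fderiv
    rw [h2]
    rw [← hx.2]
    simp [pderiv, he, add_comm]
  have hdiff : ∀ᵐ x, DifferentiableAt ℝ h x := by
    filter_upwards [(ae_restrict_iff' hD.measurableSet).1 hprod] with x hx
    by_cases hxD : x ∈ D
    · exact (hx hxD).1
    · exact ((hout x fun h => hxD (hφ.supp h)).differentiableAt_iff).2 (differentiableAt_const _)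
  obtain ⟨hi, h0⟩ := integral_fderiv_apply_eq_zero hC hcs hdiff e
  have hD0 : ∫ x in D, fderiv ℝ h x e = 0 := by
    rw [setIntegral_eq_integral_of_forall_compl_eq_zero, h0]
    intro x hx
    rw [(hout x fun h => hx (hφ.supp h)).fderiv_eq]; simp
  have hvi : IntegrableOn (fun x => pderiv i φ x • v x) D :=
    (hφ.pderiv i).integrableOn_smul (hv.continuousOn.locallyIntegrableOn hD.measurableSet)
  have : ∫ x in D, φ x • w x = ∫ x in D, (fderiv ℝ h x e - pderiv i φ x • v x) := by
    refine integral_congr_ae ?_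
    filter_upwards [hprod] with x hx
    rw [hx.2, add_sub_cancel_left]
  rw [this, integral_sub hi.integrableOn hvi, hD0, zero_sub, neg_neg]

/-- A locally Lipschitz function, differentiable almost everywhere with partial derivative `w`, has
the weak derivatives of `w` as its own. -/
theorem HasWeakDeriv.add_single (hD : IsOpen D) {v w z : Rd d → F} {i : Fin d} {β : Fin d → ℕ}
    (hv : LocallyLipschitzOn D v)
    (hw : ∀ᵐ x ∂volume.restrict D, DifferentiableAt ℝ v x ∧
      fderiv ℝ v x (EuclideanSpace.single i 1) = w x)
    (hz : HasWeakDeriv D β w z) : HasWeakDeriv D (β + Pi.single i 1) v z := by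
  refine ⟨hv.continuousOn.locallyIntegrableOn hD.measurableSet, hz.locInt', fun φ hφ => ?_⟩
  have h1 : pderivs (β + Pi.single i 1) φ = pderiv i (pderivs β φ) := by
    funext x
    exact (pderiv_pderivs isOpen_univ (hφ.smooth.contDiffOn.of_le (by exact_mod_cast le_top)) i
      (mem_univ x)).symm
  rw [h1, integral_pderiv_smul hD hv hw (hφ.pderivs β), hz.integral_eq φ hφ, order_add_single,
    pow_succ, mul_neg_one, neg_smul]

theorem HasWeakDeriv.zero_self {v : Rd d → F} (hv : LocallyIntegrableOn v D) :
    HasWeakDeriv D 0 v v :=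
  ⟨hv, hv, fun φ _ => by simp [pderivs_zero, order]⟩

/-- The weak derivative of order zero is the function itself. -/
theorem HasWeakDeriv.ae_eq [CompleteSpace F] (hD : IsOpen D) {v w : Rd d → F}
    (h : HasWeakDeriv D 0 v w) : v =ᵐ[volume.restrict D] w := by
  have := hD.ae_eq_zero_of_integral_contDiff_smul_eq_zero (μ := volume) (f := v - w)
    (h.locInt.sub h.locInt') (fun φ h1 h2 h3 => by
      have hφ : IsTest D φ := ⟨h1, h2, h3⟩
      have := h.integral_eq φ hφ
      simp only [pderivs_zero, order, Pi.zero_apply, Finset.sum_const_zero, pow_zero, one_smul]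
        at this
      rw [← setIntegral_eq_integral_of_forall_compl_eq_zero
        (fun x hx => hφ.smul_eq_zero (v - w) hx)]
      simp only [Pi.sub_apply, smul_sub]
      rw [integral_sub (hφ.integrableOn_smul h.locInt) (hφ.integrableOn_smul h.locInt'), this,
        sub_self])
  rw [EventuallyEq, ae_restrict_iff' hD.measurableSet]
  filter_upwards [this] with x hx hxD
  exact sub_eq_zero.1 (hx hxD)

/-- The `L^p`-norm of the weak derivative `∂^β v`. -/
def weakNorm (D : Set (Rd d)) (p : ℝ≥0∞) (β : Fin d → ℕ) (v : Rd d → F) : ℝ≥0∞ :=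
  ⨅ (w : Rd d → F) (_ : HasWeakDeriv D β v w), eLpNorm w p (volume.restrict D)

theorem sobolevNorm_eq (D : Set (Rd d)) (η : ℕ) (p : ℝ≥0∞) (v : Rd d → F) :
    sobolevNorm D η p v = ∑ β ∈ multiIdx d η, ((mfact β : ℕ) : ℝ≥0∞)⁻¹ * weakNorm D p β v := rfl

theorem eLpNorm_le_weakNorm [CompleteSpace F] (hD : IsOpen D) (p : ℝ≥0∞) (v : Rd d → F) :
    eLpNorm v p (volume.restrict D) ≤ weakNorm D p 0 v :=
  le_iInf₂ fun _ hw => (eLpNorm_congr_ae (hw.ae_eq hD)).le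

theorem zero_mem_multiIdx (η : ℕ) : (0 : Fin d → ℕ) ∈ multiIdx d η :=
  mem_multiIdx.2 (by simp [order])

theorem mfact_zero : mfact (0 : Fin d → ℕ) = 1 := by simp [mfact]

theorem eLpNorm_le_sobolevNorm [CompleteSpace F] (hD : IsOpen D) (η : ℕ) (p : ℝ≥0∞)
    (v : Rd d → F) : eLpNorm v p (volume.restrict D) ≤ sobolevNorm D η p v := by
  refine (eLpNorm_le_weakNorm hD p v).trans ?_
  rw [sobolevNorm_eq]
  refine le_trans (by simp [mfact_zero]) (Finset.single_le_sum
    (f := fun β => ((mfact β : ℕ) : ℝ≥0∞)⁻¹ * weakNorm D p β v)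
    (fun _ _ => zero_le) (zero_mem_multiIdx η))

/-- Weak derivatives of series which converge absolutely and uniformly, together with their weak
derivatives, may be taken term by term. -/
theorem HasWeakDeriv.tsum [CompleteSpace F] {β : Fin d → ℕ}
    {v w : ℕ → Rd d → F} {u : Rd d → F} {a b : ℕ → ℝ} (ha : Summable a) (hb : Summable b)
    (hva : ∀ᵐ x ∂volume.restrict D, ∀ r, ‖v r x‖ ≤ a r)
    (hwb : ∀ᵐ x ∂volume.restrict D, ∀ r, ‖w r x‖ ≤ b r)
    (hw : ∀ r, HasWeakDeriv D β (v r) (w r))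
    (hu : ∀ᵐ x ∂volume.restrict D, HasSum (fun r => v r x) (u x)) :
    HasWeakDeriv D β u (fun x => ∑' r, w r x) := by
  have loc : ∀ {z : ℕ → Rd d → F} {s : Rd d → F} {c : ℕ → ℝ}, Summable c →
      (∀ r, AEStronglyMeasurable (z r) (volume.restrict D)) →
      (∀ᵐ x ∂volume.restrict D, ∀ r, ‖z r x‖ ≤ c r) →
      (∀ᵐ x ∂volume.restrict D, HasSum (fun r => z r x) (s x)) → LocallyIntegrableOn s D := by
    intro z s c hc hm hz hs
    refine locallyIntegrableOn_of_locallyIntegrable_restrict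
      (MemLp.locallyIntegrable (p := ∞) ?_ (by simp))
    refine memLp_top_of_bound (aestronglyMeasurable_of_tendsto_ae atTop
      (f := fun (t : Finset ℕ) x => ∑ r ∈ t, z r x)
      (fun t => Finset.aestronglyMeasurable_fun_sum t fun r _ => hm r) hs) (∑' r, c r) ?_
    filter_upwards [hz, hs] with x h1 h2
    rw [← h2.tsum_eq]
    exact tsum_of_norm_bounded hc.hasSum h1
  have hws : ∀ᵐ x ∂volume.restrict D, HasSum (fun r => w r x) (∑' r, w r x) := by
    filter_upwards [hwb] with x hx
    exact (Summable.of_norm_bounded hb hx).hasSum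
  have int : ∀ {z : ℕ → Rd d → F} {s : Rd d → F} {c : ℕ → ℝ} {φ : Rd d → ℝ}, IsTest D φ →
      Summable c → (∀ r, LocallyIntegrableOn (z r) D) →
      (∀ᵐ x ∂volume.restrict D, ∀ r, ‖z r x‖ ≤ c r) →
      (∀ᵐ x ∂volume.restrict D, HasSum (fun r => z r x) (s x)) →
      HasSum (fun r => ∫ x in D, φ x • z r x) (∫ x in D, φ x • s x) := by
    intro z s c φ hφ hc hm hz hs
    have hφi : IntegrableOn φ D :=
      (hφ.smooth.continuous.integrable_of_hasCompactSupport hφ.compact).integrableOn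
    have := hasSum_integral_of_summable_integral_norm (μ := volume.restrict D)
      (F := fun r x => φ x • z r x) (fun r => hφ.integrableOn_smul (hm r)) (by
        refine Summable.of_nonneg_of_le (fun r => integral_nonneg fun x => norm_nonneg _)
          (fun r => ?_) (hc.mul_left (∫ x in D, ‖φ x‖))
        rw [← integral_mul_const]
        refine integral_mono_ae (hφ.integrableOn_smul (hm r)).norm (hφi.norm.mul_const _) ?_
        filter_upwards [hz] with x hx
        rw [norm_smul]
        exact mul_le_mul_of_nonneg_left (hx r) (norm_nonneg _))
    convert this using 1
    refine integral_congr_ae ?_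
    filter_upwards [hs] with x hx
    exact ((hx.const_smul (φ x)).tsum_eq).symm
  refine ⟨loc ha (fun r => (hw r).locInt.aestronglyMeasurable) hva hu,
    loc hb (fun r => (hw r).locInt'.aestronglyMeasurable) hwb hws, fun φ hφ => ?_⟩
  have h1 := int (hφ.pderivs β) ha (fun r => (hw r).locInt) hva hu
  have h2 := (int hφ hb (fun r => (hw r).locInt') hwb hws).const_smul ((-1 : ℝ) ^ order β)
  simp only [(hw _).integral_eq φ hφ] at h1
  exact h1.unique h2

/-- Countable subadditivity of `weakNorm`. As it is an infimum, near-optimal representatives of the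
weak derivatives of the terms are chosen, with errors of sum at most `ε`. -/
theorem weakNorm_le_tsum [CompleteSpace F] (β : Fin d → ℕ) {v : ℕ → Rd d → F}
    {u : Rd d → F} (h0 : ∑' r, eLpNorm (v r) ∞ (volume.restrict D) ≠ ∞)
    (hu : ∀ᵐ x ∂volume.restrict D, HasSum (fun r => v r x) (u x)) :
    weakNorm D ∞ β u ≤ ∑' r, weakNorm D ∞ β (v r) := by
  refine ENNReal.le_of_forall_pos_le_add fun ε hε hfin => ?_
  obtain ⟨ε', hε', hsum⟩ := ENNReal.exists_pos_sum_of_countable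
    (ENNReal.coe_ne_zero.2 hε.ne') ℕ
  have hlt : ∀ r, weakNorm D ∞ β (v r) < weakNorm D ∞ β (v r) + ε' r := fun r =>
    ENNReal.lt_add_right (ENNReal.ne_top_of_tsum_ne_top hfin.ne r)
      (ENNReal.coe_ne_zero.2 (hε' r).ne')
  have : ∀ r, ∃ w, HasWeakDeriv D β (v r) w ∧
      eLpNorm w ∞ (volume.restrict D) < weakNorm D ∞ β (v r) + ε' r := fun r => by
    have h := hlt r
    conv_lhs at h => rw [weakNorm]
    simpa [iInf_lt_iff] using h
  choose w hw hwlt using this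
  have hwfin : ∑' r, eLpNorm (w r) ∞ (volume.restrict D) ≤ ∑' r, weakNorm D ∞ β (v r) + ε := by
    refine (ENNReal.tsum_le_tsum fun r => (hwlt r).le).trans ?_
    rw [ENNReal.tsum_add]
    gcongr
  have hwne : ∑' r, eLpNorm (w r) ∞ (volume.restrict D) ≠ ∞ :=
    (hwfin.trans_lt (by simp [hfin])).ne
  have bd : ∀ {z : ℕ → Rd d → F}, ∑' r, eLpNorm (z r) ∞ (volume.restrict D) ≠ ∞ →
      ∀ᵐ x ∂volume.restrict D, ∀ r,
        ‖z r x‖ ≤ (eLpNorm (z r) ∞ (volume.restrict D)).toReal := by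
    intro z hz
    rw [ae_all_iff]
    intro r
    have hne := ENNReal.ne_top_of_tsum_ne_top hz r
    rw [eLpNorm_exponent_top] at hne ⊢
    filter_upwards [ae_le_eLpNormEssSup (f := z r) (μ := volume.restrict D)] with x hx
    rw [← toReal_enorm]
    exact ENNReal.toReal_mono hne hx
  have hW := HasWeakDeriv.tsum (ENNReal.summable_toReal h0) (ENNReal.summable_toReal hwne)
    (bd h0) (bd hwne) hw hu
  refine (iInf₂_le _ hW).trans (le_trans ?_ hwfin)
  rw [eLpNorm_exponent_top]
  refine eLpNormEssSup_le_of_ae_enorm_bound ?_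
  filter_upwards [bd hwne] with x hx
  have hs := ENNReal.summable_toReal hwne
  have h1 := tsum_of_norm_bounded hs.hasSum hx
  rw [← ofReal_norm]
  refine (ENNReal.ofReal_le_ofReal h1).trans ?_
  rw [ENNReal.ofReal_tsum_of_nonneg (fun r => ENNReal.toReal_nonneg) hs]
  exact ENNReal.tsum_le_tsum fun r => ENNReal.ofReal_toReal_le

/-- Countable subadditivity of the norm of `W^{η,∞}(D)`. -/
theorem sobolevNorm_le_tsum [CompleteSpace F] (hD : IsOpen D) (η : ℕ) {v : ℕ → Rd d → F}
    {u : Rd d → F} (hu : ∀ᵐ x ∂volume.restrict D, HasSum (fun r => v r x) (u x)) :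
    sobolevNorm D η ∞ u ≤ ∑' r, sobolevNorm D η ∞ (v r) := by
  by_cases hfin : ∑' r, sobolevNorm D η ∞ (v r) = ∞
  · rw [hfin]; exact le_top
  have h0 : ∑' r, eLpNorm (v r) ∞ (volume.restrict D) ≠ ∞ :=
    ne_top_of_le_ne_top hfin (ENNReal.tsum_le_tsum fun r => eLpNorm_le_sobolevNorm hD η ∞ _)
  simp only [sobolevNorm_eq]
  rw [Summable.tsum_finsetSum fun _ _ => ENNReal.summable]
  refine Finset.sum_le_sum fun β _ => ?_
  rw [ENNReal.tsum_mul_left]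
  gcongr
  exact weakNorm_le_tsum β h0 hu

theorem sobolevNorm_congr_ae (η : ℕ) (p : ℝ≥0∞) {u v : Rd d → F}
    (h : u =ᵐ[volume.restrict D] v) : sobolevNorm D η p u = sobolevNorm D η p v := by
  have key : ∀ {u v : Rd d → F} (_ : u =ᵐ[volume.restrict D] v) {β w}, HasWeakDeriv D β u w →
      HasWeakDeriv D β v w := by
    intro u v h β w hw
    refine ⟨hw.locInt.congr h, hw.locInt', fun φ hφ => ?_⟩
    rw [← hw.integral_eq φ hφ]
    refine integral_congr_ae ?_
    filter_upwards [h] with x hx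
    rw [hx]
  have : ∀ β w, HasWeakDeriv D β u w ↔ HasWeakDeriv D β v w := fun β w =>
    ⟨key h, key h.symm⟩
  simp only [sobolevNorm, this]

theorem eLpNorm_two_le {G : Type*} [NormedAddCommGroup G] (w : Rd d → G)
    (hw : AEStronglyMeasurable w (volume.restrict D)) :
    eLpNorm w 2 (volume.restrict D)
      ≤ volume D ^ (1 / 2 : ℝ) * eLpNorm w ∞ (volume.restrict D) := by
  have := eLpNorm_le_eLpNorm_mul_rpow_measure_univ (p := 2) (q := ∞) le_top hw
  rw [mul_comm]
  simpa using this

/-- On a domain of finite volume, the norm of `H^{τ-1}` is controlled by that of `W^{τ,∞}`. -/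
theorem predSobolevNorm_le (hD : IsOpen D) (hDne : D.Nonempty)
    (hDv : volume D ≠ ∞) (τ : ℕ) (g : Rd d → ℝ) :
    predSobolevNorm D τ g ≤ volume D ^ (1 / 2 : ℝ) * sobolevNorm D τ ∞ g := by
  have hpos : volume D ^ (1 / 2 : ℝ) ≠ 0 := by
    have := hD.measure_pos volume hDne
    simp [ENNReal.rpow_eq_zero_iff, this.ne']
  have hne : volume D ^ (1 / 2 : ℝ) ≠ ∞ := ENNReal.rpow_ne_top_of_nonneg (by norm_num) hDv
  cases τ with
  | zero =>
    -- The case distinction provides local integrability of `g`, without which `dualSobolevNorm` is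
    -- infinite.
    by_cases hfin : sobolevNorm D 0 ∞ g = ∞
    · rw [hfin, ENNReal.mul_top hpos]; exact le_top
    have hw : ∃ w, HasWeakDeriv D 0 g w := by
      by_contra hcon
      push Not at hcon
      refine hfin ?_
      rw [sobolevNorm_eq, ENNReal.sum_eq_top]
      refine ⟨0, zero_mem_multiIdx 0, ?_⟩
      rw [mfact_zero, weakNorm]
      simp [hcon]
    obtain ⟨w, hw⟩ := hw
    rw [predSobolevNorm, dualSobolevNorm, if_pos hw.locInt]
    have hgm := hw.locInt.aestronglyMeasurable
    refine iSup_le fun φ => iSup_le fun hφ => iSup_le fun h1 => ?_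
    have hφm : AEStronglyMeasurable φ (volume.restrict D) :=
      hφ.smooth.continuous.aestronglyMeasurable
    -- The Cauchy–Schwarz inequality; `‖φ‖_{L²} ≤ ‖φ‖_{H¹} ≤ 1`.
    calc ‖∫ x in D, g x * φ x‖ₑ ≤ ∫⁻ x in D, ‖(g • φ) x‖ₑ := enorm_integral_le_lintegral_enorm _
      _ = eLpNorm (g • φ) 1 (volume.restrict D) := eLpNorm_one_eq_lintegral_enorm.symm
      _ ≤ eLpNorm g 2 (volume.restrict D) * eLpNorm φ 2 (volume.restrict D) :=
          eLpNorm_smul_le_mul_eLpNorm hφm hgm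
      _ ≤ (volume D ^ (1 / 2 : ℝ) * eLpNorm g ∞ (volume.restrict D)) * 1 :=
          mul_le_mul' (eLpNorm_two_le g hgm) ((eLpNorm_le_sobolevNorm hD 1 2 φ).trans h1)
      _ ≤ _ := by rw [mul_one]; gcongr; exact eLpNorm_le_sobolevNorm hD 0 ∞ g
  | succ m =>
    rw [predSobolevNorm, sobolevNorm_eq, sobolevNorm_eq, Finset.mul_sum]
    refine le_trans (Finset.sum_le_sum fun β _ => ?_)
      (Finset.sum_le_sum_of_subset (fun β hβ => mem_multiIdx.2
        ((mem_multiIdx.1 hβ).trans (Nat.le_succ m))))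
    rw [mul_left_comm]
    gcongr
    rw [weakNorm, weakNorm]
    refine le_of_le_of_eq (b := ⨅ (w : Rd d → ℝ) (_ : HasWeakDeriv D β g w),
      volume D ^ (1 / 2 : ℝ) * eLpNorm w ∞ (volume.restrict D)) ?_ ?_
    · exact iInf₂_mono fun w hw => eLpNorm_two_le w hw.locInt'.aestronglyMeasurable
    · rw [ENNReal.mul_iInf_of_ne hpos hne]
      refine iInf_congr fun w => ?_
      rw [ENNReal.mul_iInf_of_ne hpos hne]

end WeakDeriv

/-! ### Majorant series -/

section Majorant

variable {d : ℕ} {E F G : Type*} [NormedAddCommGroup E] [NormedSpace ℝ E]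
  [NormedAddCommGroup F] [NormedSpace ℝ F] [NormedAddCommGroup G] [NormedSpace ℝ G]
  {D : Set (Rd d)}

/-- `p` majorizes `v` on `D` up to order `m`: the function `v` has bounded weak derivatives up to
order `m`, those of order less than `m` are locally Lipschitz, and
`∑_{|β| = j} (1/β!) ‖∂^β v‖_{L^∞(D)} ≤ p_j` for `j ≤ m`. These homogeneous seminorms satisfy
`(j + 1) |v|_{j+1} = ∑_i |∂_i v|_j`, which is the recursion used here; the functions `w i` are the
partial derivatives of `v`, fixed up to null sets. -/
def HasMajorant (D : Set (Rd d)) : ℕ → PowerSeries ℝ≥0 → (Rd d → F) → Prop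
  | 0, p, v => AEStronglyMeasurable v (volume.restrict D) ∧
      ∀ᵐ x ∂volume.restrict D, ‖v x‖₊ ≤ p.coeff 0
  | m + 1, p, v => LocallyLipschitzOn D v ∧ (∀ᵐ x ∂volume.restrict D, ‖v x‖₊ ≤ p.coeff 0) ∧
      ∃ (w : Fin d → Rd d → F) (q : Fin d → PowerSeries ℝ≥0),
        (∀ i, HasMajorant D m (q i) (w i)) ∧
        (∀ j ≤ m, ∑ i, (q i).coeff j ≤ (j + 1) * p.coeff (j + 1)) ∧
        ∀ᵐ x ∂volume.restrict D, DifferentiableAt ℝ v x ∧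
          ∀ i, fderiv ℝ v x (EuclideanSpace.single i 1) = w i x

namespace HasMajorant

theorem ae_bound {m : ℕ} {p : PowerSeries ℝ≥0} {v : Rd d → F} (h : HasMajorant D m p v) :
    ∀ᵐ x ∂volume.restrict D, ‖v x‖₊ ≤ p.coeff 0 := by
  cases m with
  | zero => exact h.2
  | succ m => exact h.2.1

/-- The order of a majorant may be lowered. -/
theorem pred (hD : IsOpen D) {m : ℕ} {p : PowerSeries ℝ≥0} {v : Rd d → F}
    (h : HasMajorant D (m + 1) p v) : HasMajorant D m p v := by
  induction m generalizing p v with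
  | zero => exact ⟨h.1.continuousOn.aestronglyMeasurable hD.measurableSet, h.2.1⟩
  | succ m ih =>
    obtain ⟨h1, h2, w, s, h3, h4, h5⟩ := h
    exact ⟨h1, h2, w, s, fun i => ih (h3 i), fun j hj => h4 j (by omega), h5⟩

theorem order_zero (hD : IsOpen D) {m : ℕ} {p : PowerSeries ℝ≥0} {v : Rd d → F}
    (h : HasMajorant D m p v) : HasMajorant D 0 p v := by
  induction m with
  | zero => exact h
  | succ m ih => exact ih (h.pred hD)

theorem congr (hD : IsOpen D) {m : ℕ} {p : PowerSeries ℝ≥0} {u v : Rd d → F}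
    (h : HasMajorant D m p u) (huv : EqOn u v D) : HasMajorant D m p v := by
  have hae : u =ᵐ[volume.restrict D] v := huv.aeEq_restrict hD.measurableSet
  cases m with
  | zero =>
    refine ⟨h.1.congr hae, ?_⟩
    filter_upwards [h.2, hae] with x h1 h2
    rwa [← h2]
  | succ m =>
    obtain ⟨h1, h2, w, s, h3, h4, h5⟩ := h
    refine ⟨fun x hx => ?_, ?_, w, s, h3, h4, ?_⟩
    · obtain ⟨K, t, ht, hK⟩ := h1 hx
      refine ⟨K, t ∩ D, inter_mem ht self_mem_nhdsWithin, fun a ha b hb => ?_⟩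
      rw [← huv ha.2, ← huv hb.2]
      exact hK ha.1 hb.1
    · filter_upwards [h2, hae] with x h1 h2
      rwa [← h2]
    · filter_upwards [h5, ae_restrict_mem hD.measurableSet] with x hx hxD
      have : u =ᶠ[𝓝 x] v := huv.eventuallyEq_of_mem (hD.mem_nhds hxD)
      rw [← this.fderiv_eq, ← this.differentiableAt_iff]
      exact hx

/-- For order zero, almost everywhere equality suffices; for positive order, the values of the
function at all points of `D` matter, because local Lipschitz continuity is required. -/
theorem congr_ae {p : PowerSeries ℝ≥0} {u v : Rd d → F} (h : HasMajorant D 0 p u)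
    (huv : u =ᵐ[volume.restrict D] v) : HasMajorant D 0 p v := by
  refine ⟨h.1.congr huv, ?_⟩
  filter_upwards [h.2, huv] with x h1 h2
  rwa [← h2]

theorem add {m : ℕ} {p q : PowerSeries ℝ≥0} {u v : Rd d → F} (hu : HasMajorant D m p u)
    (hv : HasMajorant D m q v) : HasMajorant D m (p + q) (fun x => u x + v x) := by
  have hb : ∀ᵐ x ∂volume.restrict D, ‖u x + v x‖₊ ≤ (p + q).coeff 0 := by
    filter_upwards [hu.ae_bound, hv.ae_bound] with x h1 h2
    rw [map_add]
    exact (nnnorm_add_le _ _).trans (add_le_add h1 h2)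
  induction m generalizing p q u v with
  | zero => exact ⟨hu.1.add hv.1, hb⟩
  | succ m ih =>
    obtain ⟨h1, h2, w, s, h3, h4, h5⟩ := hu
    obtain ⟨h1', h2', w', s', h3', h4', h5'⟩ := hv
    refine ⟨h1.add h1', hb, fun i x => w i x + w' i x, fun i => s i + s' i,
      fun i => ih (h3 i) (h3' i) ?_, fun j hj => ?_, ?_⟩
    · filter_upwards [(h3 i).ae_bound, (h3' i).ae_bound] with x h1 h2
      rw [map_add]
      exact (nnnorm_add_le _ _).trans (add_le_add h1 h2)
    · simp only [map_add, Finset.sum_add_distrib, mul_add]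
      exact add_le_add (h4 j hj) (h4' j hj)
    · filter_upwards [h5, h5'] with x hx hx'
      refine ⟨hx.1.add hx'.1, fun i => ?_⟩
      rw [fderiv_fun_add hx.1 hx'.1]
      simp [hx.2 i, hx'.2 i]

theorem zero (m : ℕ) : HasMajorant D m 0 (fun _ => (0 : F)) := by
  induction m with
  | zero => exact ⟨aestronglyMeasurable_const, by simp⟩
  | succ m ih =>
    refine ⟨(LocallyLipschitz.const _).locallyLipschitzOn, by simp, fun _ _ => 0, fun _ => 0,
      fun _ => ih, by simp, ae_of_all _ fun x => by simp⟩

theorem sum {m : ℕ} {ι : Type*} (s : Finset ι) {p : ι → PowerSeries ℝ≥0} {v : ι → Rd d → F}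
    (h : ∀ i ∈ s, HasMajorant D m (p i) (v i)) :
    HasMajorant D m (∑ i ∈ s, p i) (fun x => ∑ i ∈ s, v i x) := by
  classical
  induction s using Finset.induction_on with
  | empty => simpa using zero m
  | insert i s hi ih =>
    simp only [Finset.sum_insert hi]
    exact (h i (Finset.mem_insert_self _ _)).add
      (ih fun j hj => h j (Finset.mem_insert_of_mem hj))

end HasMajorant

theorem coeff_mul_le_coeff_mul {j : ℕ} {a a' b b' : PowerSeries ℝ≥0}
    (ha : ∀ k ≤ j, a.coeff k ≤ a'.coeff k) (hb : ∀ k ≤ j, b.coeff k ≤ b'.coeff k) :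
    (a * b).coeff j ≤ (a' * b').coeff j := by
  rw [PowerSeries.coeff_mul, PowerSeries.coeff_mul]
  refine Finset.sum_le_sum fun x hx => ?_
  have := Finset.HasAntidiagonal.mem_antidiagonal.1 hx
  exact mul_le_mul' (ha _ (by omega)) (hb _ (by omega))

theorem coeff_zero_mul_series (p q : PowerSeries ℝ≥0) :
    (p * q).coeff 0 = p.coeff 0 * q.coeff 0 := by
  simp

namespace HasMajorant

theorem bilinear_ae_bound (B : E →L[ℝ] F →L[ℝ] G) (hB : ‖B‖ ≤ 1) {m : ℕ}
    {p q : PowerSeries ℝ≥0} {u : Rd d → E} {v : Rd d → F} (hu : HasMajorant D m p u)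
    (hv : HasMajorant D m q v) :
    ∀ᵐ x ∂volume.restrict D, ‖B (u x) (v x)‖₊ ≤ (p * q).coeff 0 := by
  filter_upwards [hu.ae_bound, hv.ae_bound] with x h1 h2
  rw [coeff_zero_mul_series]
  calc ‖B (u x) (v x)‖₊ ≤ ‖B‖₊ * ‖u x‖₊ * ‖v x‖₊ := B.le_opNorm₂ _ _
    _ ≤ 1 * ‖u x‖₊ * ‖v x‖₊ := by gcongr; exact hB
    _ ≤ _ := by rw [one_mul]; exact mul_le_mul' h1 h2

/-- Leibniz's rule. -/
theorem bilinear (hD : IsOpen D) (B : E →L[ℝ] F →L[ℝ] G) (hB : ‖B‖ ≤ 1) {m : ℕ}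
    {p q : PowerSeries ℝ≥0} {u : Rd d → E} {v : Rd d → F} (hu : HasMajorant D m p u)
    (hv : HasMajorant D m q v) : HasMajorant D m (p * q) (fun x => B (u x) (v x)) := by
  induction m generalizing p q u v with
  | zero =>
    exact ⟨B.aestronglyMeasurable_comp₂ hu.1 hv.1, bilinear_ae_bound B hB hu hv⟩
  | succ m ih =>
    have hb := bilinear_ae_bound B hB hu hv
    have hu' := hu.pred hD
    have hv' := hv.pred hD
    obtain ⟨h1, h2, w, s, h3, h4, h5⟩ := hu
    obtain ⟨h1', h2', w', s', h3', h4', h5'⟩ := hv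
    refine ⟨?_, hb, fun i x => B (u x) (w' i x) + B (w i x) (v x),
      fun i => p * s' i + s i * q,
      fun i => (ih hu' (h3' i)).add (ih (h3 i) hv'),
      fun j hj => ?_, ?_⟩
    · exact locallyLipschitzOn_comp (Φ := fun z : E × F => B z.1 z.2)
        (locallyLipschitzOn_prodMk h1 h1') (fun x _ => B.isBoundedBilinearMap.contDiff.contDiffAt)
    · calc ∑ i, (p * s' i + s i * q).coeff j
          = (p * ∑ i, s' i).coeff j + ((∑ i, s i) * q).coeff j := by
            rw [Finset.mul_sum, Finset.sum_mul, map_sum, map_sum, ← Finset.sum_add_distrib]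
            simp
        _ ≤ (p * PowerSeries.derivative ℝ≥0 q).coeff j
            + (PowerSeries.derivative ℝ≥0 p * q).coeff j := by
            refine add_le_add (coeff_mul_le_coeff_mul (fun _ _ => le_rfl) fun k hk => ?_)
              (coeff_mul_le_coeff_mul (fun k hk => ?_) fun _ _ => le_rfl)
            · rw [map_sum, PowerSeries.coeff_derivative, mul_comm]
              exact h4' k (hk.trans hj)
            · rw [map_sum, PowerSeries.coeff_derivative, mul_comm]
              exact h4 k (hk.trans hj)
        _ = (PowerSeries.derivative ℝ≥0 (p * q)).coeff j := by
            rw [Derivation.leibniz, map_add]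
            simp only [smul_eq_mul]
            rw [mul_comm q]
        _ = (j + 1) * (p * q).coeff (j + 1) := by
            rw [PowerSeries.coeff_derivative, mul_comm]
    · filter_upwards [h5, h5'] with x hx hx'
      have := B.hasFDerivAt_of_bilinear hx.1.hasFDerivAt hx'.1.hasFDerivAt
      refine ⟨this.differentiableAt, fun i => ?_⟩
      rw [this.fderiv]
      simp [hx.2 i, hx'.2 i]

/-- Linear maps of norm at most `1` preserve majorants. -/
theorem clm (L : F →L[ℝ] G) (hL : ‖L‖ ≤ 1) {m : ℕ}
    {p : PowerSeries ℝ≥0} {v : Rd d → F} (hv : HasMajorant D m p v) :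
    HasMajorant D m p (fun x => L (v x)) := by
  have hb : ∀ {v : Rd d → F} {m p}, HasMajorant D m p v →
      ∀ᵐ x ∂volume.restrict D, ‖L (v x)‖₊ ≤ p.coeff 0 := by
    intro v m p hv
    filter_upwards [hv.ae_bound] with x h1
    exact (L.le_of_opNorm_le hL (v x)).trans (by rw [one_mul]; exact_mod_cast h1)
  induction m generalizing p v with
  | zero => exact ⟨L.continuous.comp_aestronglyMeasurable hv.1, hb hv⟩
  | succ m ih =>
    have hbv := hb hv
    obtain ⟨h1, h2, w, s, h3, h4, h5⟩ := hv
    refine ⟨?_, hbv, fun i x => L (w i x), s, fun i => ih (h3 i), h4, ?_⟩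
    · exact locallyLipschitzOn_comp h1 (fun x _ => L.contDiff.contDiffAt)
    · filter_upwards [h5] with x hx
      refine ⟨L.differentiableAt.comp x hx.1, fun i => ?_⟩
      have := (L.hasFDerivAt (x := v x)).comp x hx.1.hasFDerivAt
      have h2 : fderiv ℝ (fun x => L (v x)) x = _ := this.fderiv
      rw [h2]
      simp [hx.2 i]

theorem const_smul {m : ℕ} {p : PowerSeries ℝ≥0} {v : Rd d → F} (hv : HasMajorant D m p v)
    (c : ℝ) : HasMajorant D m (PowerSeries.C ‖c‖₊ * p) (fun x => c • v x) := by
  have hb : ∀ {v : Rd d → F} {m p}, HasMajorant D m p v →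
      ∀ᵐ x ∂volume.restrict D, ‖c • v x‖₊ ≤ (PowerSeries.C ‖c‖₊ * p).coeff 0 := by
    intro v m p hv
    filter_upwards [hv.ae_bound] with x h1
    rw [nnnorm_smul, PowerSeries.coeff_C_mul]
    gcongr
  induction m generalizing p v with
  | zero => exact ⟨hv.1.const_smul c, hb hv⟩
  | succ m ih =>
    have hbv := hb hv
    obtain ⟨h1, h2, w, s, h3, h4, h5⟩ := hv
    refine ⟨?_, hbv, fun i x => c • w i x, fun i => PowerSeries.C ‖c‖₊ * s i,
      fun i => ih (h3 i), fun j hj => ?_, ?_⟩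
    · exact locallyLipschitzOn_comp (Φ := fun y : F => c • y) h1
        (fun x _ => (contDiff_const_smul c).contDiffAt)
    · simp only [PowerSeries.coeff_C_mul]
      rw [← Finset.mul_sum, mul_left_comm]
      gcongr
      exact h4 j hj
    · filter_upwards [h5] with x hx
      refine ⟨hx.1.const_smul c, fun i => ?_⟩
      rw [fderiv_fun_const_smul hx.1]
      simp [hx.2 i]

theorem prodMk {m : ℕ} {p q : PowerSeries ℝ≥0} {u : Rd d → E} {v : Rd d → F}
    (hu : HasMajorant D m p u) (hv : HasMajorant D m q v) :
    HasMajorant D m (p + q) (fun x => (u x, v x)) := by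
  have h := (hu.clm (ContinuousLinearMap.inl ℝ E F)
    (ContinuousLinearMap.norm_inl_le_one ℝ E F)).add (hv.clm (ContinuousLinearMap.inr ℝ E F)
    (ContinuousLinearMap.norm_inr_le_one ℝ E F))
  simpa using h

/-- Evaluation of a multilinear map depending on the point at functions. -/
theorem multilinear (hD : IsOpen D) {m n : ℕ} {q : PowerSeries ℝ≥0}
    {M : Rd d → E [×n]→L[ℝ] G} (hM : HasMajorant D m q M) {h : Fin n → Rd d → E}
    {P : Fin n → PowerSeries ℝ≥0} (hh : ∀ j, HasMajorant D m (P j) (h j)) :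
    HasMajorant D m (q * ∏ j, P j) (fun x => M x (fun j => h j x)) := by
  induction n generalizing q with
  | zero =>
    have := hM.clm
      ((continuousMultilinearCurryFin0 ℝ E G).toContinuousLinearEquiv : _ →L[ℝ] G) (by
        refine ContinuousLinearMap.opNorm_le_bound _ zero_le_one fun x => ?_
        rw [one_mul]
        exact ((continuousMultilinearCurryFin0 ℝ E G).norm_map x).le)
    simp only [Finset.univ_eq_empty, Finset.prod_empty, mul_one]
    refine this.congr hD fun x _ => ?_
    change M x 0 = _
    congr 1
    exact Subsingleton.elim _ _
  | succ n ih =>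
    have h1 := HasMajorant.bilinear hD
      ((continuousMultilinearCurryLeftEquiv ℝ (fun _ : Fin (n + 1) => E)
        G).toContinuousLinearEquiv : _ →L[ℝ] E →L[ℝ] (E [×n]→L[ℝ] G)) (by
        refine ContinuousLinearMap.opNorm_le_bound _ zero_le_one fun x => ?_
        rw [one_mul]
        exact ((continuousMultilinearCurryLeftEquiv ℝ (fun _ : Fin (n + 1) => E) G).norm_map
          x).le) hM (hh 0)
    have h2 := ih h1 (fun j => hh j.succ)
    rw [Fin.prod_univ_succ, ← mul_assoc]
    refine h2.congr hD fun x _ => ?_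
    change M x (Fin.cons (h 0 x) fun j : Fin n => h j.succ x) = _
    congr 1
    funext j
    refine Fin.cases ?_ (fun k => ?_) j <;> simp

end HasMajorant

/-- A power series without its constant term. -/
def tailSeries (p : PowerSeries ℝ≥0) : PowerSeries ℝ≥0 :=
  PowerSeries.mk fun j => if j = 0 then 0 else p.coeff j

/-- The majorant `∑_{r ≤ m} (M_r / r!) (p - p_0)^r` of a composite function `Φ ∘ A`, where `p`
majorizes `A` and `M_r` bounds the `r`-th derivative of `Φ`. -/
def compSeries (M : ℕ → ℝ≥0) (m : ℕ) (p : PowerSeries ℝ≥0) : PowerSeries ℝ≥0 :=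
  ∑ r ∈ Finset.range (m + 1), (M r / r.factorial) • tailSeries p ^ r

theorem coeff_zero_tailSeries (p : PowerSeries ℝ≥0) : (tailSeries p).coeff 0 = 0 := by
  simp [tailSeries]

/-- Only the term `r = 0` contributes, since `tailSeries p` has no constant term. -/
theorem coeff_zero_compSeries (M : ℕ → ℝ≥0) (m : ℕ) (p : PowerSeries ℝ≥0) :
    (compSeries M m p).coeff 0 = M 0 := by
  rw [compSeries, Finset.sum_range_succ', map_add, map_sum, Finset.sum_eq_zero]
  · simp
  · intro r _
    rw [PowerSeries.coeff_smul, pow_succ, coeff_zero_mul_series, coeff_zero_tailSeries]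
    simp

theorem derivative_tailSeries (p : PowerSeries ℝ≥0) :
    PowerSeries.derivative ℝ≥0 (tailSeries p) = PowerSeries.derivative ℝ≥0 p := by
  ext j
  rw [PowerSeries.coeff_derivative, PowerSeries.coeff_derivative, tailSeries, PowerSeries.coeff_mk]
  simp

/-- The chain rule for majorants. -/
theorem derivative_compSeries (M : ℕ → ℝ≥0) (m : ℕ) (p : PowerSeries ℝ≥0) :
    PowerSeries.derivative ℝ≥0 (compSeries M (m + 1) p)
      = compSeries (fun r => M (r + 1)) m p * PowerSeries.derivative ℝ≥0 p := by
  rw [compSeries, Finset.sum_range_succ', map_add, map_sum, compSeries, Finset.sum_mul]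
  have h0 : PowerSeries.derivative ℝ≥0 ((M 0 / (Nat.factorial 0 : ℝ≥0)) • tailSeries p ^ 0)
      = 0 := by
    rw [Derivation.map_smul]; simp
  rw [h0, add_zero]
  refine Finset.sum_congr rfl fun r _ => ?_
  rw [Derivation.map_smul, Derivation.leibniz_pow, derivative_tailSeries, Nat.factorial_succ,
    add_tsub_cancel_right, smul_eq_mul, ← Nat.cast_smul_eq_nsmul ℝ≥0, smul_smul,
    smul_mul_assoc]
  congr 1
  have : (r.factorial : ℝ≥0) ≠ 0 := by positivity
  push_cast
  field_simp

/-- The points of continuity of `Φ` form a Borel set, because they form a `Gδ`-set; outside of it,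
`Φ` may fail to be measurable. -/
theorem aestronglyMeasurable_comp_of_continuousAt [FiniteDimensional ℝ E] {X Y : Type*}
    [NormedAddCommGroup Y]
    [MeasurableSpace X] {μ : Measure X} {A : X → E} (hA : AEStronglyMeasurable A μ) {Φ : E → Y}
    (hΦ : ∀ᵐ x ∂μ, ContinuousAt Φ (A x)) : AEStronglyMeasurable (fun x => Φ (A x)) μ := by
  borelize E
  have := FiniteDimensional.proper_real E
  set K : Set E := {a | ContinuousAt Φ a}
  have hK : MeasurableSet K := (IsGδ.setOfPred_continuousAt Φ).measurableSet
  have hcont : ContinuousOn Φ K := fun a ha => ContinuousAt.continuousWithinAt ha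
  have h1 : AEStronglyMeasurable Φ ((μ.map A).restrict K) := hcont.aestronglyMeasurable hK
  have h2 : (μ.map A).restrict K = μ.map A :=
    Measure.restrict_eq_self_of_ae_mem ((ae_map_iff hA.aemeasurable hK).2 hΦ)
  rw [h2] at h1
  exact h1.comp_aemeasurable hA.aemeasurable

end Majorant

/-! ### Majorants of composite functions -/

section Composition

variable {d : ℕ} {D : Set (Rd d)} {E : Type} [NormedAddCommGroup E] [NormedSpace ℝ E]

theorem comp_ae_bound {A : Rd d → E} {K : Set E} (hK : ∀ᵐ x ∂volume.restrict D, A x ∈ K)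
    {G : Type*} [NormedAddCommGroup G] [NormedSpace ℝ G] {Φ : E → G} {M : ℕ → ℝ≥0}
    (hM : ∀ r, ∀ a ∈ K, ‖iteratedFDeriv ℝ r Φ a‖₊ ≤ M r) (m : ℕ) (p : PowerSeries ℝ≥0) :
    ∀ᵐ x ∂volume.restrict D, ‖Φ (A x)‖₊ ≤ (compSeries M m p).coeff 0 := by
  filter_upwards [hK] with x hx
  rw [coeff_zero_compSeries]
  have h := hM 0 _ hx
  rwa [← NNReal.coe_le_coe, coe_nnnorm, norm_iteratedFDeriv_zero] at h

/-- Faà di Bruno's estimate: the composite `Φ ∘ A` is majorized by the composite series. -/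
theorem HasMajorant.comp [FiniteDimensional ℝ E] (hD : IsOpen D) {m : ℕ} {p : PowerSeries ℝ≥0}
    {A : Rd d → E} (hA : HasMajorant D m p A) {K : Set E} (hK : ∀ᵐ x ∂volume.restrict D, A x ∈ K)
    (hK' : m ≠ 0 → ∀ x ∈ D, A x ∈ K) {G : Type} [NormedAddCommGroup G] [NormedSpace ℝ G]
    [CompleteSpace G] {Φ : E → G} (hΦ : ∀ a ∈ K, AnalyticAt ℝ Φ a) {M : ℕ → ℝ≥0}
    (hM : ∀ r, ∀ a ∈ K, ‖iteratedFDeriv ℝ r Φ a‖₊ ≤ M r) :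
    HasMajorant D m (compSeries M m p) (fun x => Φ (A x)) := by
  induction m generalizing G p M with
  | zero =>
    refine ⟨aestronglyMeasurable_comp_of_continuousAt hA.1 ?_, comp_ae_bound hK hM 0 p⟩
    filter_upwards [hK] with x hx
    exact (hΦ _ hx).continuousAt
  | succ m ih =>
    have hA' := hA.pred hD
    obtain ⟨h1, h2, w, s, h3, h4, h5⟩ := hA
    -- The chain rule `∂_i (Φ ∘ A) = (DΦ ∘ A) ∂_i A`, with the induction hypothesis for `DΦ`.
    have hDΦ := ih (G := E →L[ℝ] G) hA' (fun _ => hK' (Nat.succ_ne_zero m)) (Φ := fderiv ℝ Φ)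
      (fun a ha => (hΦ a ha).fderiv) (M := fun r => M (r + 1)) (fun r a ha => by
        have := hM (r + 1) a ha
        rw [← NNReal.coe_le_coe, coe_nnnorm] at this ⊢
        rwa [norm_iteratedFDeriv_fderiv])
    refine ⟨?_, comp_ae_bound hK hM _ p, fun i x => fderiv ℝ Φ (A x) (w i x),
      fun i => compSeries (fun r => M (r + 1)) m p * s i,
      fun i => HasMajorant.bilinear hD (ContinuousLinearMap.id ℝ (E →L[ℝ] G))
        ContinuousLinearMap.norm_id_le hDΦ (h3 i), fun j hj => ?_, ?_⟩
    · exact locallyLipschitzOn_comp h1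
        (fun x hx => (hΦ _ (hK' (Nat.succ_ne_zero m) x hx)).contDiffAt)
    · rw [← map_sum, ← Finset.mul_sum]
      calc (compSeries (fun r => M (r + 1)) m p * ∑ i, s i).coeff j
          ≤ (compSeries (fun r => M (r + 1)) m p * PowerSeries.derivative ℝ≥0 p).coeff j := by
            refine coeff_mul_le_coeff_mul (fun _ _ => le_rfl) fun k hk => ?_
            rw [map_sum, PowerSeries.coeff_derivative, mul_comm]
            exact h4 k (hk.trans hj)
        _ = _ := by
            rw [← derivative_compSeries, PowerSeries.coeff_derivative, mul_comm]
    · filter_upwards [h5, hK] with x hx hxK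
      have := ((hΦ _ hxK).differentiableAt.hasFDerivAt).comp x hx.1.hasFDerivAt
      refine ⟨this.differentiableAt, fun i => ?_⟩
      have h2 : fderiv ℝ (fun x => Φ (A x)) x = _ := this.fderiv
      rw [h2]
      simp [hx.2 i]

end Composition

/-! ### Majorants and the norm of `W^{τ,∞}` -/

section Norm

variable {d : ℕ} {D : Set (Rd d)} {F : Type*} [NormedAddCommGroup F] [NormedSpace ℝ F]

/-- The sum of the coefficients up to order `m`. -/
def truncSum (m : ℕ) (p : PowerSeries ℝ≥0) : ℝ≥0 := ∑ j ∈ Finset.range (m + 1), p.coeff j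

theorem truncSum_add (m : ℕ) (p q : PowerSeries ℝ≥0) :
    truncSum m (p + q) = truncSum m p + truncSum m q := by
  simp [truncSum, Finset.sum_add_distrib]

theorem truncSum_smul (m : ℕ) (c : ℝ≥0) (p : PowerSeries ℝ≥0) :
    truncSum m (c • p) = c * truncSum m p := by
  simp [truncSum, Finset.mul_sum]

theorem truncSum_sum (m : ℕ) {ι : Type*} (s : Finset ι) (p : ι → PowerSeries ℝ≥0) :
    truncSum m (∑ i ∈ s, p i) = ∑ i ∈ s, truncSum m (p i) := by
  simp only [truncSum, map_sum]
  exact Finset.sum_comm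

/-- The coefficients of the product up to order `m` involve only part of the products of
coefficients up to order `m`. -/
theorem truncSum_mul_le (m : ℕ) (p q : PowerSeries ℝ≥0) :
    truncSum m (p * q) ≤ truncSum m p * truncSum m q := by
  simp only [truncSum, PowerSeries.coeff_mul]
  rw [Finset.sum_mul_sum, ← Finset.sum_product', Finset.sum_sigma']
  have hinj : Set.InjOn (fun x : (_ : ℕ) × ℕ × ℕ => x.2)
      ((Finset.range (m + 1)).sigma fun j => Finset.HasAntidiagonal.antidiagonal j : Set _) := by
    rintro ⟨j, x⟩ hx ⟨k, y⟩ hy hxy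
    simp only [Finset.coe_sigma, Set.mem_sigma_iff, Finset.mem_coe,
      Finset.HasAntidiagonal.mem_antidiagonal] at hx hy hxy
    subst hxy
    obtain rfl : j = k := hx.2.symm.trans hy.2
    rfl
  rw [← Finset.sum_image (f := fun y : ℕ × ℕ => p.coeff y.1 * q.coeff y.2) hinj]
  refine Finset.sum_le_sum_of_subset fun y hy => ?_
  obtain ⟨⟨j, x⟩, hx, rfl⟩ := Finset.mem_image.1 hy
  simp only [Finset.mem_sigma, Finset.mem_range, Finset.HasAntidiagonal.mem_antidiagonal] at hx
  simp only [Finset.mem_product, Finset.mem_range]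
  omega

theorem truncSum_one_le (m : ℕ) : truncSum m 1 ≤ 1 := by
  simp [truncSum, PowerSeries.coeff_one]

theorem truncSum_pow_le (m : ℕ) (p : PowerSeries ℝ≥0) (r : ℕ) :
    truncSum m (p ^ r) ≤ truncSum m p ^ r := by
  induction r with
  | zero => simpa using truncSum_one_le m
  | succ r ih =>
    rw [pow_succ, pow_succ]
    exact (truncSum_mul_le _ _ _).trans (by gcongr)

theorem truncSum_prod_le (m : ℕ) {ι : Type*} (s : Finset ι) (p : ι → PowerSeries ℝ≥0) :
    truncSum m (∏ i ∈ s, p i) ≤ ∏ i ∈ s, truncSum m (p i) := by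
  classical
  induction s using Finset.induction_on with
  | empty => simpa using truncSum_one_le m
  | insert i s hi ih =>
    rw [Finset.prod_insert hi, Finset.prod_insert hi]
    exact (truncSum_mul_le _ _ _).trans (by gcongr)

theorem truncSum_tailSeries_le (m : ℕ) (p : PowerSeries ℝ≥0) :
    truncSum m (tailSeries p) ≤ truncSum m p := by
  refine Finset.sum_le_sum fun j _ => ?_
  rw [tailSeries, PowerSeries.coeff_mk]
  split_ifs <;> simp

theorem truncSum_compSeries_le (m : ℕ) (M : ℕ → ℝ≥0) (p : PowerSeries ℝ≥0) :
    truncSum m (compSeries M m p)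
      ≤ ∑ r ∈ Finset.range (m + 1), M r / r.factorial * truncSum m p ^ r := by
  rw [compSeries, truncSum_sum]
  refine Finset.sum_le_sum fun r _ => ?_
  rw [truncSum_smul]
  gcongr
  exact (truncSum_pow_le _ _ _).trans (by gcongr; exact truncSum_tailSeries_le m p)

theorem HasMajorant.locallyIntegrableOn (hD : IsOpen D) {m : ℕ} {p : PowerSeries ℝ≥0}
    {v : Rd d → F} (hv : HasMajorant D m p v) : LocallyIntegrableOn v D := by
  refine locallyIntegrableOn_of_locallyIntegrable_restrict
    (MemLp.locallyIntegrable (p := ∞) ?_ (by simp))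
  refine memLp_top_of_bound (hv.order_zero hD).1 (p.coeff 0) ?_
  filter_upwards [hv.ae_bound] with x hx
  exact_mod_cast hx

/-- By induction on `j`: Euler's identity `sum_sum_add_single` turns the recursion which defines
`HasMajorant` into a bound for the seminorms. -/
theorem HasMajorant.sum_weakNorm_le (hD : IsOpen D) {m j : ℕ} (hj : j ≤ m) {p : PowerSeries ℝ≥0}
    {v : Rd d → F} (hv : HasMajorant D m p v) :
    ∑ β ∈ Finset.piAntidiag Finset.univ j, ((mfact β : ℕ) : ℝ≥0∞)⁻¹ * weakNorm D ∞ β v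
      ≤ (p.coeff j : ℝ≥0∞) := by
  induction j generalizing m p v with
  | zero =>
    simp only [Finset.piAntidiag_zero, Finset.sum_singleton, mfact_zero, Nat.cast_one, inv_one,
      one_mul]
    refine (iInf₂_le v (HasWeakDeriv.zero_self (hv.locallyIntegrableOn hD))).trans ?_
    rw [eLpNorm_exponent_top]
    refine eLpNormEssSup_le_of_ae_enorm_bound ?_
    filter_upwards [hv.ae_bound] with x hx
    exact_mod_cast hx
  | succ j ih =>
    cases m with
    | zero => omega
    | succ m =>
    obtain ⟨h1, h2, w, s, h3, h4, h5⟩ := hv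
    have hc : ∀ (β : Fin d → ℕ) (i : Fin d),
        ((β i : ℝ≥0∞) + 1) * ((mfact (β + Pi.single i 1) : ℕ) : ℝ≥0∞)⁻¹
          = ((mfact β : ℕ) : ℝ≥0∞)⁻¹ := by
      intro β i
      rw [mfact_add_single]
      push_cast
      rw [ENNReal.mul_inv (by simp) (by simp), ← mul_assoc, ENNReal.mul_inv_cancel (by simp)
        (by simp), one_mul]
    have key := sum_sum_add_single (fun β : Fin d → ℕ => ((mfact β : ℕ) : ℝ≥0∞)⁻¹)
      (fun β => weakNorm D ∞ β v) hc j
    have hle : ((j : ℝ≥0∞) + 1) * ∑ β ∈ Finset.piAntidiag Finset.univ (j + 1),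
        ((mfact β : ℕ) : ℝ≥0∞)⁻¹ * weakNorm D ∞ β v
          ≤ ((j : ℝ≥0∞) + 1) * (p.coeff (j + 1) : ℝ≥0∞) := by
      rw [← key]
      calc _ ≤ ∑ i, ∑ β ∈ Finset.piAntidiag Finset.univ j,
            ((mfact β : ℕ) : ℝ≥0∞)⁻¹ * weakNorm D ∞ β (w i) := by
            refine Finset.sum_le_sum fun i _ => Finset.sum_le_sum fun β _ => ?_
            gcongr
            refine le_iInf₂ fun z hz => iInf₂_le z ?_
            exact hz.add_single hD h1 (h5.mono fun x hx => ⟨hx.1, hx.2 i⟩)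
        _ ≤ ∑ i, ((s i).coeff j : ℝ≥0∞) :=
            Finset.sum_le_sum fun i _ => ih (by omega) (h3 i)
        _ ≤ _ := by exact_mod_cast h4 j (by omega)
    rwa [ENNReal.mul_le_mul_iff_right (by simp) (by simp)] at hle

/-- The norm of `W^{m,∞}` is bounded by the sum of the coefficients of a majorant. -/
theorem HasMajorant.sobolevNorm_le (hD : IsOpen D) {m : ℕ} {p : PowerSeries ℝ≥0}
    {v : Rd d → F} (hv : HasMajorant D m p v) : sobolevNorm D m ∞ v ≤ truncSum m p := by
  rw [sobolevNorm_eq, sum_multiIdx, truncSum]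
  push_cast
  exact Finset.sum_le_sum fun j hj =>
    hv.sum_weakNorm_le hD (Nat.lt_succ_iff.1 (Finset.mem_range.1 hj))

end Norm

/-! ### Majorants of functions of class `C^{τ,1}` -/

section C1

variable {d : ℕ} {D : Set (Rd d)} {F : Type*} [NormedAddCommGroup F] [NormedSpace ℝ F]

/-- The majorant of `∂^β v` up to order `m`, where `|β| + m = τ + 1`, in terms of bounds `s` for the
partial derivatives of `v` of order at most `τ` and Lipschitz constants `ℓ` of those of order
`τ`. -/
def jetSeries (s ℓ : (Fin d → ℕ) → ℝ≥0) (m : ℕ) (β : Fin d → ℕ) : PowerSeries ℝ≥0 :=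
  PowerSeries.mk fun j =>
    if j < m then
      ∑ δ ∈ Finset.piAntidiag Finset.univ j, ((mfact δ : ℕ) : ℝ≥0)⁻¹ * s (β + δ)
    else
      d / m * ∑ δ ∈ Finset.piAntidiag Finset.univ (m - 1), ((mfact δ : ℕ) : ℝ≥0)⁻¹ * ℓ (β + δ)

theorem inv_mfact_add_single (β : Fin d → ℕ) (i : Fin d) :
    ((β i : ℝ≥0) + 1) * ((mfact (β + Pi.single i 1) : ℕ) : ℝ≥0)⁻¹
      = ((mfact β : ℕ) : ℝ≥0)⁻¹ := by
  have : ((mfact β : ℕ) : ℝ≥0) ≠ 0 := by exact_mod_cast (mfact_pos β).ne'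
  rw [mfact_add_single]
  push_cast
  field_simp

/-- The recursion required by `HasMajorant`; here it holds with equality. -/
theorem sum_coeff_jetSeries (s ℓ : (Fin d → ℕ) → ℝ≥0) {m : ℕ} (hm : m ≠ 0) (β : Fin d → ℕ)
    {j : ℕ} (hj : j ≤ m) :
    ∑ i, (jetSeries s ℓ m (β + Pi.single i 1)).coeff j
      = (j + 1) * (jetSeries s ℓ (m + 1) β).coeff (j + 1) := by
  have key : ∀ (G : (Fin d → ℕ) → ℝ≥0) (k : ℕ),
      ∑ i, ∑ δ ∈ Finset.piAntidiag Finset.univ k, ((mfact δ : ℕ) : ℝ≥0)⁻¹ *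
        G (β + Pi.single i 1 + δ) = ((k : ℝ≥0) + 1) *
          ∑ δ ∈ Finset.piAntidiag Finset.univ (k + 1), ((mfact δ : ℕ) : ℝ≥0)⁻¹ * G (β + δ) := by
    intro G k
    rw [← sum_sum_add_single (fun δ : Fin d → ℕ => ((mfact δ : ℕ) : ℝ≥0)⁻¹) (fun δ => G (β + δ))
      inv_mfact_add_single k]
    refine Finset.sum_congr rfl fun i _ => Finset.sum_congr rfl fun δ _ => ?_
    rw [add_assoc, add_comm (Pi.single i 1)]
  simp only [jetSeries, PowerSeries.coeff_mk]
  rcases hj.lt_or_eq with h | rfl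
  · simp only [h, if_true, Nat.add_lt_add_iff_right]
    exact key s j
  · simp only [lt_irrefl, if_false]
    obtain ⟨k, rfl⟩ := Nat.exists_eq_succ_of_ne_zero hm
    rw [← Finset.mul_sum, Nat.succ_eq_add_one, Nat.add_sub_cancel, Nat.add_sub_cancel, key ℓ k]
    push_cast
    field_simp

/-- Rademacher's theorem is not needed here: where the derivative does not exist, `fderiv` is `0`.
-/
theorem HasMajorant.pderiv_of_lipschitz [FiniteDimensional ℝ F] (hD : IsOpen D) {u : Rd d → F}
    {L : ℝ≥0} (hu : LipschitzOnWith L u D) (i : Fin d) :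
    HasMajorant D 0 (PowerSeries.C L) (pderiv i u) := by
  have := FiniteDimensional.complete ℝ F
  refine ⟨?_, ?_⟩
  · borelize F
    have := FiniteDimensional.proper_real F
    exact ((measurable_fderiv_apply_const ℝ u _).stronglyMeasurable).aestronglyMeasurable
  · filter_upwards [ae_restrict_mem hD.measurableSet] with x hx
    have h1 := norm_fderiv_le_of_lipschitzOn ℝ (hD.mem_nhds hx) hu
    rw [PowerSeries.coeff_zero_C]
    exact ((fderiv ℝ u x).le_of_opNorm_le h1 _).trans (by simp)

/-- Functions of class `C^{τ,1}` are majorized up to order `τ + 1`. -/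
theorem hasMajorant_pderivs [FiniteDimensional ℝ F] (hD : IsOpen D) {v : Rd d → F} {τ : ℕ}
    (hv : ContDiffOn ℝ τ v D) {s ℓ : (Fin d → ℕ) → ℝ≥0}
    (hs : ∀ β, order β ≤ τ → ∀ x ∈ D, ‖pderivs β v x‖₊ ≤ s β)
    (hℓ : ∀ β, order β = τ → LipschitzOnWith (ℓ β) (pderivs β v) D) (m : ℕ) (β : Fin d → ℕ)
    (hβ : order β + m = τ) : HasMajorant D (m + 1) (jetSeries s ℓ (m + 1) β) (pderivs β v) := by
  have hbd : ∀ (m : ℕ) (β : Fin d → ℕ), order β + m = τ → ∀ᵐ x ∂volume.restrict D,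
      ‖pderivs β v x‖₊ ≤ (jetSeries s ℓ (m + 1) β).coeff 0 := by
    intro m β hβ
    filter_upwards [ae_restrict_mem hD.measurableSet] with x hx
    refine (hs β (by omega) x hx).trans ?_
    simp [jetSeries, mfact_zero]
  induction m generalizing β with
  | zero =>
    have hL := hℓ β (by omega)
    refine ⟨fun x hx => ⟨ℓ β, D, self_mem_nhdsWithin, hL⟩, hbd 0 β hβ,
      fun i => pderiv i (pderivs β v), fun _ => PowerSeries.C (ℓ β),
      fun i => HasMajorant.pderiv_of_lipschitz hD hL i, fun j hj => ?_, ?_⟩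
    · obtain rfl : j = 0 := Nat.le_zero.1 hj
      simp [jetSeries, mfact_zero]
    · rw [ae_restrict_iff' hD.measurableSet]
      -- Rademacher's theorem.
      filter_upwards [hL.ae_differentiableWithinAt_of_mem (μ := volume)] with x hx hxD
      exact ⟨(hx hxD).differentiableAt (hD.mem_nhds hxD), fun i => rfl⟩
  | succ m ih =>
    have hC : ContDiffOn ℝ 1 (pderivs β v) D := by
      have := contDiffOn_pderivs (n := 1) (β := β) hD (hv.of_le
        (by exact_mod_cast (by omega : 1 + order β ≤ τ)))
      exact_mod_cast this
    refine ⟨?_, hbd (m + 1) β hβ, fun i => pderivs (β + Pi.single i 1) v,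
      fun i => jetSeries s ℓ (m + 1) (β + Pi.single i 1),
      fun i => ih _ (by rw [order_add_single]; omega), fun j hj => ?_, ?_⟩
    · intro x hx
      obtain ⟨K, t, ht, hK⟩ := (hC.contDiffAt (hD.mem_nhds hx)).exists_lipschitzOnWith
      exact ⟨K, t, mem_nhdsWithin_of_mem_nhds ht, hK⟩
    · exact (sum_coeff_jetSeries s ℓ (Nat.succ_ne_zero m) β hj).le
    · filter_upwards [ae_restrict_mem hD.measurableSet] with x hx
      refine ⟨(hC.differentiableOn (by norm_num)).differentiableAt (hD.mem_nhds hx), fun i => ?_⟩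
      exact pderiv_pderivs hD (hv.of_le (by exact_mod_cast (by omega : order β + 1 ≤ τ))) i hx

theorem inv_mfact_le_one (β : Fin d → ℕ) : ((mfact β : ℕ) : ℝ≥0)⁻¹ ≤ 1 :=
  inv_le_one_of_one_le₀ (by exact_mod_cast mfact_pos β)

theorem truncSum_jetSeries_le (s ℓ : (Fin d → ℕ) → ℝ≥0) (τ : ℕ) :
    truncSum τ (jetSeries s ℓ (τ + 1) 0) ≤ ∑ β ∈ multiIdx d τ, s β := by
  rw [sum_multiIdx, truncSum]
  refine Finset.sum_le_sum fun j hj => ?_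
  rw [jetSeries, PowerSeries.coeff_mk, if_pos (Finset.mem_range.1 hj)]
  refine Finset.sum_le_sum fun δ _ => ?_
  rw [zero_add]
  exact mul_le_of_le_one_left zero_le (inv_mfact_le_one δ)

theorem coeff_jetSeries_top_le (s ℓ : (Fin d → ℕ) → ℝ≥0) (τ : ℕ) :
    (τ + 1) * (jetSeries s ℓ (τ + 1) 0).coeff (τ + 1)
      ≤ d * ∑ β ∈ Finset.piAntidiag Finset.univ τ, ℓ β := by
  rw [jetSeries, PowerSeries.coeff_mk, if_neg (lt_irrefl _)]
  have : ∑ δ ∈ Finset.piAntidiag (Finset.univ : Finset (Fin d)) τ,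
      ((mfact δ : ℕ) : ℝ≥0)⁻¹ * ℓ (0 + δ) ≤ ∑ β ∈ Finset.piAntidiag Finset.univ τ, ℓ β := by
    refine Finset.sum_le_sum fun δ _ => ?_
    rw [zero_add]
    exact mul_le_of_le_one_left zero_le (inv_mfact_le_one δ)
  calc _ = d * ∑ δ ∈ Finset.piAntidiag (Finset.univ : Finset (Fin d)) τ,
      ((mfact δ : ℕ) : ℝ≥0)⁻¹ * ℓ (0 + δ) := by
        rw [Nat.add_sub_cancel]; push_cast; field_simp
    _ ≤ _ := by gcongr

theorem filter_multiIdx (τ : ℕ) : (multiIdx d τ).filter (fun β => order β = τ)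
    = Finset.piAntidiag Finset.univ τ := by
  ext β
  simp only [Finset.mem_filter, mem_multiIdx, Finset.mem_piAntidiag, Finset.mem_univ,
    implies_true, and_true]
  change _ ↔ order β = τ
  constructor
  · exact fun h => h.2
  · exact fun h => ⟨h.le, h⟩

/-- Majorants of the first partial derivatives, up to order `τ`. For `τ = 0` these derivatives exist
almost everywhere only. -/
theorem exists_majorant_pderiv [FiniteDimensional ℝ F] (hD : IsOpen D) {v : Rd d → F} {τ : ℕ}
    (hv : ContDiffOn ℝ τ v D) {s ℓ : (Fin d → ℕ) → ℝ≥0}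
    (hs : ∀ β, order β ≤ τ → ∀ x ∈ D, ‖pderivs β v x‖₊ ≤ s β)
    (hℓ : ∀ β, order β = τ → LipschitzOnWith (ℓ β) (pderivs β v) D) :
    ∃ q : Fin d → PowerSeries ℝ≥0, (∀ i, HasMajorant D τ (q i) (pderiv i v)) ∧
      ∀ j ≤ τ, ∑ i, (q i).coeff j ≤ (j + 1) * (jetSeries s ℓ (τ + 1) 0).coeff (j + 1) := by
  cases τ with
  | zero =>
    have hL := hℓ 0 (by simp [order])
    rw [pderivs_zero] at hL
    refine ⟨fun _ => PowerSeries.C (ℓ 0),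
      fun i => HasMajorant.pderiv_of_lipschitz hD hL i, fun j hj => ?_⟩
    obtain rfl : j = 0 := Nat.le_zero.1 hj
    simp [jetSeries, mfact_zero]
  | succ m =>
    refine ⟨fun i => jetSeries s ℓ (m + 1) (0 + Pi.single i 1), fun i => ?_,
      fun j hj => (sum_coeff_jetSeries s ℓ (Nat.succ_ne_zero m) 0 hj).le⟩
    have h0 : order (0 : Fin d → ℕ) = 0 := by simp [order]
    have := hasMajorant_pderivs hD hv hs hℓ m (0 + Pi.single i 1)
      (by rw [order_add_single, h0]; omega)
    rw [zero_add, pderivs_single] at this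
    simpa only [zero_add] using this

/-- The differential is the sum of the functions `ξ ↦ ξ_i ∂_i v`. -/
theorem HasMajorant.fderiv (hD : IsOpen D) {v : Rd d → F} {m : ℕ} {q : Fin d → PowerSeries ℝ≥0}
    (h : ∀ i, HasMajorant D m (q i) (pderiv i v)) :
    HasMajorant D m (∑ i, q i) (fderiv ℝ v) := by
  have h1 : ∀ i ∈ (Finset.univ : Finset (Fin d)), HasMajorant D m (q i)
      (fun x => (coordSmul i : F →L[ℝ] Rd d →L[ℝ] F) (pderiv i v x)) := fun i _ =>
    (h i).clm _ (norm_coordSmul_le i)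
  exact (HasMajorant.sum Finset.univ h1).congr hD fun x _ => sum_coordSmul (_root_.fderiv ℝ v x)

theorem truncSum_succ_le {τ : ℕ} {P : PowerSeries ℝ≥0} {S L M : ℝ≥0} (h1 : truncSum τ P ≤ S)
    (h2 : (τ + 1) * P.coeff (τ + 1) ≤ d * L) (hM : S + L ≤ M) :
    truncSum (τ + 1) P ≤ (1 + d) * M := by
  rw [truncSum, Finset.sum_range_succ]
  have h3 : P.coeff (τ + 1) ≤ (τ + 1) * P.coeff (τ + 1) :=
    le_mul_of_one_le_left zero_le (le_add_of_nonneg_left zero_le)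
  have hS : S ≤ M := (le_add_right le_rfl).trans hM
  have hL : L ≤ M := (le_add_left le_rfl).trans hM
  calc _ ≤ S + d * L := add_le_add h1 (h3.trans h2)
    _ ≤ M + d * M := by gcongr
    _ = _ := by ring

/-- The coefficients of a derivative up to order `τ`, in terms of bounds `S` for the derivatives of
order at most `τ` and `L` for the Lipschitz constants. The factor `j + 1` is at most `τ` except for
the top order, where the Lipschitz constants enter. -/
theorem truncSum_le_of_derivative (hd : 0 < d) {τ : ℕ} {P q : PowerSeries ℝ≥0} {S L M : ℝ≥0}
    (h1 : truncSum τ P ≤ S) (h2 : (τ + 1) * P.coeff (τ + 1) ≤ d * L) (hM : S + L ≤ M)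
    (hq : ∀ j ≤ τ, q.coeff j ≤ (j + 1) * P.coeff (j + 1)) :
    truncSum τ q ≤ (τ + 1) * d * M := by
  have h4 : truncSum τ q ≤ ∑ j ∈ Finset.range (τ + 1), ((j : ℝ≥0) + 1) * P.coeff (j + 1) :=
    Finset.sum_le_sum fun j hj => hq j (Nat.lt_succ_iff.1 (Finset.mem_range.1 hj))
  have h5 : ∑ j ∈ Finset.range τ, ((j : ℝ≥0) + 1) * P.coeff (j + 1) ≤ τ * S := by
    calc _ ≤ ∑ j ∈ Finset.range τ, (τ : ℝ≥0) * P.coeff (j + 1) := by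
          refine Finset.sum_le_sum fun j hj => ?_
          gcongr
          exact_mod_cast Finset.mem_range.1 hj
      _ ≤ τ * truncSum τ P := by
          rw [← Finset.mul_sum, truncSum, Finset.sum_range_succ' _ τ]
          gcongr
          exact le_add_right le_rfl
      _ ≤ _ := by gcongr
  have hd1 : (1 : ℝ≥0) ≤ d := by exact_mod_cast hd
  rw [Finset.sum_range_succ] at h4
  calc _ ≤ τ * S + d * L := h4.trans (add_le_add h5 h2)
    _ ≤ ((τ + 1) * d) * S + ((τ + 1) * d) * L := by
        gcongr
        · calc (τ : ℝ≥0) ≤ τ + 1 := le_add_right le_rfl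
            _ ≤ (τ + 1) * d := le_mul_of_one_le_right zero_le hd1
        · exact le_mul_of_one_le_left zero_le (le_add_left le_rfl)
    _ = (τ + 1) * d * (S + L) := by ring
    _ ≤ _ := by gcongr

/-- A function of class `C^{τ,1}` is majorized up to order `τ + 1`, and its differential up to
order `τ`, with sums controlled by its norm. -/
theorem exists_majorant_of_c1Norm_le [FiniteDimensional ℝ F] (hd : 0 < d) (hD : IsOpen D)
    {v : Rd d → F} {τ : ℕ} (hv : ContDiffOn ℝ τ v D) {M : ℝ≥0} (hM : c1Norm D τ v ≤ M) :
    (∃ p, HasMajorant D (τ + 1) p v ∧ truncSum τ p ≤ M ∧ truncSum (τ + 1) p ≤ (1 + d) * M) ∧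
    ∃ q, HasMajorant D τ q (fderiv ℝ v) ∧ truncSum τ q ≤ (τ + 1) * d * M := by
  set S : (Fin d → ℕ) → ℝ≥0∞ := fun β => ⨆ x ∈ D, ‖pderivs β v x‖ₑ with hS
  set Λ : (Fin d → ℕ) → ℝ≥0∞ := fun β => eHolderNorm 1 (D.domRestrict (pderivs β v)) with hΛ
  set s : (Fin d → ℕ) → ℝ≥0 := fun β => (S β).toNNReal
  set ℓ : (Fin d → ℕ) → ℝ≥0 := fun β => (Λ β).toNNReal
  have hc : c1Norm D τ v
      = ∑ β ∈ multiIdx d τ, S β + ∑ β ∈ Finset.piAntidiag Finset.univ τ, Λ β := by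
    rw [c1Norm, filter_multiIdx]
  have hfin : c1Norm D τ v ≠ ∞ := (hM.trans_lt ENNReal.coe_lt_top).ne
  have hSfin : ∀ β ∈ multiIdx d τ, S β ≠ ∞ := fun β hβ h => hfin (by
    rw [hc, (ENNReal.sum_eq_top).2 ⟨β, hβ, h⟩, top_add])
  have hΛfin : ∀ β ∈ Finset.piAntidiag Finset.univ τ, Λ β ≠ ∞ := fun β hβ h => hfin (by
    rw [hc, (ENNReal.sum_eq_top (f := Λ)).2 ⟨β, hβ, h⟩, add_top])
  have hs : ∀ β, order β ≤ τ → ∀ x ∈ D, ‖pderivs β v x‖₊ ≤ s β := by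
    intro β hβ x hx
    rw [← ENNReal.coe_le_coe, ENNReal.coe_toNNReal (hSfin β (mem_multiIdx.2 hβ))]
    exact le_iSup₂ (f := fun x (_ : x ∈ D) => ‖pderivs β v x‖ₑ) x hx
  have hℓ : ∀ β, order β = τ → LipschitzOnWith (ℓ β) (pderivs β v) D := by
    intro β hβ
    have : β ∈ Finset.piAntidiag (Finset.univ : Finset (Fin d)) τ := by
      rw [← filter_multiIdx]
      exact Finset.mem_filter.2 ⟨mem_multiIdx.2 hβ.le, hβ⟩
    have h1 := (eHolderNorm_ne_top.1 (hΛfin β this)).holderWith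
    rw [lipschitzOnWith_iff_restrict]
    exact holderWith_one.1 h1
  have hsum : ∑ β ∈ multiIdx d τ, s β + ∑ β ∈ Finset.piAntidiag Finset.univ τ, ℓ β ≤ M := by
    rw [← ENNReal.coe_le_coe]
    refine le_trans (le_of_eq ?_) hM
    rw [hc]
    push_cast
    congr 1
    · exact Finset.sum_congr rfl fun β hβ => ENNReal.coe_toNNReal (hSfin β hβ)
    · exact Finset.sum_congr rfl fun β hβ => ENNReal.coe_toNNReal (hΛfin β hβ)
  set P := jetSeries s ℓ (τ + 1) 0 with hP
  set Ssum := ∑ β ∈ multiIdx d τ, s β with hSsum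
  set Lsum := ∑ β ∈ Finset.piAntidiag Finset.univ τ, ℓ β with hLsum
  have h1 : truncSum τ P ≤ Ssum := truncSum_jetSeries_le s ℓ τ
  have h2 : (τ + 1) * P.coeff (τ + 1) ≤ d * Lsum := coeff_jetSeries_top_le s ℓ τ
  have hmaj : HasMajorant D (τ + 1) P v := by
    have := hasMajorant_pderivs hD hv hs hℓ τ 0 (by simp [order])
    rwa [pderivs_zero] at this
  refine ⟨⟨P, hmaj, h1.trans ((le_add_right le_rfl).trans hsum), ?_⟩, ?_⟩
  · exact truncSum_succ_le h1 h2 hsum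
  · obtain ⟨q, hq1, hq2⟩ := exists_majorant_pderiv hD hv hs hℓ
    refine ⟨∑ i, q i, HasMajorant.fderiv hD hq1, ?_⟩
    refine truncSum_le_of_derivative hd h1 h2 hsum fun j hj => ?_
    rw [map_sum]
    exact hq2 j hj

end C1

/-! ### Series in `C^{τ,1}` -/

section Series

variable {d : ℕ} {D : Set (Rd d)} {F : Type*} [NormedAddCommGroup F] [NormedSpace ℝ F]

theorem wordDeriv_eq_pderivs (hD : IsOpen D) {v : Rd d → F} {w : List (Fin d)}
    (hv : ContDiffOn ℝ (w.length : ℕ) v D) :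
    EqOn (wordDeriv w v) (pderivs (fun i => w.count i) v) D := by
  rw [pderivs_eq_wordDeriv]
  exact wordDeriv_perm hD
    (List.perm_iff_count.2 fun i => (count_word (fun i => w.count i) i).symm) hv

theorem order_count (w : List (Fin d)) : order (fun i => w.count i) = w.length := by
  rw [← length_word]
  exact (List.perm_iff_count.2 fun i => count_word (fun i => w.count i) i).length_eq

/-- A series of functions whose partial derivatives of order at most `n` are summable uniformly is
`n` times continuously differentiable and can be differentiated term by term. -/
theorem contDiffOn_tsum_of_wordDeriv [CompleteSpace F] (hD : IsOpen D) {n : ℕ}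
    {φ : ℕ → Rd d → F} (hφ : ∀ k, ContDiffOn ℝ n (φ k) D) {u : ℕ → ℝ} (hu : Summable u)
    (hb : ∀ k (w : List (Fin d)), w.length ≤ n → ∀ x ∈ D, ‖wordDeriv w (φ k) x‖ ≤ u k) :
    ContDiffOn ℝ n (fun x => ∑' k, φ k x) D ∧ ∀ w : List (Fin d), w.length ≤ n →
      EqOn (wordDeriv w (fun x => ∑' k, φ k x)) (fun x => ∑' k, wordDeriv w (φ k) x) D := by
  induction n generalizing φ with
  | zero =>
    refine ⟨?_, fun w hw => ?_⟩
    · rw [Nat.cast_zero, contDiffOn_zero]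
      exact continuousOn_tsum (fun k => (hφ k).continuousOn) hu
        (fun k x hx => hb k [] le_rfl x hx)
    · rw [List.length_eq_zero_iff.1 (Nat.le_zero.1 hw)]
      exact fun _ _ => rfl
  | succ n ih =>
    have hdiff : ∀ k, ∀ x ∈ D, DifferentiableAt ℝ (φ k) x := fun k x hx =>
      ((hφ k).differentiableOn (by simp)).differentiableAt (hD.mem_nhds hx)
    have hfb : ∀ k, ∀ x ∈ D, ‖fderiv ℝ (φ k) x‖ ≤ d * u k := by
      intro k x hx
      refine (norm_le_sum_single _).trans ?_
      calc _ ≤ ∑ _i : Fin d, u k :=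
            Finset.sum_le_sum fun i _ => hb k [i] (by simp) x hx
        _ = _ := by simp
    have hder : ∀ x ∈ D, HasFDerivAt (fun x => ∑' k, φ k x) (∑' k, fderiv ℝ (φ k) x) x := by
      intro x hx
      obtain ⟨r, hr, hball⟩ := Metric.isOpen_iff.1 hD x hx
      exact hasFDerivAt_tsum_of_isPreconnected (hu.mul_left (d : ℝ)) Metric.isOpen_ball
        (convex_ball x r).isPreconnected (fun k y hy => (hdiff k y (hball hy)).hasFDerivAt)
        (fun k y hy => hfb k y (hball hy)) (Metric.mem_ball_self hr)
        (Summable.of_norm_bounded hu fun k => hb k [] (by simp) x hx) (Metric.mem_ball_self hr)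
    have hpd : ∀ i, EqOn (pderiv i (fun x => ∑' k, φ k x)) (fun x => ∑' k, pderiv i (φ k) x) D := by
      intro i x hx
      simp only [pderiv]
      rw [(hder x hx).fderiv]
      have hs : Summable fun k => fderiv ℝ (φ k) x :=
        Summable.of_norm_bounded (hu.mul_left (d : ℝ)) fun k => hfb k x hx
      exact (ContinuousLinearMap.apply ℝ F (EuclideanSpace.single i (1 : ℝ))).map_tsum hs
    have hi : ∀ i, _ := fun i => ih (φ := fun k => pderiv i (φ k))
      (fun k => contDiffOn_pderiv hD (hφ k) i)
      (fun k w hw x hx => hb k (i :: w) (by simpa using hw) x hx)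
    refine ⟨contDiffOn_succ_of_pderiv hD
      (fun x hx => (hder x hx).differentiableAt.differentiableWithinAt)
      fun i => (hi i).1.congr (hpd i), fun w hw => ?_⟩
    cases w with
    | nil => exact fun _ _ => rfl
    | cons i w =>
      exact (wordDeriv_congr hD (hpd i) w).trans ((hi i).2 w (by simpa using hw))

theorem enorm_pderivs_le_c1Norm {τ : ℕ} {β : Fin d → ℕ} (hβ : order β ≤ τ) (v : Rd d → F)
    {x : Rd d} (hx : x ∈ D) : ‖pderivs β v x‖ₑ ≤ c1Norm D τ v := by
  refine (le_iSup₂ (f := fun x (_ : x ∈ D) => ‖pderivs β v x‖ₑ) x hx).trans ?_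
  exact (Finset.single_le_sum (f := fun β => ⨆ x ∈ D, ‖pderivs β v x‖ₑ) (fun _ _ => zero_le)
    (mem_multiIdx.2 hβ)).trans (le_add_right le_rfl)

theorem enorm_le_c1Norm (τ : ℕ) (v : Rd d → F) {x : Rd d} (hx : x ∈ D) :
    ‖v x‖ₑ ≤ c1Norm D τ v := by
  have := enorm_pderivs_le_c1Norm (τ := τ) (β := 0) (by simp [order]) v hx
  rwa [pderivs_zero] at this

/-- Completeness of `C^{τ,1}`: an absolutely convergent series of functions of class `C^{τ,1}` is
of class `C^{τ,1}`, with the expected norm bound. -/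
theorem c1Norm_tsum_le [CompleteSpace F] (hD : IsOpen D) {τ : ℕ} {φ : ℕ → Rd d → F}
    (hφ : ∀ k, ContDiffOn ℝ τ (φ k) D) (hs : ∑' k, c1Norm D τ (φ k) ≠ ∞) :
    ContDiffOn ℝ τ (fun x => ∑' k, φ k x) D ∧
      c1Norm D τ (fun x => ∑' k, φ k x) ≤ ∑' k, c1Norm D τ (φ k) := by
  have hk : ∀ k, c1Norm D τ (φ k) ≠ ∞ := fun k => ENNReal.ne_top_of_tsum_ne_top hs k
  have hbd : ∀ k (β : Fin d → ℕ), order β ≤ τ → ∀ x ∈ D,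
      ‖pderivs β (φ k) x‖ ≤ (c1Norm D τ (φ k)).toReal := by
    intro k β hβ x hx
    rw [← toReal_enorm]
    exact ENNReal.toReal_mono (hk k) (enorm_pderivs_le_c1Norm hβ (φ k) hx)
  have hsum := ENNReal.summable_toReal hs
  obtain ⟨h1, h2⟩ := contDiffOn_tsum_of_wordDeriv hD hφ hsum (fun k w hw x hx => by
    rw [wordDeriv_eq_pderivs hD ((hφ k).of_le (by exact_mod_cast hw)) hx]
    exact hbd k _ (by rwa [order_count]) x hx)
  have h3 : ∀ β : Fin d → ℕ, order β ≤ τ →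
      EqOn (pderivs β (fun x => ∑' k, φ k x)) (fun x => ∑' k, pderivs β (φ k) x) D := by
    intro β hβ
    have := h2 (word β) (by rwa [length_word])
    simpa only [pderivs_eq_wordDeriv] using this
  refine ⟨h1, ?_⟩
  have hsplit : ∑' k, c1Norm D τ (φ k)
      = ∑ β ∈ multiIdx d τ, ∑' k, (⨆ x ∈ D, ‖pderivs β (φ k) x‖ₑ)
        + ∑ β ∈ (multiIdx d τ).filter (fun β => order β = τ),
          ∑' k, eHolderNorm 1 (D.domRestrict (pderivs β (φ k))) := by
    simp only [c1Norm]
    rw [ENNReal.tsum_add, Summable.tsum_finsetSum fun _ _ => ENNReal.summable,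
      Summable.tsum_finsetSum fun _ _ => ENNReal.summable]
  rw [hsplit, c1Norm]
  refine add_le_add (Finset.sum_le_sum fun β hβ => ?_) (Finset.sum_le_sum fun β hβ => ?_)
  · refine iSup₂_le fun x hx => ?_
    rw [h3 β (mem_multiIdx.1 hβ) hx]
    refine enorm_tsum_le_tsum_enorm.trans (ENNReal.tsum_le_tsum fun k => ?_)
    exact le_iSup₂ (f := fun x (_ : x ∈ D) => ‖pderivs β (φ k) x‖ₑ) x hx
  · obtain ⟨hβ1, hβ2⟩ := Finset.mem_filter.1 hβ
    have hle : ∀ k, eHolderNorm 1 (D.domRestrict (pderivs β (φ k))) ≤ c1Norm D τ (φ k) :=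
      fun k => (Finset.single_le_sum
        (f := fun β => eHolderNorm 1 (D.domRestrict (pderivs β (φ k)))) (fun _ _ => zero_le)
        hβ).trans (le_add_left le_rfl)
    have hLfin : ∑' k, eHolderNorm 1 (D.domRestrict (pderivs β (φ k))) ≠ ∞ :=
      ne_top_of_le_ne_top hs (ENNReal.tsum_le_tsum hle)
    have hL : ∀ k, eHolderNorm 1 (D.domRestrict (pderivs β (φ k))) ≠ ∞ := fun k =>
      ENNReal.ne_top_of_tsum_ne_top hLfin k
    rw [← ENNReal.coe_toNNReal hLfin]
    refine HolderWith.eHolderNorm_le (holderWith_one.2 fun x y => ?_)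
    rw [ENNReal.coe_toNNReal hLfin]
    have hsm : ∀ x ∈ D, Summable fun k => pderivs β (φ k) x := fun x hx =>
      Summable.of_norm_bounded hsum fun k => hbd k β (mem_multiIdx.1 hβ1) x hx
    simp only [Set.domRestrict_apply]
    rw [h3 β (mem_multiIdx.1 hβ1) x.2, h3 β (mem_multiIdx.1 hβ1) y.2, edist_eq_enorm_sub,
      ← (hsm x x.2).tsum_sub (hsm y y.2), ← ENNReal.tsum_mul_right]
    refine enorm_tsum_le_tsum_enorm.trans (ENNReal.tsum_le_tsum fun k => ?_)
    rw [← edist_eq_enorm_sub]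
    have hw := holderWith_one.1 (eHolderNorm_ne_top.1 (hL k)).holderWith
    have := hw x y
    rwa [(eHolderNorm_ne_top.1 (hL k)).coe_nnHolderNorm_eq_eHolderNorm] at this

theorem pderivs_const_smul (c : ℝ) (β : Fin d → ℕ) (v : Rd d → F) :
    pderivs β (c • v) = c • pderivs β v := by
  rw [pderivs_eq_wordDeriv, pderivs_eq_wordDeriv]
  induction word β generalizing v with
  | nil => rfl
  | cons i w ih =>
    have : pderiv i (c • v) = c • pderiv i v := by
      funext x
      simp [pderiv, fderiv_const_smul_field]
    rw [wordDeriv, this, ih]; rfl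

theorem c1Norm_const_smul (c : ℝ) (τ : ℕ) (v : Rd d → F) :
    c1Norm D τ (c • v) = ‖c‖ₑ * c1Norm D τ v := by
  simp only [c1Norm, pderivs_const_smul, mul_add, Finset.mul_sum]
  congr 1
  · refine Finset.sum_congr rfl fun β _ => ?_
    simp only [ENNReal.mul_iSup, Pi.smul_apply, enorm_smul]
  · refine Finset.sum_congr rfl fun β _ => ?_
    exact eHolderNorm_smul (f := D.domRestrict (pderivs β v)) c

end Series

/-! ### The embedding of `C^{τ,1}` into `W^{τ+1,∞}` -/

section Embedding

variable {d : ℕ} {D : Set (Rd d)} {F : Type*} [NormedAddCommGroup F] [NormedSpace ℝ F]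

theorem pderivs_const (e : F) {β : Fin d → ℕ} (hβ : β ≠ 0) :
    pderivs β (fun _ : Rd d => e) = fun _ => 0 := by
  have h0 : ∀ w : List (Fin d), wordDeriv w (fun _ : Rd d => (0 : F)) = fun _ => 0 := by
    intro w
    induction w with
    | nil => rfl
    | cons i w ih =>
      have : pderiv i (fun _ : Rd d => (0 : F)) = fun _ => 0 := by funext x; simp [pderiv]
      rw [wordDeriv, this, ih]
  rw [pderivs_eq_wordDeriv]
  cases hw : word β with
  | nil =>
    refine absurd (funext fun i => ?_) hβ
    rw [← count_word β i, hw]; rfl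
  | cons i w =>
    have : pderiv i (fun _ : Rd d => e) = fun _ => 0 := by funext x; simp [pderiv]
    rw [wordDeriv, this, h0]

theorem c1Norm_const_le (D : Set (Rd d)) (τ : ℕ) (e : F) :
    c1Norm D τ (fun _ => e) ≤ ‖e‖ₑ := by
  have h1 : ∀ β ∈ (multiIdx d τ).filter (fun β => order β = τ),
      eHolderNorm 1 (D.domRestrict (pderivs β (fun _ : Rd d => e))) = 0 := by
    intro β _
    by_cases hβ : β = 0
    · rw [hβ, pderivs_zero]
      exact eHolderNorm_const _ _ _
    · rw [pderivs_const e hβ]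
      exact eHolderNorm_const _ _ _
  rw [c1Norm, Finset.sum_eq_zero h1, add_zero,
    Finset.sum_eq_single_of_mem 0 (zero_mem_multiIdx τ)]
  · rw [pderivs_zero]
    exact iSup₂_le fun _ _ => le_rfl
  · intro β _ hβ
    rw [pderivs_const e hβ]
    simp

theorem memC1_const (D : Set (Rd d)) (τ : ℕ) (e : F) : MemC1 D τ (fun _ => e) := by
  refine ⟨contDiffOn_const, fun β _ => ⟨pderivs β (fun _ => e), ?_, fun _ _ => rfl⟩,
    (c1Norm_const_le D τ e).trans_lt enorm_lt_top⟩
  by_cases hβ : β = 0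
  · rw [hβ, pderivs_zero]; exact continuousOn_const
  · rw [pderivs_const e hβ]; exact continuousOn_const

/-- The norm of the embedding of `C^{τ,1}` into `W^{τ+1,∞}` is at least `1`, as constants show.
The set of admissible constants is non-empty, so the infimum defining the norm is a genuine one. -/
theorem one_le_cEmb (hd : 0 < d) (hD : IsOpen D) (hDne : D.Nonempty) (τ : ℕ) :
    1 ≤ cEmb D τ := by
  refine le_csInf ⟨1 + d, by positivity, fun v hv => ?_⟩ ?_
  · obtain ⟨⟨p, hp, _, h2⟩, _⟩ := exists_majorant_of_c1Norm_le hd hD hv.contDiffOn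
      (M := (c1Norm D τ v).toNNReal) (ENNReal.coe_toNNReal hv.norm_lt_top.ne).ge
    refine (hp.sobolevNorm_le hD).trans ?_
    refine (ENNReal.coe_le_coe.2 h2).trans (le_of_eq ?_)
    rw [ENNReal.coe_mul, ENNReal.coe_toNNReal hv.norm_lt_top.ne]
    congr 1
    rw [show (1 + d : ℝ) = ((1 + d : ℝ≥0) : ℝ) by push_cast; rfl, ENNReal.ofReal_coe_nnreal]
  · rintro c ⟨hc, h⟩
    set e : Rd d := EuclideanSpace.single ⟨0, hd⟩ 1
    have he : ‖e‖ₑ = 1 := by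
      rw [← ofReal_norm]
      simp [e]
    have h1 := h _ (memC1_const D τ e)
    have hμ : volume.restrict D ≠ 0 := by
      rw [Ne, Measure.restrict_eq_zero]
      exact (hD.measure_pos volume hDne).ne'
    have h2 := eLpNorm_le_sobolevNorm hD (τ + 1) ∞ (fun _ => e)
    rw [eLpNorm_const _ (by simp) hμ, he] at h2
    have h3 : (1 : ℝ≥0∞) ≤ ENNReal.ofReal c := by
      calc (1 : ℝ≥0∞) ≤ _ := by simpa using h2
        _ ≤ _ := h1
        _ ≤ ENNReal.ofReal c * 1 := by gcongr; exact (c1Norm_const_le D τ e).trans he.le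
        _ = _ := mul_one _
    rwa [ENNReal.one_le_ofReal] at h3

end Embedding

/-! ### Bounds for higher derivatives -/

section DerivativeBounds

variable {X Z E F G : Type*} [NormedAddCommGroup X] [NormedSpace ℝ X]
  [NormedAddCommGroup Z] [NormedSpace ℝ Z]
  [NormedAddCommGroup E] [NormedSpace ℝ E] [CompleteSpace E]
  [NormedAddCommGroup F] [NormedSpace ℝ F] [CompleteSpace F]
  [NormedAddCommGroup G] [NormedSpace ℝ G]

/-- Leibniz's rule for divided derivatives, at a point of analyticity. -/
theorem norm_iteratedFDeriv_bilinear_le (B : E →L[ℝ] F →L[ℝ] G) (hB : ‖B‖ ≤ 1) {f : X → E}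
    {g : X → F} {a : X} (hf : AnalyticAt ℝ f a) (hg : AnalyticAt ℝ g a) {α β : ℕ → ℝ}
    (hα : ∀ n, ‖iteratedFDeriv ℝ n f a‖ ≤ n.factorial * α n)
    (hβ : ∀ n, ‖iteratedFDeriv ℝ n g a‖ ≤ n.factorial * β n) (n : ℕ) :
    ‖iteratedFDeriv ℝ n (fun x => B (f x) (g x)) a‖
      ≤ n.factorial * ∑ i ∈ Finset.range (n + 1), α i * β (n - i) := by
  obtain ⟨s, hs, hso, has⟩ := eventually_nhds_iff.1
    (hf.eventually_analyticAt.and hg.eventually_analyticAt)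
  have hfs : ContDiffOn ℝ n f s := fun x hx => (hs x hx).1.contDiffAt.contDiffWithinAt
  have hgs : ContDiffOn ℝ n g s := fun x hx => (hs x hx).2.contDiffAt.contDiffWithinAt
  have := B.norm_iteratedFDerivWithin_le_of_bilinear_of_le_one hfs hgs hso.uniqueDiffOn has le_rfl
    hB
  simp only [iteratedFDerivWithin_of_isOpen _ hso has] at this
  refine this.trans ?_
  rw [Finset.mul_sum]
  refine Finset.sum_le_sum fun i hi => ?_
  have hin : i ≤ n := Nat.lt_succ_iff.1 (Finset.mem_range.1 hi)
  have h0 : 0 ≤ (i.factorial : ℝ) * α i := (norm_nonneg _).trans (hα i)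
  calc (n.choose i : ℝ) * ‖iteratedFDeriv ℝ i f a‖ * ‖iteratedFDeriv ℝ (n - i) g a‖
      ≤ n.choose i * (i.factorial * α i) * ((n - i).factorial * β (n - i)) := by
        gcongr
        · exact hα i
        · exact hβ _
    _ = (n.choose i * i.factorial * (n - i).factorial : ℕ) * (α i * β (n - i)) := by
        push_cast; ring
    _ = _ := by rw [Nat.choose_mul_factorial_mul_factorial hin]

theorem norm_iteratedFDeriv_comp_clm_le (L : X →L[ℝ] Z) (hL : ‖L‖ ≤ 1) {f : Z → F} {a : X}
    (hf : AnalyticAt ℝ f (L a)) (n : ℕ) :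
    ‖iteratedFDeriv ℝ n (fun x => f (L x)) a‖ ≤ ‖iteratedFDeriv ℝ n f (L a)‖ := by
  obtain ⟨s, hs, hso, has⟩ := eventually_nhds_iff.1 hf.eventually_analyticAt
  have hfs : ContDiffOn ℝ n f s := fun x hx => (hs x hx).contDiffAt.contDiffWithinAt
  have hpo : IsOpen (L ⁻¹' s) := hso.preimage L.continuous
  have h := L.iteratedFDerivWithin_comp_right hfs hso.uniqueDiffOn hpo.uniqueDiffOn has
    (i := n) le_rfl
  rw [iteratedFDerivWithin_of_isOpen _ hpo has, iteratedFDerivWithin_of_isOpen _ hso has] at h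
  change ‖iteratedFDeriv ℝ n (f ∘ L) a‖ ≤ _
  rw [h]
  refine (ContinuousMultilinearMap.norm_compContinuousLinearMap_le _ _).trans ?_
  refine mul_le_of_le_one_right (norm_nonneg _) ?_
  exact Finset.prod_le_one (fun _ _ => norm_nonneg _) fun _ _ => hL

theorem norm_iteratedFDeriv_clm_comp_le (L : E →L[ℝ] G) (hL : ‖L‖ ≤ 1) {f : X → E} {a : X}
    (hf : AnalyticAt ℝ f a) (n : ℕ) :
    ‖iteratedFDeriv ℝ n (fun x => L (f x)) a‖ ≤ ‖iteratedFDeriv ℝ n f a‖ := by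
  have h := L.iteratedFDeriv_comp_left (hf.contDiffAt (n := n)) (i := n) le_rfl
  change ‖iteratedFDeriv ℝ n (L ∘ f) a‖ ≤ _
  rw [h]
  exact (L.norm_compContinuousMultilinearMap_le _).trans
    (mul_le_of_le_one_left (norm_nonneg _) hL)

/-- The divided derivatives of the inversion grow like those of a geometric series. -/
theorem norm_iteratedFDeriv_inverse_le {R : Type*} [NormedRing R] [NormedAlgebra ℝ R]
    [CompleteSpace R] (n : ℕ) (x : Rˣ) :
    ‖iteratedFDeriv ℝ n (Ring.inverse : R → R) x‖
      ≤ n.factorial * ‖((x⁻¹ : Rˣ) : R)‖ ^ (n + 1) := by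
  induction n using Nat.strong_induction_on generalizing x with
  | _ n ih =>
    cases n with
    | zero => simp
    | succ n =>
      -- `D(y⁻¹) h = -y⁻¹ h y⁻¹` expresses the derivative of the inversion by the inversion.
      have hev : fderiv ℝ (Ring.inverse : R → R) =ᶠ[𝓝 (x : R)] fun y =>
          -(ContinuousLinearMap.mulLeftRight ℝ R (Ring.inverse y) (Ring.inverse y)) := by
        filter_upwards [Units.isOpen.mem_nhds x.isUnit] with y hy
        obtain ⟨u, rfl⟩ := hy
        rw [fderiv_inverse, Ring.inverse_unit]
      rw [← norm_iteratedFDeriv_fderiv, (hev.iteratedFDeriv ℝ n).eq_of_nhds]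
      have hneg : iteratedFDeriv ℝ n (fun y : R =>
          -(ContinuousLinearMap.mulLeftRight ℝ R (Ring.inverse y) (Ring.inverse y))) x
          = -iteratedFDeriv ℝ n (fun y : R =>
          (ContinuousLinearMap.mulLeftRight ℝ R (Ring.inverse y) (Ring.inverse y))) x :=
        iteratedFDeriv_neg_apply
      rw [hneg, norm_neg]
      have han := analyticAt_inverse (𝕜 := ℝ) x
      -- Leibniz's rule is stated with bounds for all orders, whereas the induction hypothesis
      -- covers the orders `i ≤ n` only; beyond, the derivative serves as its own bound.
      have h0 : ∀ i, ‖iteratedFDeriv ℝ i (Ring.inverse : R → R) x‖ ≤ i.factorial *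
          (if i ≤ n then ‖((x⁻¹ : Rˣ) : R)‖ ^ (i + 1) else
            ‖iteratedFDeriv ℝ i (Ring.inverse : R → R) x‖) := by
        intro i
        split_ifs with hi
        · exact ih i (by omega) x
        · exact le_mul_of_one_le_left (norm_nonneg _) (by exact_mod_cast i.factorial_pos)
      refine (norm_iteratedFDeriv_bilinear_le (ContinuousLinearMap.mulLeftRight ℝ R)
        (ContinuousLinearMap.opNorm_mulLeftRight_le ℝ R) han han h0 h0 n).trans (le_of_eq ?_)
      have : ∀ i ∈ Finset.range (n + 1),
          (if i ≤ n then ‖((x⁻¹ : Rˣ) : R)‖ ^ (i + 1) else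
            ‖iteratedFDeriv ℝ i (Ring.inverse : R → R) x‖) *
          (if n - i ≤ n then ‖((x⁻¹ : Rˣ) : R)‖ ^ (n - i + 1) else
            ‖iteratedFDeriv ℝ (n - i) (Ring.inverse : R → R) x‖)
          = ‖((x⁻¹ : Rˣ) : R)‖ ^ (n + 2) := by
        intro i hi
        have hin : i ≤ n := Nat.lt_succ_iff.1 (Finset.mem_range.1 hi)
        rw [if_pos hin, if_pos (Nat.sub_le _ _), ← pow_add]
        congr 1; omega
      rw [Finset.sum_congr rfl this, Finset.sum_const, Finset.card_range, nsmul_eq_mul,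
        Nat.factorial_succ]
      push_cast; ring

end DerivativeBounds

/-! ### The determinant -/

section Determinant

variable {d : ℕ}

/-- The columns of a matrix. -/
def columns (d : ℕ) : Mat d →L[ℝ] (Fin d → Rd d) :=
  ContinuousLinearMap.pi fun i => ContinuousLinearMap.apply ℝ (Rd d) (EuclideanSpace.single i 1)

theorem norm_columns_apply_le (J : Mat d) : ‖columns d J‖ ≤ ‖J‖ := by
  refine (pi_norm_le_iff_of_nonneg (norm_nonneg _)).2 fun i => ?_
  exact (J.le_opNorm _).trans (by simp)

theorem norm_columns_le : ‖columns d‖ ≤ 1 :=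
  ContinuousLinearMap.opNorm_le_bound _ zero_le_one fun J => by
    rw [one_mul]; exact norm_columns_apply_le J

/-- The determinant as a multilinear function of the columns; its norm is at most `1` by Hadamard's
inequality. -/
def detForm (d : ℕ) : ContinuousMultilinearMap ℝ (fun _ : Fin d => Rd d) ℝ :=
  (EuclideanSpace.basisFun (Fin d) ℝ).toBasis.det.toMultilinearMap.mkContinuous 1 fun v => by
    have : Fact (Module.finrank ℝ (Rd d) = d) := ⟨by simp⟩
    have h := (EuclideanSpace.basisFun (Fin d) ℝ).toBasis.orientation.abs_volumeForm_apply_le v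
    rw [Orientation.volumeForm_robust _ (EuclideanSpace.basisFun (Fin d) ℝ) rfl] at h
    rw [one_mul]
    exact h

theorem norm_detForm_le : ‖detForm d‖ ≤ 1 :=
  MultilinearMap.mkContinuous_norm_le _ zero_le_one _

theorem det_eq_detForm (J : Mat d) : J.det = detForm d (columns d J) := by
  have h := (EuclideanSpace.basisFun (Fin d) ℝ).toBasis.det_comp (J : Rd d →ₗ[ℝ] Rd d)
    (EuclideanSpace.basisFun (Fin d) ℝ).toBasis
  rw [Module.Basis.det_self, mul_one] at h
  rw [ContinuousLinearMap.det, ← h]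
  change _ = (EuclideanSpace.basisFun (Fin d) ℝ).toBasis.det _
  congr 1
  funext i
  simp [columns]

theorem analyticAt_det (J : Mat d) : AnalyticAt ℝ (fun J : Mat d => J.det) J := by
  have h : ContDiff ℝ ⊤ fun J : Mat d => J.det := by
    simp only [det_eq_detForm]
    exact (detForm d).contDiff.comp (columns d).contDiff
  exact h.contDiffAt.analyticAt

/-- The `n`-th derivative of a multilinear form of norm `1` in `d` variables is a sum of `d!/(d-n)!`
terms, each containing `d - n` of the columns. -/
theorem norm_iteratedFDeriv_det_le {J : Mat d} {σup : ℝ} (hσ : 1 ≤ σup) (hJ : ‖J‖ ≤ σup) (n : ℕ) :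
    ‖iteratedFDeriv ℝ n (fun J : Mat d => J.det) J‖
      ≤ n.factorial * (d.choose n * σup ^ d) := by
  have han : AnalyticAt ℝ (detForm d) (columns d J) := (detForm d).contDiff.contDiffAt.analyticAt
  simp only [det_eq_detForm]
  refine (norm_iteratedFDeriv_comp_clm_le (columns d) norm_columns_le han n).trans ?_
  refine ((detForm d).norm_iteratedFDeriv_le n _).trans ?_
  rw [Fintype.card_fin, Nat.descFactorial_eq_factorial_mul_choose]
  push_cast
  calc (n.factorial * d.choose n : ℝ) * ‖detForm d‖ * ‖columns d J‖ ^ (d - n)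
      ≤ (n.factorial * d.choose n : ℝ) * 1 * σup ^ (d - n) := by
        gcongr
        · exact norm_detForm_le
        · exact (norm_columns_apply_le J).trans hJ
    _ ≤ (n.factorial * d.choose n : ℝ) * 1 * σup ^ d := by
        gcongr
        exact Nat.sub_le _ _
    _ = _ := by ring

theorem sum_choose_le (d n : ℕ) : ∑ i ∈ Finset.range (n + 1), (d.choose i : ℝ) ≤ 2 ^ d := by
  have : ∑ i ∈ Finset.range (n + 1), d.choose i ≤ 2 ^ d := by
    rw [← Nat.sum_range_choose]
    calc _ ≤ ∑ i ∈ Finset.range (max (n + 1) (d + 1)), d.choose i :=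
          Finset.sum_le_sum_of_subset (Finset.range_subset_range.2 (le_max_left _ _))
      _ = _ := by
          refine (Finset.sum_subset (Finset.range_subset_range.2 (le_max_right _ _)) ?_).symm
          intro i _ hi
          exact Nat.choose_eq_zero_of_lt (by simpa using hi)
  exact_mod_cast this

end Determinant

/-! ### The diffusion matrix and the loading as functions of the jet -/

section Data

variable {d : ℕ}

/-- The set of matrices with singular values between `σlow` and `σup`. -/
def matSet (d : ℕ) (σlow σup : ℝ) : Set (Mat d) :=
  {J | ∀ ξ, σlow * ‖ξ‖ ≤ ‖J ξ‖ ∧ ‖J ξ‖ ≤ σup * ‖ξ‖}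

theorem norm_le_of_mem_matSet {σlow σup : ℝ} (hσ : 1 ≤ σup) {J : Mat d}
    (hJ : J ∈ matSet d σlow σup) : ‖J‖ ≤ σup :=
  J.opNorm_le_bound (by linarith) fun ξ => (hJ ξ).2

theorem exists_unit_of_mem_matSet {σlow σup : ℝ} (hσ : 0 < σlow) {J : Mat d}
    (hJ : J ∈ matSet d σlow σup) :
    ∃ u : (Mat d)ˣ, (u : Mat d) = J ∧ ‖((u⁻¹ : (Mat d)ˣ) : Mat d)‖ ≤ σlow⁻¹ := by
  have hinj : Function.Injective J := by
    intro x y hxy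
    have h := (hJ (x - y)).1
    rw [map_sub, hxy, sub_self, norm_zero] at h
    have : ‖x - y‖ ≤ 0 := by
      by_contra hcon
      push Not at hcon
      nlinarith
    exact sub_eq_zero.1 (norm_le_zero_iff.1 this)
  have hbij : Function.Bijective (J : Rd d →ₗ[ℝ] Rd d) :=
    ⟨hinj, LinearMap.injective_iff_surjective.1 hinj⟩
  set e : Rd d ≃L[ℝ] Rd d :=
    (LinearEquiv.ofBijective (J : Rd d →ₗ[ℝ] Rd d) hbij).toContinuousLinearEquiv with he
  have heJ : (e : Rd d →L[ℝ] Rd d) = J := by ext x; rfl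
  refine ⟨e.toUnit, heJ, ContinuousLinearMap.opNorm_le_bound _ (by positivity) fun x => ?_⟩
  have hx : J (e.symm x) = x := e.apply_symm_apply x
  have h := (hJ (e.symm x)).1
  rw [hx] at h
  change ‖e.symm x‖ ≤ _
  rw [inv_mul_eq_div, le_div_iff₀ hσ, mul_comm]
  exact h

/-- Taking the adjoint, as a real linear map. -/
def adjointL (d : ℕ) : Mat d →L[ℝ] Mat d :=
  LinearMap.mkContinuous
    { toFun := fun A => ContinuousLinearMap.adjoint A
      map_add' := fun A B => map_add _ A B
      map_smul' := fun c A => by simp } 1 fun A => by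
        rw [one_mul]; exact (ContinuousLinearMap.adjoint.norm_map A).le

theorem adjointL_apply (A : Mat d) : adjointL d A = ContinuousLinearMap.adjoint A := rfl

theorem norm_adjointL_le : ‖adjointL d‖ ≤ 1 := LinearMap.mkContinuous_norm_le _ zero_le_one _

/-- The diffusion matrix as a function of the Jacobian. -/
def diffusion (J : Mat d) : Mat d :=
  J.det • Ring.inverse (ContinuousLinearMap.adjoint J * J)

theorem inverse_adjoint_mul_self (u : (Mat d)ˣ) :
    Ring.inverse (ContinuousLinearMap.adjoint (u : Mat d) * (u : Mat d))
      = Ring.inverse (u : Mat d) * adjointL d (Ring.inverse (u : Mat d)) := by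
  have h : ContinuousLinearMap.adjoint (u : Mat d) * (u : Mat d)
      = ((star u * u : (Mat d)ˣ) : Mat d) := by
    rw [Units.val_mul, Units.coe_star]; rfl
  rw [h, Ring.inverse_unit, Ring.inverse_unit, mul_inv_rev, Units.val_mul, adjointL_apply]
  rfl

theorem diffusion_eventuallyEq (u : (Mat d)ˣ) : (diffusion : Mat d → Mat d) =ᶠ[𝓝 (u : Mat d)]
    fun J => ContinuousLinearMap.lsmul ℝ ℝ J.det
      (ContinuousLinearMap.compL ℝ (Rd d) (Rd d) (Rd d) (Ring.inverse J)
        (adjointL d (Ring.inverse J))) := by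
  filter_upwards [Units.isOpen.mem_nhds u.isUnit] with J hJ
  obtain ⟨u, rfl⟩ := hJ
  rw [diffusion, inverse_adjoint_mul_self]
  rfl

theorem analyticAt_inverse_mul_adjoint (u : (Mat d)ˣ) : AnalyticAt ℝ (fun J : Mat d =>
    ContinuousLinearMap.compL ℝ (Rd d) (Rd d) (Rd d) (Ring.inverse J)
      (adjointL d (Ring.inverse J))) u := by
  have h1 := analyticAt_inverse (𝕜 := ℝ) u
  have h2 : AnalyticAt ℝ (fun J : Mat d => adjointL d (Ring.inverse J)) u :=
    ((adjointL d).analyticAt _).comp h1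
  exact ((ContinuousLinearMap.compL ℝ (Rd d) (Rd d) (Rd d)).analyticAt_bilinear _).comp₂ h1 h2

theorem analyticAt_diffusion (u : (Mat d)ˣ) : AnalyticAt ℝ (diffusion : Mat d → Mat d) u := by
  refine AnalyticAt.congr ?_ (diffusion_eventuallyEq u).symm
  exact (analyticAt_det _).smul (analyticAt_inverse_mul_adjoint u)

theorem norm_iteratedFDeriv_inverse_mul_adjoint_le {c : ℝ} {u : (Mat d)ˣ}
    (hu : ‖((u⁻¹ : (Mat d)ˣ) : Mat d)‖ ≤ c) (n : ℕ) :
    ‖iteratedFDeriv ℝ n (fun J : Mat d => ContinuousLinearMap.compL ℝ (Rd d) (Rd d) (Rd d)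
      (Ring.inverse J) (adjointL d (Ring.inverse J))) u‖
      ≤ n.factorial * ((n + 1) * c ^ (n + 2)) := by
  have hinv := analyticAt_inverse (𝕜 := ℝ) u
  have hadj : AnalyticAt ℝ (fun J : Mat d => adjointL d (Ring.inverse J)) u :=
    ((adjointL d).analyticAt _).comp hinv
  have hα : ∀ n, ‖iteratedFDeriv ℝ n (Ring.inverse : Mat d → Mat d) u‖
      ≤ n.factorial * c ^ (n + 1) := fun n => by
    refine (norm_iteratedFDeriv_inverse_le n u).trans ?_
    gcongr
  have hβ : ∀ n, ‖iteratedFDeriv ℝ n (fun J : Mat d => adjointL d (Ring.inverse J)) u‖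
      ≤ n.factorial * c ^ (n + 1) := fun n =>
    (norm_iteratedFDeriv_clm_comp_le _ norm_adjointL_le hinv n).trans (hα n)
  refine (norm_iteratedFDeriv_bilinear_le _
    (ContinuousLinearMap.norm_compL_le ℝ (Rd d) (Rd d) (Rd d))
    hinv hadj hα hβ n).trans (le_of_eq ?_)
  have : ∀ i ∈ Finset.range (n + 1), c ^ (i + 1) * c ^ (n - i + 1) = c ^ (n + 2) := by
    intro i hi
    have hin : i ≤ n := Nat.lt_succ_iff.1 (Finset.mem_range.1 hi)
    rw [← pow_add]; congr 1; omega
  rw [Finset.sum_congr rfl this, Finset.sum_const, Finset.card_range, nsmul_eq_mul]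
  push_cast
  rfl

/-- The linear factor from Leibniz's rule is absorbed by `n - i + 1 ≤ 2 ^ n`, which doubles the
rate. -/
theorem sum_choose_mul_le {σup c : ℝ} (hσ : 0 ≤ σup) (hc1 : 1 ≤ c) (d n : ℕ) :
    ∑ i ∈ Finset.range (n + 1), (d.choose i * σup ^ d) * (((n - i : ℕ) + 1) * c ^ (n - i + 2))
      ≤ 2 ^ d * (σup ^ d * 2 ^ n * c ^ (n + 2)) := by
  have key : ∀ i ∈ Finset.range (n + 1),
      (d.choose i * σup ^ d) * (((n - i : ℕ) + 1) * c ^ (n - i + 2))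
        ≤ d.choose i * (σup ^ d * 2 ^ n * c ^ (n + 2)) := by
    intro i hi
    have hin : i ≤ n := Nat.lt_succ_iff.1 (Finset.mem_range.1 hi)
    have e1 : (((n - i : ℕ) : ℝ) + 1) ≤ 2 ^ n := by
      have : n - i + 1 ≤ 2 ^ n :=
        (Nat.succ_le_of_lt (Nat.lt_two_pow_self)).trans
          (Nat.pow_le_pow_right (by norm_num) (Nat.sub_le n i))
      exact_mod_cast this
    have e2 : c ^ (n - i + 2) ≤ c ^ (n + 2) := pow_le_pow_right₀ hc1 (by omega)
    calc _ = d.choose i * (σup ^ d * (((n - i : ℕ) : ℝ) + 1) * c ^ (n - i + 2)) := by ring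
      _ ≤ _ := by gcongr
  refine (Finset.sum_le_sum key).trans ?_
  rw [← Finset.sum_mul]
  gcongr
  exact sum_choose_le d n

/-- Cauchy estimates for the diffusion matrix, from `(JᵀJ)⁻¹ = J⁻¹ (J⁻¹)ᵀ` and `‖J⁻¹‖ ≤ σlow⁻¹`. -/
theorem norm_iteratedFDeriv_diffusion_le {σlow σup : ℝ} (h0 : 0 < σlow) (h1 : σlow ≤ 1)
    (h2 : 1 ≤ σup) {J : Mat d} (hJ : J ∈ matSet d σlow σup) (n : ℕ) :
    ‖iteratedFDeriv ℝ n (diffusion : Mat d → Mat d) J‖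
      ≤ n.factorial * kT d σlow σup * (2 * σlow⁻¹) ^ n := by
  obtain ⟨u, rfl, hu⟩ := exists_unit_of_mem_matSet h0 hJ
  rw [((diffusion_eventuallyEq u).iteratedFDeriv ℝ n).eq_of_nhds]
  have hQ := norm_iteratedFDeriv_inverse_mul_adjoint_le hu
  have hdet := norm_iteratedFDeriv_det_le h2 (norm_le_of_mem_matSet h2 hJ)
  have := norm_iteratedFDeriv_bilinear_le (ContinuousLinearMap.lsmul ℝ ℝ)
    ContinuousLinearMap.opNorm_lsmul_le (analyticAt_det (u : Mat d))
    (analyticAt_inverse_mul_adjoint u) hdet hQ n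
  refine this.trans ?_
  rw [mul_assoc]
  refine mul_le_mul_of_nonneg_left ?_ (Nat.cast_nonneg _)
  refine (sum_choose_mul_le (by linarith) ((one_le_inv₀ h0).2 h1) d n).trans (le_of_eq ?_)
  rw [kT, ← inv_pow]; ring

theorem isSelfAdjoint_diffusion (J : Mat d) : IsSelfAdjoint (diffusion J) := by
  unfold diffusion
  refine IsSelfAdjoint.smul (by simp [IsSelfAdjoint]) ?_
  have : IsSelfAdjoint (ContinuousLinearMap.adjoint J * J) := by
    exact IsSelfAdjoint.star_mul_self J
  rw [IsSelfAdjoint, ← Ring.inverse_star, this.star_eq]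

/-- The loading as a function of the deformation and its Jacobian. -/
def loading (f : Rd d → ℝ) (a : Rd d × Mat d) : ℝ := f a.1 * a.2.det

theorem analyticAt_loading {f : Rd d → ℝ} {a : Rd d × Mat d} (hf : AnalyticAt ℝ f a.1) :
    AnalyticAt ℝ (loading f) a := by
  have h1 : AnalyticAt ℝ (fun a : Rd d × Mat d => f a.1) a := hf.comp analyticAt_fst
  have h2 : AnalyticAt ℝ (fun a : Rd d × Mat d => a.2.det) a :=
    AnalyticAt.comp (g := fun J : Mat d => J.det) (analyticAt_det _) analyticAt_snd
  exact h1.mul h2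

/-- Cauchy estimates for the loading. The rate is that of `f`, because the determinant is a
polynomial, whose divided derivatives sum up to at most `(2 σup)^d`. -/
theorem norm_iteratedFDeriv_loading_le {f : Rd d → ℝ} {a : Rd d × Mat d}
    (hf : AnalyticAt ℝ f a.1) {kf c σup : ℝ} (hk : 0 ≤ kf) (hc : 1 ≤ c) (hσ : 1 ≤ σup)
    (hfb : ∀ n, ‖iteratedFDeriv ℝ n f a.1‖ ≤ n.factorial * (kf * c ^ n)) (ha : ‖a.2‖ ≤ σup)
    (n : ℕ) : ‖iteratedFDeriv ℝ n (loading f) a‖ ≤ n.factorial * kS d σup kf * c ^ n := by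
  have h1 : AnalyticAt ℝ (fun a : Rd d × Mat d => f a.1) a := hf.comp analyticAt_fst
  have h2 : AnalyticAt ℝ (fun a : Rd d × Mat d => a.2.det) a :=
    AnalyticAt.comp (g := fun J : Mat d => J.det) (analyticAt_det _) analyticAt_snd
  have hα : ∀ n, ‖iteratedFDeriv ℝ n (fun a : Rd d × Mat d => f a.1) a‖
      ≤ n.factorial * (kf * c ^ n) := fun n =>
    (norm_iteratedFDeriv_comp_clm_le (ContinuousLinearMap.fst ℝ (Rd d) (Mat d))
      (ContinuousLinearMap.norm_fst_le ..) hf n).trans (hfb n)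
  have hβ : ∀ n, ‖iteratedFDeriv ℝ n (fun a : Rd d × Mat d => a.2.det) a‖
      ≤ n.factorial * (d.choose n * σup ^ d) := fun n =>
    (norm_iteratedFDeriv_comp_clm_le (f := fun J : Mat d => J.det)
      (ContinuousLinearMap.snd ℝ (Rd d) (Mat d))
      (ContinuousLinearMap.norm_snd_le ..) (analyticAt_det _) n).trans
      (norm_iteratedFDeriv_det_le hσ ha n)
  refine (norm_iteratedFDeriv_bilinear_le _ (ContinuousLinearMap.opNorm_mul_le ℝ ℝ) h1 h2 hα hβ
    n).trans ?_
  rw [mul_assoc]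
  gcongr
  have hσ0 : 0 ≤ σup := by linarith
  calc ∑ i ∈ Finset.range (n + 1), kf * c ^ i * (d.choose (n - i) * σup ^ d)
      ≤ ∑ i ∈ Finset.range (n + 1), d.choose (n - i) * (kf * c ^ n * σup ^ d) := by
        refine Finset.sum_le_sum fun i hi => ?_
        have hin : i ≤ n := Nat.lt_succ_iff.1 (Finset.mem_range.1 hi)
        have : c ^ i ≤ c ^ n := pow_le_pow_right₀ hc hin
        calc _ = d.choose (n - i) * (kf * c ^ i * σup ^ d) := by ring
          _ ≤ _ := by gcongr
    _ = (∑ i ∈ Finset.range (n + 1), (d.choose i : ℝ)) * (kf * c ^ n * σup ^ d) := by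
        rw [← Finset.sum_mul]
        congr 1
        exact Finset.sum_range_reflect (fun i => (d.choose i : ℝ)) (n + 1)
    _ ≤ 2 ^ d * (kf * c ^ n * σup ^ d) := by
        gcongr; exact sum_choose_le d n
    _ = _ := by rw [kS]; ring

end Data

/-! ### Taylor series along segments -/

section Taylor

variable {E G : Type*} [NormedAddCommGroup E] [NormedSpace ℝ E]
  [NormedAddCommGroup G] [NormedSpace ℝ G]

theorem norm_iteratedFDeriv_iteratedFDeriv (g : E → G) (a : E) (n r : ℕ) :
    ‖iteratedFDeriv ℝ r (iteratedFDeriv ℝ n g) a‖ = ‖iteratedFDeriv ℝ (n + r) g a‖ := by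
  induction n generalizing r with
  | zero =>
    rw [iteratedFDeriv_zero_eq_comp, LinearIsometryEquiv.norm_iteratedFDeriv_comp_left, zero_add]
  | succ n ih =>
    have h := LinearIsometryEquiv.norm_iteratedFDeriv_comp_left
      (𝕜 := ℝ) (F := E →L[ℝ] (E [×n]→L[ℝ] G)) (G := E [×(n + 1)]→L[ℝ] G)
      (continuousMultilinearCurryLeftEquiv ℝ (fun _ : Fin (n + 1) => E) G).symm
      (fderiv ℝ (iteratedFDeriv ℝ n g)) a r
    rw [iteratedFDeriv_succ_eq_comp_left]
    refine h.trans ?_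
    rw [norm_iteratedFDeriv_fderiv, ih, show n + 1 + r = n + (r + 1) by omega]

/-- `D^n g` has divided derivatives of geometric growth if `g` has; the price is a factor `2` in the
rate, from `(n + r)! ≤ 2^{n+r} n! r!`. -/
theorem norm_iteratedFDeriv_iteratedFDeriv_le {g : E → G} {a : E} {k c : ℝ} (hk : 0 ≤ k)
    (hc : 0 ≤ c) (hg : ∀ n, ‖iteratedFDeriv ℝ n g a‖ ≤ n.factorial * k * c ^ n) (n r : ℕ) :
    ‖iteratedFDeriv ℝ r (iteratedFDeriv ℝ n g) a‖
      ≤ r.factorial * (n.factorial * k * (2 * c) ^ n) * (2 * c) ^ r := by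
  rw [norm_iteratedFDeriv_iteratedFDeriv]
  refine (hg _).trans ?_
  have h : (n + r).factorial ≤ 2 ^ (n + r) * (n.factorial * r.factorial) := by
    rw [← Nat.add_choose_mul_factorial_mul_factorial, mul_assoc]
    exact Nat.mul_le_mul_right _ (Nat.choose_le_two_pow _ _)
  have h' : ((n + r).factorial : ℝ) ≤ 2 ^ (n + r) * (n.factorial * r.factorial) := by
    exact_mod_cast h
  calc _ ≤ 2 ^ (n + r) * (n.factorial * r.factorial) * k * c ^ (n + r) := by gcongr
    _ = _ := by rw [mul_pow, mul_pow, pow_add, pow_add]; ring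

theorem iteratedDerivWithin_comp_line [CompleteSpace G] {Ψ : E → G} {a b : E}
    (hΨ : ∀ s ∈ Icc (0 : ℝ) 1, AnalyticAt ℝ Ψ (a + s • b)) (j : ℕ) {s : ℝ}
    (hs : s ∈ Icc (0 : ℝ) 1) :
    iteratedDerivWithin j (fun s : ℝ => Ψ (a + s • b)) (Icc 0 1) s
      = iteratedFDeriv ℝ j Ψ (a + s • b) fun _ => b := by
  induction j generalizing s with
  | zero => simp
  | succ j ih =>
    rw [iteratedDerivWithin_succ, derivWithin_congr (fun t ht => ih ht) (ih hs)]
    have hline : HasDerivAt (fun s : ℝ => a + s • b) b s := by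
      simpa using ((hasDerivAt_id s).smul_const b).const_add a
    have hd : DifferentiableAt ℝ (iteratedFDeriv ℝ j Ψ) (a + s • b) :=
      ((hΨ s hs).contDiffAt (n := (⊤ : ℕ∞))).differentiableAt_iteratedFDeriv
        (by exact_mod_cast ENat.natCast_lt_top j)
    have h1 := hd.hasFDerivAt.comp_hasDerivAt s hline
    have h2 := ((ContinuousMultilinearMap.apply ℝ (fun _ : Fin j => E) G
      (fun _ => b)).hasFDerivAt (x := iteratedFDeriv ℝ j Ψ (a + s • b))).comp_hasDerivAt s h1
    rw [iteratedFDeriv_succ_apply_left]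
    exact h2.hasDerivWithinAt.derivWithin (uniqueDiffOn_Icc zero_lt_one s hs)

/-- Taylor's expansion along a segment on which the derivatives satisfy Cauchy estimates. -/
theorem hasSum_taylor [CompleteSpace G] {Ψ : E → G} {a b : E} {k c : ℝ} (hc : 0 ≤ c)
    (hΨ : ∀ s ∈ Icc (0 : ℝ) 1, AnalyticAt ℝ Ψ (a + s • b))
    (hb : ∀ s ∈ Icc (0 : ℝ) 1, ∀ r,
      ‖iteratedFDeriv ℝ r Ψ (a + s • b)‖ ≤ r.factorial * k * c ^ r)
    (hcb : c * ‖b‖ < 1) :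
    HasSum (fun r : ℕ => (r.factorial : ℝ)⁻¹ • iteratedFDeriv ℝ r Ψ a fun _ => b)
      (Ψ (a + b)) := by
  have h0 : (0 : ℝ) ∈ Icc (0 : ℝ) 1 := ⟨le_rfl, zero_le_one⟩
  have h1 : (1 : ℝ) ∈ Icc (0 : ℝ) 1 := ⟨zero_le_one, le_rfl⟩
  have hq0 : 0 ≤ c * ‖b‖ := by positivity
  have hder : ∀ s ∈ Icc (0 : ℝ) 1, ∀ r, ‖iteratedFDeriv ℝ r Ψ (a + s • b) fun _ => b‖
      ≤ r.factorial * (k * (c * ‖b‖) ^ r) := fun s hs r => by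
    refine (ContinuousMultilinearMap.le_opNorm _ _).trans ?_
    rw [Finset.prod_const, Finset.card_univ, Fintype.card_fin]
    calc _ ≤ (r.factorial * k * c ^ r) * ‖b‖ ^ r := by gcongr; exact hb s hs r
      _ = _ := by rw [mul_pow]; ring
  have hk : 0 ≤ k := by simpa using (norm_nonneg _).trans (hb 0 h0 0)
  have hzero : ∀ r : ℕ, ‖(r.factorial : ℝ)⁻¹ • iteratedFDeriv ℝ r Ψ a fun _ => b‖
      ≤ k * (c * ‖b‖) ^ r := fun r => by
    have := hder 0 h0 r
    rw [zero_smul, add_zero] at this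
    rw [norm_smul, norm_inv, Real.norm_natCast, inv_mul_le_iff₀ (by positivity)]
    exact this
  have hgeo : Summable fun r : ℕ => k * (c * ‖b‖) ^ r :=
    (summable_geometric_of_lt_one hq0 hcb).mul_left k
  suffices H : Tendsto (fun n : ℕ => ∑ r ∈ Finset.range n,
      (r.factorial : ℝ)⁻¹ • iteratedFDeriv ℝ r Ψ a fun _ => b) atTop (𝓝 (Ψ (a + b))) from
    (Summable.of_norm_bounded hgeo hzero).hasSum_iff_tendsto_nat.2 H
  rw [← tendsto_add_atTop_iff_nat 1, tendsto_iff_norm_sub_tendsto_zero]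
  have hlim : Tendsto (fun n : ℕ => k * (((n + 1 : ℕ) : ℝ) * (c * ‖b‖) ^ (n + 1))) atTop (𝓝 0) := by
    have := (tendsto_self_mul_const_pow_of_lt_one hq0 hcb).comp (tendsto_add_atTop_nat 1)
    simpa using this.const_mul k
  refine squeeze_zero (fun _ => norm_nonneg _) (fun n => ?_) hlim
  have hcd : ContDiffOn ℝ (n + 1) (fun s : ℝ => Ψ (a + s • b)) (Icc 0 1) := fun s hs => by
    have hl : ContDiffAt ℝ (n + 1) (fun s : ℝ => a + s • b) s := by fun_prop
    exact ((hΨ s hs).contDiffAt.comp s hl).contDiffWithinAt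
  -- The remainder of order `n + 1` is at most `k (n + 1) (c ‖b‖)^(n + 1)`, which tends to `0`.
  have key := taylor_mean_remainder_bound zero_le_one hcd h1
    (C := (n + 1).factorial * (k * (c * ‖b‖) ^ (n + 1))) fun s hs => by
      rw [iteratedDerivWithin_comp_line hΨ _ hs]; exact hder s hs (n + 1)
  rw [taylor_within_apply, norm_sub_rev] at key
  have hsum : ∑ i ∈ Finset.range (n + 1), ((i.factorial : ℝ)⁻¹ * (1 - 0) ^ i) •
      iteratedDerivWithin i (fun s : ℝ => Ψ (a + s • b)) (Icc 0 1) 0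
      = ∑ r ∈ Finset.range (n + 1), (r.factorial : ℝ)⁻¹ • iteratedFDeriv ℝ r Ψ a fun _ => b := by
    refine Finset.sum_congr rfl fun i _ => ?_
    rw [iteratedDerivWithin_comp_line hΨ i h0]
    simp
  rw [hsum, one_smul] at key
  refine key.trans (le_of_eq ?_)
  rw [Nat.factorial_succ]
  have : (n.factorial : ℝ) ≠ 0 := by positivity
  push_cast
  field_simp
  ring

end Taylor

/-! ### Iterated directional derivatives -/

section Directions

variable {E G : Type*} [NormedAddCommGroup E] [NormedSpace ℝ E]
  [NormedAddCommGroup G] [NormedSpace ℝ G] {ι : Type*}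

/-- The iterated directional derivative of `g` at `a` along the directions `h k`, `k ∈ l`. -/
def dirDeriv (g : E → G) (h : ι → E) (l : List ι) (a : E) : G :=
  iteratedFDeriv ℝ l.length g a fun j => h (l.get j)

/-- Symmetry of higher derivatives, for a permutation given as an injective map between index sets
of equal, but not definitionally equal, size. -/
theorem iteratedFDeriv_comp_injective [CompleteSpace G] {g : E → G} {a : E}
    (hg : AnalyticAt ℝ g a) {n m : ℕ} (hnm : n = m) {e : Fin n → Fin m} (he : Function.Injective e)
    (v : Fin m → E) :
    iteratedFDeriv ℝ n g a (v ∘ e) = iteratedFDeriv ℝ m g a v := by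
  subst hnm
  exact hg.contDiffAt.iteratedFDeriv_comp_perm v
    (Equiv.ofBijective e (Finite.injective_iff_bijective.1 he))

/-- Iterated directional derivatives do not depend on the order of the directions. -/
theorem dirDeriv_perm [CompleteSpace G] {g : E → G} {a : E} (hg : AnalyticAt ℝ g a)
    (h : ι → E) {l l' : List ι} (hl : l.Perm l') : dirDeriv g h l a = dirDeriv g h l' a := by
  classical
  have hinj : Function.Injective (hl.subperm.idxInj) := hl.subperm.idxInj_injective
  unfold dirDeriv
  rw [← iteratedFDeriv_comp_injective hg hl.length_eq hinj]
  congr 1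
  funext j
  exact congrArg h (List.Subperm.getElem_idxInj_eq_getElem hl.subperm).symm

theorem dirDeriv_cons (g : E → G) (h : ι → E) (i : ι) (l : List ι) (a : E) :
    dirDeriv g h (i :: l) a
      = fderiv ℝ (iteratedFDeriv ℝ l.length g) a (h i) fun j => h (l.get j) := rfl

end Directions

/-! ### Analytic functions composed with functions of finite smoothness -/

section Superposition

variable {d : ℕ} {D : Set (Rd d)} {E G : Type} [NormedAddCommGroup E] [NormedSpace ℝ E]
  [NormedAddCommGroup G] [NormedSpace ℝ G]

/-- `g` is analytic at the points of `K`, with `‖D^n g‖ ≤ n! k c^n` there. -/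
def CauchyBound (K : Set E) (g : E → G) (k c : ℝ≥0) : Prop :=
  ∀ a ∈ K, AnalyticAt ℝ g a ∧ ∀ n : ℕ, ‖iteratedFDeriv ℝ n g a‖ ≤ n.factorial * k * c ^ n

theorem CauchyBound.iteratedFDeriv [CompleteSpace G] {K : Set E} {g : E → G} {k c : ℝ≥0}
    (hg : CauchyBound K g k c) (n : ℕ) :
    CauchyBound K (iteratedFDeriv ℝ n g) (n.factorial * k * (2 * c) ^ n) (2 * c) := fun a ha =>
  ⟨AnalyticOnNhd.iteratedFDeriv (s := {a}) (fun x hx => by rw [hx]; exact (hg a ha).1) n a rfl,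
    fun r => by
      have := norm_iteratedFDeriv_iteratedFDeriv_le k.2 c.2 (hg a ha).2 n r
      push_cast
      exact this⟩

/-- The derivatives of an analytic function along a function `a`, evaluated at functions `h j`. -/
theorem exists_majorant_iteratedFDeriv [FiniteDimensional ℝ E] [CompleteSpace G] (hD : IsOpen D)
    {τ : ℕ} {K : Set E} {g : E → G} {k c : ℝ≥0} (hg : CauchyBound K g k c) {a : Rd d → E}
    {p : PowerSeries ℝ≥0} (ha : HasMajorant D τ p a) {P : ℝ≥0} (hp : truncSum τ p ≤ P)
    (hK : ∀ᵐ x ∂volume.restrict D, a x ∈ K) (hK' : τ ≠ 0 → ∀ x ∈ D, a x ∈ K) {n : ℕ}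
    {h : Fin n → Rd d → E} {q : Fin n → PowerSeries ℝ≥0} {Q : Fin n → ℝ≥0}
    (hh : ∀ j, HasMajorant D τ (q j) (h j)) (hq : ∀ j, truncSum τ (q j) ≤ Q j) :
    ∃ s, HasMajorant D τ s (fun x => iteratedFDeriv ℝ n g (a x) fun j => h j x) ∧
      truncSum τ s ≤ n.factorial * k * (2 * c) ^ n
        * (∑ r ∈ Finset.range (τ + 1), (2 * c * P) ^ r) * ∏ j, Q j := by
  have hn := hg.iteratedFDeriv n
  have hcomp := ha.comp hD hK hK' (Φ := iteratedFDeriv ℝ n g) (fun a ha => (hn a ha).1)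
    (M := fun r => r.factorial * (n.factorial * k * (2 * c) ^ n) * (2 * c) ^ r)
    (fun r a ha => by
      have := (hn a ha).2 r
      rw [← NNReal.coe_le_coe]
      exact_mod_cast this)
  refine ⟨_, HasMajorant.multilinear hD hcomp hh, ?_⟩
  refine (truncSum_mul_le _ _ _).trans ?_
  refine mul_le_mul' ((truncSum_compSeries_le _ _ _).trans ?_)
    ((truncSum_prod_le _ _ _).trans (Finset.prod_le_prod' fun j _ => hq j))
  rw [Finset.mul_sum]
  refine Finset.sum_le_sum fun r _ => ?_
  have hr : (r.factorial : ℝ≥0) ≠ 0 := by exact_mod_cast r.factorial_ne_zero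
  calc _ ≤ r.factorial * (n.factorial * k * (2 * c) ^ n) * (2 * c) ^ r / r.factorial * P ^ r := by
        gcongr
    _ = (n.factorial * k * (2 * c) ^ n) * ((2 * c) ^ r * P ^ r) := by field_simp
    _ = _ := by rw [← mul_pow]

/-- The remainder of Taylor's expansion of a derivative of an analytic function along functions, in
the norm of `W^{τ,∞}(D)`. -/
theorem sobolevNorm_taylor_remainder_le [FiniteDimensional ℝ E] [CompleteSpace G] (hD : IsOpen D)
    {τ : ℕ} {K : Set E} {g : E → G} {k c : ℝ≥0} (hg : CauchyBound K g k c) {a b : Rd d → E}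
    {p pb : PowerSeries ℝ≥0} (ha : HasMajorant D τ p a) {P B : ℝ≥0} (hp : truncSum τ p ≤ P)
    (hb : HasMajorant D τ pb b) (hpb : truncSum τ pb ≤ B) (hB : 4 * c * B ≤ 1 / 2)
    (hK : ∀ᵐ x ∂volume.restrict D, ∀ s ∈ Icc (0 : ℝ) 1, a x + s • b x ∈ K)
    (hK' : τ ≠ 0 → ∀ x ∈ D, a x ∈ K) {n : ℕ}
    {h : Fin n → Rd d → E} {q : Fin n → PowerSeries ℝ≥0} {Q : Fin n → ℝ≥0}
    (hh : ∀ j, HasMajorant D τ (q j) (h j)) (hq : ∀ j, truncSum τ (q j) ≤ Q j) (κ : ℝ) (m : ℕ) :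
    sobolevNorm D τ ∞ (fun x => κ • (iteratedFDeriv ℝ n g (a x + b x) (fun j => h j x) -
      ∑ r ∈ Finset.range m, (r.factorial : ℝ)⁻¹ •
        iteratedFDeriv ℝ r (iteratedFDeriv ℝ n g) (a x) (fun _ => b x) (fun j => h j x)))
      ≤ ↑(2 * (‖κ‖₊ * (n.factorial * k * (2 * c) ^ n
        * (∑ r ∈ Finset.range (τ + 1), (4 * c * P) ^ r) * ∏ j, Q j) * (4 * c * B) ^ m)) := by
  set C : ℝ≥0 := n.factorial * k * (2 * c) ^ n
        * (∑ r ∈ Finset.range (τ + 1), (4 * c * P) ^ r) * ∏ j, Q j with hC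
  have hn := hg.iteratedFDeriv n
  have hK0 : ∀ᵐ x ∂volume.restrict D, a x ∈ K := hK.mono fun x hx => by
    simpa using hx 0 ⟨le_rfl, zero_le_one⟩
  set T : ℕ → Rd d → G := fun r x => (r.factorial : ℝ)⁻¹ •
        iteratedFDeriv ℝ r (iteratedFDeriv ℝ n g) (a x) (fun _ => b x) (fun j => h j x) with hT
  -- The rate `c` of `g` is doubled twice, in passing to `D^n g` and to `D^r D^n g`.
  have hterm : ∀ r, sobolevNorm D τ ∞ (fun x => κ • T r x) ≤ ↑(‖κ‖₊ * C * (4 * c * B) ^ r) := by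
    intro r
    obtain ⟨s, hs, hsB⟩ := exists_majorant_iteratedFDeriv hD hn ha hp hK0 hK' (n := r)
      (h := fun _ => b) (q := fun _ => pb) (Q := fun _ => B) (fun _ => hb) (fun _ => hpb)
    have h2 := HasMajorant.multilinear hD hs hh
    have h3 := (h2.const_smul (r.factorial : ℝ)⁻¹).const_smul κ
    refine (h3.sobolevNorm_le hD).trans ?_
    rw [ENNReal.coe_le_coe]
    rw [← PowerSeries.smul_eq_C_mul, ← PowerSeries.smul_eq_C_mul, truncSum_smul, truncSum_smul]
    have hr : (r.factorial : ℝ≥0) ≠ 0 := by exact_mod_cast r.factorial_ne_zero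
    have hnr : ‖(r.factorial : ℝ)⁻¹‖₊ = (r.factorial : ℝ≥0)⁻¹ := by simp
    rw [hnr, mul_assoc]
    refine mul_le_mul' le_rfl ?_
    calc (r.factorial : ℝ≥0)⁻¹ * truncSum τ (s * ∏ j, q j)
        ≤ (r.factorial : ℝ≥0)⁻¹ * ((r.factorial * (n.factorial * k * (2 * c) ^ n) *
            (2 * (2 * c)) ^ r * (∑ r ∈ Finset.range (τ + 1), (2 * (2 * c) * P) ^ r) *
            ∏ _j : Fin r, B) * ∏ j, Q j) := by
          gcongr
          refine (truncSum_mul_le _ _ _).trans (mul_le_mul' hsB ?_)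
          exact (truncSum_prod_le _ _ _).trans (Finset.prod_le_prod' fun j _ => hq j)
      _ = _ := by
          rw [Finset.prod_const, Finset.card_univ, Fintype.card_fin, hC, ← mul_assoc 2 2 c,
            show (2 * 2 : ℝ≥0) = 4 by norm_num, mul_pow (4 * c) B]
          field_simp
  -- Pointwise, the remainder is the sum of the terms of order at least `m`.
  have hsum : ∀ᵐ x ∂volume.restrict D, HasSum (fun r => κ • T (r + m) x)
      (κ • (iteratedFDeriv ℝ n g (a x + b x) (fun j => h j x) - ∑ r ∈ Finset.range m, T r x)) := by
    filter_upwards [hK, hb.ae_bound] with x hx hbx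
    refine HasSum.const_smul κ ?_
    rw [hasSum_nat_add_iff' (f := fun r => T r x)]
    have hbB : ‖b x‖₊ ≤ B := hbx.trans
      (le_trans (Finset.single_le_sum (f := fun j => pb.coeff j) (fun _ _ => zero_le)
        (Finset.mem_range.2 (Nat.succ_pos τ))) hpb)
    have hsmall : ((2 * c : ℝ≥0) : ℝ) * ‖b x‖ < 1 := by
      have h1 : 2 * c * ‖b x‖₊ ≤ 1 / 4 := by
        calc 2 * c * ‖b x‖₊ ≤ 2 * c * B := by gcongr
          _ = (4 * c * B) / 2 := by
            rw [eq_div_iff (by norm_num)]; ring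
          _ ≤ (1 / 2) / 2 := by gcongr
          _ = 1 / 4 := by norm_num [div_div]
      have h2 : ((2 * c * ‖b x‖₊ : ℝ≥0) : ℝ) ≤ ((1 / 4 : ℝ≥0) : ℝ) := NNReal.coe_le_coe.2 h1
      push_cast at h2 ⊢
      linarith
    have hTay := hasSum_taylor (Ψ := iteratedFDeriv ℝ n g) (a := a x) (b := b x) (2 * c).2
      (fun s hs => (hn _ (hx s hs)).1) (fun s hs r => (hn _ (hx s hs)).2 r) hsmall
    exact hTay.mapL (ContinuousMultilinearMap.apply ℝ (fun _ : Fin n => E) G fun j => h j x)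
  -- As `4 c B ≤ 1/2`, the geometric series from the order `m` on is at most twice its first term.
  refine (sobolevNorm_le_tsum hD τ hsum).trans
    ((ENNReal.tsum_le_tsum fun r => hterm (r + m)).trans ?_)
  set Q' := 4 * c * B
  have : ∀ r, ((‖κ‖₊ * C * Q' ^ (r + m) : ℝ≥0) : ℝ≥0∞) =
      ((‖κ‖₊ * C * Q' ^ m : ℝ≥0) : ℝ≥0∞) * (Q' : ℝ≥0∞) ^ r := fun r => by
    push_cast; rw [pow_add]; ring
  simp_rw [this]
  rw [ENNReal.tsum_mul_left, ENNReal.tsum_geometric, ENNReal.coe_mul 2, mul_comm]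
  gcongr
  rw [ENNReal.inv_le_iff_inv_le]
  refine ENNReal.le_sub_of_add_le_left ENNReal.coe_ne_top ?_
  calc (Q' : ℝ≥0∞) + ((2 : ℝ≥0) : ℝ≥0∞)⁻¹ ≤ 2⁻¹ + 2⁻¹ := by
        gcongr
        · have : (Q' : ℝ≥0∞) ≤ ((1 / 2 : ℝ≥0) : ℝ≥0∞) := ENNReal.coe_le_coe.2 hB
          simpa using this
        · simp
    _ = 1 := ENNReal.inv_two_add_inv_two

end Superposition

/-! ### Rounding of parameters -/

section Rounding

theorem ae_mem_box : ∀ᵐ y ∂law, y ∈ box := by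
  have h : ∀ k : ℕ+, ∀ᵐ y ∂law, y k ∈ Icc (-1 : ℝ) 1 := fun k => by
    have h1 : ∀ᵐ t ∂uniformLaw, t ∈ Icc (-1 : ℝ) 1 :=
      ProbabilityTheory.ae_cond_mem measurableSet_Icc
    exact (measurePreserving_eval_infinitePi (fun _ : ℕ+ => uniformLaw) k).quasiMeasurePreserving.ae
      h1
  filter_upwards [ae_all_iff.2 h] with y hy
  exact fun k _ => hy k

/-- The `ℓ¹`-distance of two parameters with weights `w`. -/
def wdist (w : ℕ+ → ℝ≥0) (y y' : Param) : ℝ≥0 := ∑' k, ‖y' k - y k‖₊ * w k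

/-- The grid cell of `y` in the first `n` variables, for the mesh width `1/(n+1)`. -/
def cell (n : ℕ) (y : Param) : Fin n → ℤ := fun j => ⌊((n : ℝ) + 1) * y (j : ℕ).succPNat⌋

/-- A point of `□` with finitely many nonzero coordinates which represents a grid cell. It is
clamped to `□`, so that it is defined for every cell, whether the cell meets `□` or not. -/
def cellPoint (n : ℕ) (z : Fin n → ℤ) : Param := fun k =>
  if h : k.natPred < n then max (-1) (min 1 ((z ⟨k.natPred, h⟩ : ℝ) / (n + 1))) else 0

theorem cellPoint_mem_box (n : ℕ) (z : Fin n → ℤ) : cellPoint n z ∈ box := by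
  intro k _
  unfold cellPoint
  split_ifs
  · exact ⟨le_max_left _ _, max_le (by norm_num) (min_le_left _ _)⟩
  · constructor <;> norm_num

theorem measurable_cell (n : ℕ) : Measurable (cell n) :=
  measurable_pi_iff.2 fun _ => Int.measurable_floor.comp
    ((measurable_pi_apply _).const_mul _)

theorem abs_cellPoint_sub_le {y : Param} (hy : y ∈ box) {n : ℕ} {k : ℕ+} (hk : k.natPred < n) :
    |cellPoint n (cell n y) k - y k| ≤ 1 / ((n : ℝ) + 1) := by
  have hn : (0 : ℝ) < (n : ℝ) + 1 := by positivity
  have hyk := hy k (mem_univ k)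
  simp only [cellPoint, dif_pos hk, cell, PNat.succPNat_natPred]
  have h1 := Int.floor_le (((n : ℝ) + 1) * y k)
  have h2 := Int.lt_floor_add_one (((n : ℝ) + 1) * y k)
  set z : ℝ := (⌊((n : ℝ) + 1) * y k⌋ : ℝ)
  have h3 : z / (n + 1) ≤ y k := by rw [div_le_iff₀ hn]; linarith
  have h4 : y k - 1 / ((n : ℝ) + 1) ≤ z / (n + 1) := by
    rw [sub_le_iff_le_add, ← add_div, le_div_iff₀ hn]; linarith
  have hp : 0 < 1 / ((n : ℝ) + 1) := by positivity
  have h5 : min 1 (z / (n + 1)) = z / (n + 1) := min_eq_right (h3.trans hyk.2)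
  rw [h5, abs_le]
  constructor
  · have := le_max_right (-1) (z / ((n : ℝ) + 1)); linarith
  · have : max (-1) (z / ((n : ℝ) + 1)) ≤ y k := max_le hyk.1 h3
    linarith

theorem tendsto_wdist_cellPoint {w : ℕ+ → ℝ≥0} (hw : Summable w) {y : Param} (hy : y ∈ box) :
    Tendsto (fun n => wdist w y (cellPoint n (cell n y))) atTop (𝓝 0) := by
  rw [← NNReal.tendsto_coe]
  simp only [wdist, NNReal.coe_tsum, NNReal.coe_mul, coe_nnnorm, Real.norm_eq_abs, NNReal.coe_zero]
  have hw' : Summable fun k => 2 * (w k : ℝ) := (NNReal.summable_coe.2 hw).mul_left 2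
  have := tendsto_tsum_of_dominated_convergence (𝓕 := atTop)
    (f := fun n k => |cellPoint n (cell n y) k - y k| * (w k : ℝ)) (g := fun _ => 0) hw'
    (fun k => ?_) (Eventually.of_forall fun n k => ?_)
  · simpa using this
  · have hlim : Tendsto (fun n : ℕ => 1 / ((n : ℝ) + 1) * (w k : ℝ)) atTop (𝓝 0) := by
      simpa using (tendsto_one_div_add_atTop_nhds_zero_nat (𝕜 := ℝ)).mul_const (w k : ℝ)
    refine squeeze_zero' (Eventually.of_forall fun n => by positivity) ?_ hlim
    filter_upwards [eventually_gt_atTop k.natPred] with n hn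
    gcongr
    exact abs_cellPoint_sub_le hy hn
  · rw [Real.norm_eq_abs, abs_of_nonneg (by positivity)]
    gcongr
    have h1 := cellPoint_mem_box n (cell n y) k (mem_univ k)
    have h2 := hy k (mem_univ k)
    rw [abs_le]
    constructor <;> linarith [h1.1, h1.2, h2.1, h2.2]

end Rounding

/-! ### Parametric derivatives along affine families -/

section Family

variable {d : ℕ} {D : Set (Rd d)} {E G : Type} [NormedAddCommGroup E] [NormedSpace ℝ E]
  [NormedAddCommGroup G] [NormedSpace ℝ G]

/-- A family `A y = A 0 + ∑ y_k e_k` of functions on `D` with values in `K`, affine in the parameter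
`y ∈ □`, which is bounded by `P` in the norm of the majorants, and whose coefficients `e_k` are
bounded by a summable sequence `w_k`. The values may lie outside of `K` on a null set if `τ = 0`. -/
structure AffineFamily (D : Set (Rd d)) (τ : ℕ) (K : Set E) (A : Param → Rd d → E)
    (e : ℕ+ → Rd d → E) (w : ℕ+ → ℝ≥0) (P : ℝ≥0) : Prop where
  summable : Summable w
  base : ∀ y ∈ box, ∃ p, HasMajorant D τ p (A y) ∧ truncSum τ p ≤ P
  dir : ∀ k, ∃ p, HasMajorant D τ p (e k) ∧ truncSum τ p ≤ w k
  incr : ∀ y ∈ box, ∀ y' ∈ box,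
    ∃ p, HasMajorant D τ p (fun x => A y' x - A y x) ∧ truncSum τ p ≤ wdist w y y'
  affine : ∀ y ∈ box, ∀ i t, y + Pi.single i t ∈ box →
    ∀ᵐ x ∂volume.restrict D, A (y + Pi.single i t) x = A y x + t • e i x
  segment : ∀ y ∈ box, ∀ y' ∈ box, ∀ᵐ x ∂volume.restrict D, ∀ s ∈ Icc (0 : ℝ) 1,
    A y x + s • (A y' x - A y x) ∈ K
  mem : τ ≠ 0 → ∀ y ∈ box, ∀ x ∈ D, A y x ∈ K

/-- The parametric derivative `∂_y^α` of `g ∘ A` for an affine family `A` with coefficients `e`. -/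
def paramDeriv (g : E → G) (A : Param → Rd d → E) (e : ℕ+ → Rd d → E) (α : ℕ+ →₀ ℕ) (y : Param)
    (x : Rd d) : G :=
  dirDeriv g (fun k => e k x) (Finsupp.toMultiset α).toList (A y x)

theorem paramDeriv_zero (g : E → G) (A : Param → Rd d → E) (e : ℕ+ → Rd d → E) (y : Param) :
    paramDeriv g A e 0 y = fun x => g (A y x) := by
  funext x
  simp only [paramDeriv, map_zero, Multiset.toList_zero]
  rfl

theorem length_toList_toMultiset (α : ℕ+ →₀ ℕ) :
    (Finsupp.toMultiset α).toList.length = α.degree := by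
  rw [Multiset.length_toList, Finsupp.card_toMultiset]
  rfl

theorem prod_toList_toMultiset (w : ℕ+ → ℝ≥0) (α : ℕ+ →₀ ℕ) :
    ∏ j : Fin (Finsupp.toMultiset α).toList.length, w ((Finsupp.toMultiset α).toList.get j)
      = α.prod fun k a => w k ^ a := by
  have h1 := Fin.prod_univ_fun_getElem (Finsupp.toMultiset α).toList w
  refine h1.trans ?_
  rw [← Multiset.prod_coe, ← Multiset.map_coe, Multiset.coe_toList, Finsupp.toMultiset_map,
    Finsupp.prod_toMultiset, Finsupp.prod_mapDomain_index (by simp) (by simp [pow_add])]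

variable {τ : ℕ} {K : Set E} {A : Param → Rd d → E} {e : ℕ+ → Rd d → E} {w : ℕ+ → ℝ≥0}
  {P : ℝ≥0}

theorem AffineFamily.ae_mem (hA : AffineFamily D τ K A e w P) {y : Param} (hy : y ∈ box) :
    ∀ᵐ x ∂volume.restrict D, A y x ∈ K :=
  (hA.segment y hy y hy).mono fun x hx => by simpa using hx 0 ⟨le_rfl, zero_le_one⟩

variable [FiniteDimensional ℝ E] [CompleteSpace G] {g : E → G} {k c : ℝ≥0}

/-- The bound for the parametric derivatives in `W^{τ,∞}(D)`. -/
theorem AffineFamily.sobolevNorm_paramDeriv_le (hD : IsOpen D)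
    (hA : AffineFamily D τ K A e w P) (hg : CauchyBound K g k c) (α : ℕ+ →₀ ℕ) {y : Param}
    (hy : y ∈ box) :
    sobolevNorm D τ ∞ (paramDeriv g A e α y) ≤ ↑(α.degree.factorial * k * (2 * c) ^ α.degree *
      (∑ r ∈ Finset.range (τ + 1), (2 * c * P) ^ r) * α.prod fun k a => w k ^ a) := by
  obtain ⟨p, hp, hpP⟩ := hA.base y hy
  choose q hq hqw using hA.dir
  obtain ⟨s, hs, hsb⟩ := exists_majorant_iteratedFDeriv hD hg hp hpP (hA.ae_mem hy)
    (fun h => hA.mem h y hy) (n := (Finsupp.toMultiset α).toList.length)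
    (fun j => hq ((Finsupp.toMultiset α).toList.get j))
    (fun j => hqw ((Finsupp.toMultiset α).toList.get j))
  refine (hs.sobolevNorm_le hD).trans (ENNReal.coe_le_coe.2 (hsb.trans (le_of_eq ?_)))
  rw [prod_toList_toMultiset, length_toList_toMultiset]

/-- The parametric derivatives are Lipschitz continuous in the parameter. -/
theorem AffineFamily.exists_sobolevNorm_sub_le (hD : IsOpen D)
    (hA : AffineFamily D τ K A e w P) (hg : CauchyBound K g k c) (α : ℕ+ →₀ ℕ) :
    ∃ C : ℝ≥0, ∀ y ∈ box, ∀ y' ∈ box, 4 * c * wdist w y y' ≤ 1 / 2 →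
      sobolevNorm D τ ∞ (fun x => paramDeriv g A e α y' x - paramDeriv g A e α y x)
        ≤ ↑(C * wdist w y y') := by
  choose q hq hqw using hA.dir
  refine ⟨2 * (‖(1 : ℝ)‖₊ * ((Finsupp.toMultiset α).toList.length.factorial * k *
    (2 * c) ^ (Finsupp.toMultiset α).toList.length *
    (∑ r ∈ Finset.range (τ + 1), (4 * c * P) ^ r) *
    ∏ j, w ((Finsupp.toMultiset α).toList.get j))) * (4 * c), fun y hy y' hy' hsmall => ?_⟩
  obtain ⟨p, hp, hpP⟩ := hA.base y hy
  obtain ⟨pb, hpb, hpbB⟩ := hA.incr y hy y' hy'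
  have h := sobolevNorm_taylor_remainder_le hD hg hp hpP hpb hpbB hsmall (hA.segment y hy y' hy')
    (fun h => hA.mem h y hy) (n := (Finsupp.toMultiset α).toList.length)
    (fun j => hq ((Finsupp.toMultiset α).toList.get j))
    -- Taylor's expansion of order one, that is, without a linear term.
    (fun j => hqw ((Finsupp.toMultiset α).toList.get j)) 1 1
  have e1 : ∀ x, (1 : ℝ) • (iteratedFDeriv ℝ (Finsupp.toMultiset α).toList.length g
      (A y x + (A y' x - A y x)) (fun j => e ((Finsupp.toMultiset α).toList.get j) x) -
      ∑ r ∈ Finset.range 1, (r.factorial : ℝ)⁻¹ • iteratedFDeriv ℝ r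
        (iteratedFDeriv ℝ (Finsupp.toMultiset α).toList.length g) (A y x)
        (fun _ => A y' x - A y x) (fun j => e ((Finsupp.toMultiset α).toList.get j) x))
      = paramDeriv g A e α y' x - paramDeriv g A e α y x := fun x => by
    simp [paramDeriv, dirDeriv]
  simp only [e1] at h
  refine h.trans (le_of_eq ?_)
  congr 1
  ring

theorem toList_toMultiset_add_single_perm (α : ℕ+ →₀ ℕ) (i : ℕ+) :
    (Finsupp.toMultiset (α + Finsupp.single i 1)).toList.Perm
      (i :: (Finsupp.toMultiset α).toList) := by
  rw [← Multiset.coe_eq_coe, Multiset.coe_toList, ← Multiset.cons_coe, Multiset.coe_toList,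
    map_add, Finsupp.toMultiset_single, one_smul, add_comm, Multiset.singleton_add]

/-- The difference quotients converge with a linear rate. -/
theorem AffineFamily.exists_sobolevNorm_quotient_le (hD : IsOpen D)
    (hA : AffineFamily D τ K A e w P) (hg : CauchyBound K g k c) (α : ℕ+ →₀ ℕ) (i : ℕ+)
    {y : Param} (hy : y ∈ box) :
    ∃ C : ℝ≥0, ∀ t : ℝ, t ≠ 0 → y + Pi.single i t ∈ box → 4 * c * (‖t‖₊ * w i) ≤ 1 / 2 →
      sobolevNorm D τ ∞ (fun x => t⁻¹ • (paramDeriv g A e α (y + Pi.single i t) x -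
        paramDeriv g A e α y x) - paramDeriv g A e (α + Finsupp.single i 1) y x)
        ≤ ↑(C * ‖t‖₊) := by
  choose q hq hqw using hA.dir
  obtain ⟨p, hp, hpP⟩ := hA.base y hy
  set l := (Finsupp.toMultiset α).toList with hl
  set C0 : ℝ≥0 := l.length.factorial * k * (2 * c) ^ l.length
        * (∑ r ∈ Finset.range (τ + 1), (4 * c * P) ^ r) * ∏ j, w (l.get j)
  refine ⟨2 * C0 * (4 * c * w i) ^ 2, fun t ht hyt hsmall => ?_⟩
  have hb := (hq i).const_smul t
  have hbB : truncSum τ (PowerSeries.C ‖t‖₊ * q i) ≤ ‖t‖₊ * w i := by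
    rw [← PowerSeries.smul_eq_C_mul, truncSum_smul]
    gcongr
    exact hqw i
  have hseg : ∀ᵐ x ∂volume.restrict D, ∀ s ∈ Icc (0 : ℝ) 1, A y x + s • t • e i x ∈ K := by
    filter_upwards [hA.segment y hy _ hyt, hA.affine y hy i t hyt] with x hx hxa
    rw [hxa, add_sub_cancel_left] at hx
    exact hx
  have h := sobolevNorm_taylor_remainder_le hD hg hp hpP hb hbB hsmall hseg
    (fun h => hA.mem h y hy) (n := l.length)
    -- Taylor's expansion of order two; the linear term is the derivative in the direction `e_i`.
    (fun j => hq (l.get j)) (fun j => hqw (l.get j)) t⁻¹ 2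
  have hae : (fun x => t⁻¹ • (paramDeriv g A e α (y + Pi.single i t) x -
        paramDeriv g A e α y x) - paramDeriv g A e (α + Finsupp.single i 1) y x)
      =ᵐ[volume.restrict D] fun x => t⁻¹ • (iteratedFDeriv ℝ l.length g (A y x + t • e i x)
        (fun j => e (l.get j) x) - ∑ r ∈ Finset.range 2, (r.factorial : ℝ)⁻¹ •
        iteratedFDeriv ℝ r (iteratedFDeriv ℝ l.length g) (A y x) (fun _ => t • e i x)
          (fun j => e (l.get j) x)) := by
    filter_upwards [hA.ae_mem hy, hA.affine y hy i t hyt] with x hx hxa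
    have h1 : paramDeriv g A e (α + Finsupp.single i 1) y x
        = fderiv ℝ (iteratedFDeriv ℝ l.length g) (A y x) (e i x) fun j => e (l.get j) x := by
      rw [← dirDeriv_cons g (fun k => e k x)]
      exact dirDeriv_perm (hg _ hx).1 _ (toList_toMultiset_add_single_perm α i)
    rw [h1]
    simp only [paramDeriv, dirDeriv, hxa]
    simp only [Finset.sum_range_succ, Finset.range_zero, Finset.sum_empty, zero_add,
      Nat.factorial_zero, Nat.factorial_one, Nat.cast_one, inv_one, one_smul,
      iteratedFDeriv_zero_apply, iteratedFDeriv_one_apply, map_smul,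
      smul_apply]
    rw [← sub_sub, smul_sub _ _ (t • _), smul_smul, inv_mul_cancel₀ ht, one_smul]
  rw [sobolevNorm_congr_ae τ ∞ hae]
  refine h.trans (le_of_eq ?_)
  change ((2 * (‖t⁻¹‖₊ * C0 * (4 * c * (‖t‖₊ * w i)) ^ 2) : ℝ≥0) : ℝ≥0∞) = _
  congr 1
  have ht' : ‖t‖₊ ≠ 0 := by simpa using ht
  rw [nnnorm_inv]
  field_simp

theorem AffineFamily.isParamDeriv (hD : IsOpen D)
    (hA : AffineFamily D τ K A e w P) (hg : CauchyBound K g k c) :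
    IsParamDeriv (sobolevNorm D τ ∞) (fun y x => g (A y x)) (paramDeriv g A e) where
  zero y _ := paramDeriv_zero g A e y
  step α i y hy := by
    obtain ⟨C, hC⟩ := hA.exists_sobolevNorm_quotient_le hD hg α i hy
    have hn : Tendsto (fun t : ℝ => ‖t‖₊) (𝓝[{t : ℝ | t ≠ 0 ∧ y + Pi.single i t ∈ box}] 0)
        (𝓝 0) := by
      have : Tendsto (fun t : ℝ => ‖t‖₊) (𝓝 0) (𝓝 0) := by
        simpa using (continuous_nnnorm (E := ℝ)).tendsto 0
      exact this.mono_left nhdsWithin_le_nhds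
    have h1 : Tendsto (fun t : ℝ => ((C * ‖t‖₊ : ℝ≥0) : ℝ≥0∞))
        (𝓝[{t : ℝ | t ≠ 0 ∧ y + Pi.single i t ∈ box}] 0) (𝓝 0) := by
      rw [← ENNReal.coe_zero, ENNReal.tendsto_coe]
      simpa using hn.const_mul C
    have h2 : ∀ᶠ t : ℝ in 𝓝[{t : ℝ | t ≠ 0 ∧ y + Pi.single i t ∈ box}] 0,
        4 * c * (‖t‖₊ * w i) ≤ 1 / 2 := by
      have : Tendsto (fun t : ℝ => 4 * c * (‖t‖₊ * w i))
          (𝓝[{t : ℝ | t ≠ 0 ∧ y + Pi.single i t ∈ box}] 0) (𝓝 0) := by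
        simpa using (hn.mul_const (w i)).const_mul (4 * c)
      exact this.eventually_le_const (by norm_num)
    refine tendsto_of_tendsto_of_tendsto_of_le_of_le' tendsto_const_nhds h1
      (Eventually.of_forall fun _ => zero_le) ?_
    filter_upwards [self_mem_nhdsWithin, h2] with t ht ht2
    exact hC t ht.1 ht.2 ht2

/-- The derivative at `y` is approximated by the derivatives at the representatives of the grid
cells of `y`, of which there are countably many. -/
theorem AffineFamily.stronglyMeas (hD : IsOpen D)
    (hA : AffineFamily D τ K A e w P) (hg : CauchyBound K g k c) (α : ℕ+ →₀ ℕ) :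
    StronglyMeas (sobolevNorm D τ ∞) (paramDeriv g A e α) := by
  obtain ⟨C, hC⟩ := hA.exists_sobolevNorm_sub_le hD hg α
  refine ⟨fun n y => paramDeriv g A e α (cellPoint n (cell n y)), fun n => ⟨?_, fun z => ?_,
    fun y => ?_⟩, ?_⟩
  · exact (countable_range fun z : Fin n → ℤ => paramDeriv g A e α (cellPoint n z)).mono
      (range_subset_iff.2 fun y => mem_range_self (cell n y))
  · exact (measurable_cell n
      ((to_countable {z' : Fin n → ℤ | paramDeriv g A e α (cellPoint n z') = z}).measurableSet)
      ).nullMeasurableSet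
  · exact (hA.sobolevNorm_paramDeriv_le hD hg α (cellPoint_mem_box n _)).trans_lt
      ENNReal.coe_lt_top
  · filter_upwards [ae_mem_box] with y hy
    have hw := tendsto_wdist_cellPoint hA.summable hy
    have h1 : Tendsto (fun n => ((C * wdist w y (cellPoint n (cell n y)) : ℝ≥0) : ℝ≥0∞))
        atTop (𝓝 0) := by
      rw [← ENNReal.coe_zero, ENNReal.tendsto_coe]
      simpa using hw.const_mul C
    have h2 : ∀ᶠ n in atTop, 4 * c * wdist w y (cellPoint n (cell n y)) ≤ 1 / 2 := by
      have := hw.const_mul (4 * c)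
      rw [mul_zero] at this
      exact this.eventually_le_const (by norm_num)
    refine tendsto_of_tendsto_of_tendsto_of_le_of_le' tendsto_const_nhds h1
      (Eventually.of_forall fun _ => zero_le) ?_
    filter_upwards [h2] with n hn
    exact hC y hy _ (cellPoint_mem_box n _) hn

end Family

/-! ### Comparison of norms -/

section Transfer

variable {d : ℕ} {F : Type*} {N N' : (Rd d → F) → ℝ≥0∞} {C : ℝ≥0∞}

theorem tendsto_zero_of_le_mul (hC : C ≠ ∞) (h : ∀ v, N' v ≤ C * N v) {ι : Type*} {l : Filter ι}
    {v : ι → Rd d → F} (hv : Tendsto (fun i => N (v i)) l (𝓝 0)) :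
    Tendsto (fun i => N' (v i)) l (𝓝 0) := by
  have h1 : Tendsto (fun i => C * N (v i)) l (𝓝 0) := by
    simpa using ENNReal.Tendsto.const_mul hv (Or.inr hC)
  exact tendsto_of_tendsto_of_tendsto_of_le_of_le tendsto_const_nhds h1 (fun _ => zero_le)
    fun i => h _

variable [NormedAddCommGroup F] {u : Param → Rd d → F}

theorem bochnerNorm_le {B : ℝ≥0∞} (hu : StronglyMeas N u) (hB : ∀ y ∈ box, N (u y) ≤ B) :
    bochnerNorm N u ≤ B := by
  rw [bochnerNorm, if_pos hu]
  exact essSup_le_of_ae_le B (ae_mem_box.mono hB)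

theorem StronglyMeas.of_le (hC : C ≠ ∞) (h : ∀ v, N' v ≤ C * N v) (hu : StronglyMeas N u) :
    StronglyMeas N' u := by
  obtain ⟨s, h1, h2⟩ := hu
  exact ⟨s, fun n => ⟨(h1 n).1, (h1 n).2.1, fun y =>
    (h _).trans_lt (ENNReal.mul_lt_top hC.lt_top ((h1 n).2.2 y))⟩,
    h2.mono fun y hy => tendsto_zero_of_le_mul hC h hy⟩

theorem IsParamDeriv.of_le [NormedSpace ℝ F] (hC : C ≠ ∞) (h : ∀ v, N' v ≤ C * N v)
    {U : (ℕ+ →₀ ℕ) → Param → Rd d → F} (hU : IsParamDeriv N u U) : IsParamDeriv N' u U :=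
  ⟨hU.zero, fun α i y hy => tendsto_zero_of_le_mul hC h (hU.step α i y hy)⟩

end Transfer

/-! ### The support of the law -/

section LawSupport

theorem uniformLaw_pos {u : Set ℝ} (hu : IsOpen u) {t : ℝ} (ht : t ∈ u) (h1 : t ∈ Icc (-1 : ℝ) 1) :
    0 < uniformLaw u := by
  rw [uniformLaw, ProbabilityTheory.cond_apply measurableSet_Icc]
  refine ENNReal.mul_pos (by simp) (ne_of_gt ?_)
  have hcl : t ∈ closure (Ioo (-1 : ℝ) 1) := by
    rw [closure_Ioo (by norm_num)]; exact h1
  have hne : (u ∩ Ioo (-1 : ℝ) 1).Nonempty := mem_closure_iff.1 hcl u hu ht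
  refine ((hu.inter isOpen_Ioo).measure_pos volume hne).trans_le (measure_mono ?_)
  exact fun s hs => ⟨Ioo_subset_Icc_self hs.2, hs.1⟩

/-- The law charges every open set which meets the cube. -/
theorem law_pos {U : Set Param} (hU : IsOpen U) {y : Param} (hyU : y ∈ U) (hy : y ∈ box) :
    0 < law U := by
  obtain ⟨I, u, hu, hIU⟩ := isOpen_pi_iff.1 hU y hyU
  refine lt_of_lt_of_le ?_ (measure_mono hIU)
  have hmeas : ∀ i ∈ I, MeasurableSet (u i) := fun i hi => (hu i hi).1.measurableSet
  rw [law, Measure.infinitePi_pi _ hmeas]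
  exact pos_iff_ne_zero.2 (Finset.prod_ne_zero_iff.2 fun i hi =>
    (uniformLaw_pos (hu i hi).1 (hu i hi).2 (hy i (mem_univ i))).ne')

/-- What holds for almost every parameter holds on a dense subset of the cube. -/
theorem mem_closure_of_ae {p : Param → Prop} (hp : ∀ᵐ y ∂law, p y) {y : Param} (hy : y ∈ box) :
    y ∈ closure {y | y ∈ box ∧ p y} := by
  rw [mem_closure_iff]
  intro U hU hyU
  by_contra hcon
  have hnull : law U = 0 := by
    refine measure_mono_null (t := {y | ¬ (y ∈ box ∧ p y)}) ?_ (ae_mem_box.and hp)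
    exact fun z hz hz' => hcon ⟨z, hz, hz'⟩
  exact (law_pos hU hyU hy).ne' hnull

end LawSupport

/-! ### The volume of the reference domain -/

section Volume

variable {d : ℕ}

/-- A map which expands distances at least by the factor `s` expands volumes at least by `s ^ d`:
this holds for the `d`-dimensional Hausdorff measure, a multiple of the volume. No measurability is
involved. -/
theorem volume_le_of_antilipschitz {D H : Set (Rd d)} {V : Rd d → Rd d} (hV : MapsTo V D H) {s : ℝ}
    (hs : 0 < s) (hVD : ∀ x ∈ D, ∀ x' ∈ D, s * ‖x - x'‖ ≤ ‖V x - V x'‖) :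
    volume D ≤ ENNReal.ofReal ((s ^ d)⁻¹) * volume H := by
  set μ : Measure (Rd d) := Measure.hausdorffMeasure (Module.finrank ℝ (Rd d)) with hμ
  have hvol : (volume : Measure (Rd d)) = Measure.addHaarScalarFactor volume μ • μ :=
    Measure.isAddLeftInvariant_eq_smul volume μ
  have hfin : Module.finrank ℝ (Rd d) = d := by simp
  have hanti : AntilipschitzWith (s⁻¹).toNNReal (D.domRestrict V) := by
    refine AntilipschitzWith.of_le_mul_dist fun x x' => ?_
    have := hVD x x.2 x' x'.2
    rw [Real.coe_toNNReal _ (by positivity), Subtype.dist_eq, dist_eq_norm, dist_eq_norm,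
      inv_mul_eq_div, le_div_iff₀ hs, mul_comm]
    exact this
  have hle := hanti.le_hausdorffMeasure_image (d := (Module.finrank ℝ (Rd d) : ℝ))
    (Nat.cast_nonneg _) univ
  have h1 : Measure.hausdorffMeasure (Module.finrank ℝ (Rd d)) (univ : Set D) = μ D := by
    have := (isometry_subtype_coe (s := D)).hausdorffMeasure_image
      (d := (Module.finrank ℝ (Rd d) : ℝ)) (Or.inl (Nat.cast_nonneg _)) univ
    rw [image_univ, Subtype.range_coe] at this
    exact this.symm
  rw [h1] at hle
  have h2 : D.domRestrict V '' univ ⊆ H := by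
    rintro _ ⟨x, _, rfl⟩; exact hV x.2
  have h3 : μ D ≤ ENNReal.ofReal ((s ^ d)⁻¹) * μ H := by
    refine hle.trans (mul_le_mul' (le_of_eq ?_) (measure_mono h2))
    rw [hfin, ENNReal.rpow_natCast, ← ENNReal.ofReal, ← ENNReal.ofReal_pow (by positivity),
      inv_pow]
  rw [hvol]
  simp only [Measure.smul_apply]
  rw [mul_smul_comm]
  gcongr

end Volume

/-! ### Symmetry of the derivatives of the diffusion matrix -/

section Selfadjoint

variable {E G H : Type*} [NormedAddCommGroup E] [NormedSpace ℝ E]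
  [NormedAddCommGroup G] [NormedSpace ℝ G] [NormedAddCommGroup H] [NormedSpace ℝ H]

/-- The iterated derivatives of a function with values in the kernel of `T` have values in the
kernel of `T`. This holds at every point, also where the derivatives have the default value `0`. -/
theorem map_iteratedFDeriv_eq_zero (T : G →L[ℝ] H) {g : E → G} (hT : ∀ a, T (g a) = 0) (n : ℕ)
    (a : E) (h : Fin n → E) : T (iteratedFDeriv ℝ n g a h) = 0 := by
  induction n generalizing a with
  | zero => simpa using hT a
  | succ n ih =>
    rw [iteratedFDeriv_succ_apply_left]
    by_cases hd : DifferentiableAt ℝ (iteratedFDeriv ℝ n g) a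
    · set Q : (E [×n]→L[ℝ] G) →L[ℝ] H :=
        T.comp (ContinuousMultilinearMap.apply ℝ (fun _ : Fin n => E) G (Fin.tail h)) with hQ
      have h1 := (Q.hasFDerivAt.comp a hd.hasFDerivAt).fderiv
      have h2 : Q ∘ iteratedFDeriv ℝ n g = fun _ => 0 := funext fun b => ih b _
      rw [h2, fderiv_fun_const] at h1
      exact (DFunLike.congr_fun h1 (h 0)).symm
    · rw [fderiv_zero_of_not_differentiableAt hd]
      simp

variable {d : ℕ}

theorem isSelfAdjoint_dirDeriv_diffusion {ι : Type*} (h : ι → E) (l : List ι)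
    (L : E →L[ℝ] Mat d) (a : E) :
    IsSelfAdjoint (dirDeriv (fun a => diffusion (L a)) h l a) := by
  have := map_iteratedFDeriv_eq_zero (adjointL d - ContinuousLinearMap.id ℝ (Mat d))
    (g := fun a => diffusion (L a)) (fun a => by
      have h := isSelfAdjoint_diffusion (L a)
      rw [sub_apply, sub_eq_zero]
      exact h) l.length a (fun j => h (l.get j))
  rw [sub_apply, sub_eq_zero] at this
  exact this

end Selfadjoint

/-! ### Jets -/

section Jet

variable {d : ℕ} {D : Set (Rd d)} {F : Type*} [NormedAddCommGroup F] [NormedSpace ℝ F]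

/-- The first-order jet of `v`. -/
def jet (v : Rd d → F) (x : Rd d) : F × (Rd d →L[ℝ] F) := (v x, fderiv ℝ v x)

theorem jet_add_smul {u v w : Rd d → F} {x : Rd d} {s : ℝ} (hu : u =ᶠ[𝓝 x] fun z => v z + s • w z)
    (hv : DifferentiableAt ℝ v x) (hw : DifferentiableAt ℝ w x) :
    DifferentiableAt ℝ u x ∧ jet u x = jet v x + s • jet w x := by
  have h := hv.hasFDerivAt.add (hw.hasFDerivAt.const_smul s)
  have h' : HasFDerivAt u (fderiv ℝ v x + s • fderiv ℝ w x) x := h.congr_of_eventuallyEq hu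
  refine ⟨h'.differentiableAt, ?_⟩
  rw [jet, h'.fderiv, hu.eq_of_nhds]
  rfl

/-- The factor `1` accounts for the function, the factor `(τ + 1) d` for its differential. -/
theorem exists_majorant_jet [FiniteDimensional ℝ F] (hd : 0 < d) (hD : IsOpen D)
    {v : Rd d → F} {τ : ℕ} (hv : ContDiffOn ℝ τ v D) {M : ℝ≥0} (hM : c1Norm D τ v ≤ M) :
    ∃ p, HasMajorant D τ p (jet v) ∧ truncSum τ p ≤ (1 + (τ + 1) * d) * M := by
  obtain ⟨⟨p, hp, hpM, -⟩, q, hq, hqM⟩ := exists_majorant_of_c1Norm_le hd hD hv hM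
  refine ⟨p + q, (hp.pred hD).prodMk hq, ?_⟩
  rw [truncSum_add, add_mul, one_mul]
  gcongr

theorem ae_differentiableAt_of_c1Norm [FiniteDimensional ℝ F] (hd : 0 < d) (hD : IsOpen D)
    {v : Rd d → F} {τ : ℕ} (hv : ContDiffOn ℝ τ v D) {M : ℝ≥0} (hM : c1Norm D τ v ≤ M) :
    ∀ᵐ x ∂volume.restrict D, DifferentiableAt ℝ v x := by
  obtain ⟨⟨p, hp, -⟩, -⟩ := exists_majorant_of_c1Norm_le hd hD hv hM
  obtain ⟨-, -, w, q, -, -, h⟩ := hp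
  exact h.mono fun x hx => hx.1

theorem differentiableAt_of_contDiffOn (hD : IsOpen D) {v : Rd d → F} {τ : ℕ}
    (hv : ContDiffOn ℝ τ v D) (hτ : τ ≠ 0) {x : Rd d} (hx : x ∈ D) : DifferentiableAt ℝ v x :=
  (hv.contDiffAt (hD.mem_nhds hx)).differentiableAt (by exact_mod_cast hτ)

/-- Jets of sums agree with sums of jets everywhere on `D` if `τ ≠ 0`, and almost everywhere if `τ =
0`; in both cases majorants carry over. -/
theorem HasMajorant.congr_of_eqOn (hD : IsOpen D) {τ : ℕ} {p : PowerSeries ℝ≥0} {u v : Rd d → F}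
    (hu : HasMajorant D τ p u) (hae : u =ᵐ[volume.restrict D] v) (h : τ ≠ 0 → EqOn u v D) :
    HasMajorant D τ p v := by
  rcases Nat.eq_zero_or_pos τ with rfl | hτ
  · exact hu.congr_ae hae
  · exact hu.congr hD (h hτ.ne')

/-- At its points of differentiability, the derivative of a bi-Lipschitz map inherits the Lipschitz
constants. -/
theorem fderiv_mem_matSet (hD : IsOpen D) {V : Rd d → Rd d} {σlow σup : ℝ}
    (hV : ∀ x ∈ D, ∀ x' ∈ D, σlow * ‖x - x'‖ ≤ ‖V x - V x'‖ ∧ ‖V x - V x'‖ ≤ σup * ‖x - x'‖)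
    {x : Rd d} (hx : x ∈ D) (hdiff : DifferentiableAt ℝ V x) :
    fderiv ℝ V x ∈ matSet d σlow σup := by
  intro ξ
  have hl : HasDerivAt (fun t : ℝ => V (x + t • ξ)) (fderiv ℝ V x ξ) 0 :=
    hdiff.hasFDerivAt.hasLineDerivAt ξ
  have hs := hl.tendsto_slope_zero.norm
  have hev : ∀ᶠ t : ℝ in 𝓝[≠] 0, σlow * ‖ξ‖ ≤ ‖t⁻¹ • (V (x + (0 + t) • ξ) - V (x + (0 : ℝ) • ξ))‖ ∧
      ‖t⁻¹ • (V (x + (0 + t) • ξ) - V (x + (0 : ℝ) • ξ))‖ ≤ σup * ‖ξ‖ := by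
    have hmem : ∀ᶠ t : ℝ in 𝓝 0, x + t • ξ ∈ D := by
      have hc : ContinuousAt (fun t : ℝ => x + t • ξ) 0 := by fun_prop
      exact hc.eventually_mem (by simpa using hD.mem_nhds hx)
    filter_upwards [hmem.filter_mono nhdsWithin_le_nhds, self_mem_nhdsWithin] with t ht ht0
    have ht1 : 0 < |t| := abs_pos.2 ht0
    have h := hV _ ht _ hx
    rw [add_sub_cancel_left, norm_smul, Real.norm_eq_abs] at h
    rw [zero_add, zero_smul, add_zero, norm_smul, norm_inv, Real.norm_eq_abs, inv_mul_eq_div,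
      le_div_iff₀ ht1, div_le_iff₀ ht1]
    constructor <;> nlinarith [h.1, h.2]
  exact ⟨ge_of_tendsto hs (hev.mono fun _ h => h.1), le_of_tendsto hs (hev.mono fun _ h => h.2)⟩

end Jet

/-! ### The expansion of the domain mapping -/

section Expansion

variable {d : ℕ} {D : Set (Rd d)}

/-- The coefficients of the expansion of the domain mapping, indexed from `0`. -/
def coef (y : Param) : ℕ → ℝ
  | 0 => 1
  | k + 1 => y k.succPNat

theorem coef_pnat (y : Param) (k : ℕ+) : coef y k = y k := by
  obtain ⟨n, hn⟩ : ∃ n, (k : ℕ) = n + 1 := ⟨k.natPred, by simp⟩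
  have hk : k = n.succPNat := PNat.eq hn
  rw [hn, coef, hk]

/-- The function `∑ ζ_k φ_k`. -/
def expansion (φ : ℕ → Rd d → Rd d) (ζ : ℕ → ℝ) (x : Rd d) : Rd d := ∑' k, ζ k • φ k x

variable {τ : ℕ} {φ : ℕ → Rd d → Rd d} {Γ : ℕ → ℝ≥0}

theorem summable_expansion (hΓ : ∀ k, c1Norm D τ (φ k) ≤ Γ k) (hs : Summable Γ) {ζ : ℕ → ℝ} {B : ℝ}
    (hζ : ∀ k, ‖ζ k‖ ≤ B) {x : Rd d} (hx : x ∈ D) : Summable fun k => ζ k • φ k x := by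
  refine Summable.of_norm_bounded (g := fun k => B * (Γ k : ℝ))
    ((NNReal.summable_coe.2 hs).mul_left B) fun k => ?_
  have h : ‖φ k x‖ₑ ≤ Γ k := (enorm_le_c1Norm τ _ hx).trans (hΓ k)
  have h' : ‖φ k x‖ ≤ Γ k := by
    rw [enorm_eq_nnnorm] at h
    exact_mod_cast h
  rw [norm_smul]
  exact mul_le_mul (hζ k) h' (norm_nonneg _) ((norm_nonneg _).trans (hζ k))

theorem c1Norm_expansion_le (hD : IsOpen D) (hφ : ∀ k, ContDiffOn ℝ τ (φ k) D)
    (hΓ : ∀ k, c1Norm D τ (φ k) ≤ Γ k) {ζ : ℕ → ℝ} (hs : Summable fun k => ‖ζ k‖₊ * Γ k) :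
    ContDiffOn ℝ τ (expansion φ ζ) D ∧
      c1Norm D τ (expansion φ ζ) ≤ ↑(∑' k, ‖ζ k‖₊ * Γ k) := by
  have hk : ∀ k, c1Norm D τ (ζ k • φ k) ≤ ↑(‖ζ k‖₊ * Γ k) := fun k => by
    rw [c1Norm_const_smul, ENNReal.coe_mul]
    exact mul_le_mul' le_rfl (hΓ k)
  have hle : ∑' k, c1Norm D τ (ζ k • φ k) ≤ ↑(∑' k, ‖ζ k‖₊ * Γ k) := by
    rw [ENNReal.coe_tsum hs]
    exact ENNReal.tsum_le_tsum hk
  have h := c1Norm_tsum_le hD (φ := fun k => ζ k • φ k) (fun k => (hφ k).const_smul (ζ k))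
    (ne_top_of_le_ne_top ENNReal.coe_ne_top hle)
  exact ⟨h.1, h.2.trans hle⟩

theorem norm_coef_le {y : Param} (hy : y ∈ box) (k : ℕ) : ‖coef y k‖ ≤ 1 := by
  cases k with
  | zero => simp [coef]
  | succ k =>
    have := hy k.succPNat (mem_univ _)
    exact abs_le.2 this

/-- The distance of two expansions; the coefficient with index `0` does not depend on the parameter.
-/
theorem tsum_coef_sub (Γ : ℕ → ℝ≥0) (L : ℝ≥0) (hs : Summable Γ) {y y' : Param}
    (hy : y ∈ box) (hy' : y' ∈ box) :
    (Summable fun k => ‖coef y' k - coef y k‖₊ * Γ k) ∧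
      L * ∑' k, ‖coef y' k - coef y k‖₊ * Γ k = wdist (fun k => L * Γ k) y y' := by
  have hsum : Summable fun k => ‖coef y' k - coef y k‖₊ * Γ k := by
    refine NNReal.summable_of_le (fun k => ?_) (hs.mul_left 2)
    refine mul_le_mul' ?_ le_rfl
    rw [← NNReal.coe_le_coe]
    have h1 := norm_coef_le hy k
    have h2 := norm_coef_le hy' k
    have h3 := norm_sub_le (coef y' k) (coef y k)
    push_cast
    linarith
  refine ⟨hsum, ?_⟩
  have h0 : ‖coef y' 0 - coef y 0‖₊ * Γ 0 = 0 := by simp [coef]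
  have hsum' : Summable fun k => ‖coef y' (k + 1) - coef y (k + 1)‖₊ * Γ (k + 1) :=
    (NNReal.summable_nat_add_iff (f := fun k => ‖coef y' k - coef y k‖₊ * Γ k) 1).2 hsum
  have h1 : ∑' k, ‖coef y' k - coef y k‖₊ * Γ k
      = ∑' k, ‖coef y' (k + 1) - coef y (k + 1)‖₊ * Γ (k + 1) := by
    have := tsum_eq_zero_add' (f := fun k => ‖coef y' k - coef y k‖₊ * Γ k) hsum'
    rw [this, h0, zero_add]
  have h2 := tsum_pnat_eq_tsum_succ (f := fun k => ‖coef y' k - coef y k‖₊ * Γ k)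
  rw [h1, ← h2, ← NNReal.tsum_mul_left, wdist]
  refine tsum_congr fun k => ?_
  rw [coef_pnat, coef_pnat, mul_left_comm]

theorem mapV_eq_expansion {σ : ℕ → ℝ} {ψ : ℕ → Rd d → Rd d}
    (hΓ : ∀ k, c1Norm D τ (fun x => σ k • ψ k x) ≤ Γ k) (hs : Summable Γ) {y : Param} (hy : y ∈ box)
    {x : Rd d} (hx : x ∈ D) :
    mapV σ ψ y x = expansion (fun k x => σ k • ψ k x) (coef y) x := by
  have hsum := summable_expansion hΓ hs (norm_coef_le hy) hx
  rw [expansion, hsum.tsum_eq_zero_add, mapV]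
  simp only [coef, one_smul]
  congr 1
  have h : ∀ k : ℕ+, y k • σ k • ψ k x = coef y (k : ℕ) • σ (k : ℕ) • ψ (k : ℕ) x := fun k => by
    rw [coef_pnat]
  simp_rw [h]
  rw [tsum_pnat_eq_tsum_succ (f := fun k => coef y k • σ k • ψ k x)]
  rfl

end Expansion

/-! ### The domain mapping as an affine family -/

section Mapping

variable {d : ℕ} {D H : Set (Rd d)} {τ : ℕ} {σ : ℕ → ℝ} {ψ : ℕ → Rd d → Rd d} {Γ : ℕ → ℝ≥0}
  {σlow σup : ℝ}

/-- The function `(1 - s) V[y] + s V[y']` is `V` at the corresponding parameter. -/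
theorem mapV_segment (hΓ : ∀ k, c1Norm D τ (fun x => σ k • ψ k x) ≤ Γ k) (hs : Summable Γ)
    {y y' : Param} (hy : y ∈ box) (hy' : y' ∈ box) {s : ℝ} (hys : y + s • (y' - y) ∈ box)
    {x : Rd d} (hx : x ∈ D) :
    mapV σ ψ (y + s • (y' - y)) x = mapV σ ψ y x + s • (mapV σ ψ y' x - mapV σ ψ y x) := by
  rw [mapV_eq_expansion hΓ hs hy hx, mapV_eq_expansion hΓ hs hy' hx, mapV_eq_expansion hΓ hs hys hx]
  have h1 := summable_expansion hΓ hs (norm_coef_le hy) hx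
  have h2 := summable_expansion hΓ hs (norm_coef_le hy') hx
  unfold expansion
  rw [← h2.tsum_sub h1, ← (h2.sub h1).tsum_const_smul, ← h1.tsum_add ((h2.sub h1).const_smul s)]
  refine tsum_congr fun k => ?_
  have h : coef (y + s • (y' - y)) k = coef y k + s * (coef y' k - coef y k) := by
    cases k <;> simp [coef]
  rw [h, ← sub_smul, add_smul, mul_smul]

theorem mapV_add_single (hΓ : ∀ k, c1Norm D τ (fun x => σ k • ψ k x) ≤ Γ k) (hs : Summable Γ)
    {y : Param} (hy : y ∈ box) {i : ℕ+} {t : ℝ} (hyt : y + Pi.single i t ∈ box)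
    {x : Rd d} (hx : x ∈ D) :
    mapV σ ψ (y + Pi.single i t) x = mapV σ ψ y x + t • σ i • ψ i x := by
  rw [mapV_eq_expansion hΓ hs hy hx, mapV_eq_expansion hΓ hs hyt hx]
  have h1 := summable_expansion hΓ hs (norm_coef_le hy) hx
  have h2 := summable_expansion hΓ hs (norm_coef_le hyt) hx
  rw [← sub_eq_iff_eq_add', expansion, expansion, ← h2.tsum_sub h1]
  rw [tsum_eq_single (i : ℕ)]
  · rw [← sub_smul, coef_pnat, coef_pnat]; simp
  · intro k hk
    rw [← sub_smul]
    cases k with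
    | zero => simp [coef]
    | succ k =>
      have : k.succPNat ≠ i := fun h => hk (by rw [← h]; rfl)
      simp [coef, this]

theorem continuousOn_mapV (hΓ : ∀ k, c1Norm D τ (fun x => σ k • ψ k x) ≤ Γ k) (hs : Summable Γ)
    {x : Rd d} (hx : x ∈ D) : ContinuousOn (fun y => mapV σ ψ y x) box := by
  have h : ContinuousOn (fun y => expansion (fun k x => σ k • ψ k x) (coef y) x) box := by
    refine continuousOn_tsum (u := fun k => (Γ k : ℝ)) (fun k => ?_) (NNReal.summable_coe.2 hs)
      fun k y hy => ?_
    · cases k with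
      | zero => simp only [coef]; exact continuousOn_const
      | succ k =>
        simp only [coef]
        exact ((continuous_apply _).smul continuous_const).continuousOn
    · have h : ‖σ k • ψ k x‖ₑ ≤ Γ k := (enorm_le_c1Norm τ (fun x => σ k • ψ k x) hx).trans (hΓ k)
      have h' : ‖σ k • ψ k x‖ ≤ Γ k := by
        rw [enorm_eq_nnnorm] at h
        exact_mod_cast h
      rw [norm_smul]
      exact (mul_le_of_le_one_left (norm_nonneg _) (norm_coef_le hy k)).trans h'
  exact h.congr fun y hy => mapV_eq_expansion hΓ hs hy hx

/-- By continuity in the parameter, the bi-Lipschitz bounds hold for every parameter in the cube. -/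
theorem biLipschitz_mapV (hΓ : ∀ k, c1Norm D τ (fun x => σ k • ψ k x) ≤ Γ k) (hs : Summable Γ)
    (hLip : ∀ᵐ y ∂law, ∀ x ∈ D, ∀ x' ∈ D, σlow * ‖x - x'‖ ≤ ‖mapV σ ψ y x - mapV σ ψ y x'‖ ∧
      ‖mapV σ ψ y x - mapV σ ψ y x'‖ ≤ σup * ‖x - x'‖) {y : Param} (hy : y ∈ box) :
    ∀ x ∈ D, ∀ x' ∈ D, σlow * ‖x - x'‖ ≤ ‖mapV σ ψ y x - mapV σ ψ y x'‖ ∧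
      ‖mapV σ ψ y x - mapV σ ψ y x'‖ ≤ σup * ‖x - x'‖ := by
  intro x hx x' hx'
  have hcl := mem_closure_of_ae hLip hy
  have hc := ((((continuousOn_mapV hΓ hs hx).sub (continuousOn_mapV hΓ hs hx')).norm) y hy).mono
    (t := box) (fun z hz => hz.1 :
      {y | y ∈ box ∧ ∀ x ∈ D, ∀ x' ∈ D, σlow * ‖x - x'‖ ≤ ‖mapV σ ψ y x - mapV σ ψ y x'‖ ∧
        ‖mapV σ ψ y x - mapV σ ψ y x'‖ ≤ σup * ‖x - x'‖} ⊆ box)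
  exact ⟨continuousWithinAt_const.closure_le hcl hc fun z hz => (hz.2 x hx x' hx').1,
    hc.closure_le hcl continuousWithinAt_const fun z hz => (hz.2 x hx x' hx').2⟩

theorem box_segment {y y' : Param} (hy : y ∈ box) (hy' : y' ∈ box) {s : ℝ}
    (hs : s ∈ Icc (0 : ℝ) 1) :
    y + s • (y' - y) ∈ box := by
  have hconv : Convex ℝ box := convex_pi fun _ _ => convex_Icc _ _
  exact hconv.add_smul_sub_mem hy hy' hs

/-- The `1`-jets of the domain mapping form an affine family. -/
theorem affineFamily_jet_mapV (hd : 0 < d) (hD : IsOpen D)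
    (hφ : ∀ k, ContDiffOn ℝ τ (fun x => σ k • ψ k x) D)
    (hΓ : ∀ k, c1Norm D τ (fun x => σ k • ψ k x) ≤ Γ k) (hs : Summable Γ)
    (hLip : ∀ᵐ y ∂law, ∀ x ∈ D, ∀ x' ∈ D, σlow * ‖x - x'‖ ≤ ‖mapV σ ψ y x - mapV σ ψ y x'‖ ∧
      ‖mapV σ ψ y x - mapV σ ψ y x'‖ ≤ σup * ‖x - x'‖)
    (hHold : ∀ y ∈ box, MapsTo (mapV σ ψ y) D H) :
    AffineFamily D τ (H ×ˢ matSet d σlow σup) (fun y => jet (mapV σ ψ y))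
      (fun k => jet fun x => σ k • ψ k x) (fun k => (1 + (τ + 1) * d) * Γ k)
      ((1 + (τ + 1) * d) * ∑' k, Γ k) := by
  set L : ℝ≥0 := 1 + (τ + 1) * d with hL
  have hE : ∀ y ∈ box, EqOn (expansion (fun k x => σ k • ψ k x) (coef y)) (mapV σ ψ y) D :=
    fun y hy x hx => (mapV_eq_expansion hΓ hs hy hx).symm
  have hreg : ∀ y ∈ box, ContDiffOn ℝ τ (mapV σ ψ y) D ∧ ∃ M : ℝ≥0,
      c1Norm D τ (expansion (fun k x => σ k • ψ k x) (coef y)) ≤ M ∧ M ≤ ∑' k, Γ k := by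
    intro y hy
    have hle : ∀ k, ‖coef y k‖₊ * Γ k ≤ Γ k := fun k =>
      mul_le_of_le_one_left zero_le (norm_coef_le hy k)
    have hsum : Summable fun k => ‖coef y k‖₊ * Γ k := NNReal.summable_of_le hle hs
    obtain ⟨h1, h2⟩ := c1Norm_expansion_le hD hφ hΓ hsum
    exact ⟨h1.congr fun x hx => (hE y hy hx).symm, _, h2, hsum.tsum_le_tsum hle hs⟩
  have hev : ∀ {x}, x ∈ D → ∀ {u v : Rd d → Rd d}, EqOn u v D → u =ᶠ[𝓝 x] v := fun hx _ _ h =>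
    h.eventuallyEq_of_mem (hD.mem_nhds hx)
  have hjetE : ∀ {u v : Rd d → Rd d}, EqOn u v D → EqOn (jet u) (jet v) D := fun h x hx => by
    rw [jet, jet, (hev hx h).fderiv_eq, h hx]
  have hdae : ∀ y ∈ box, ∀ᵐ x ∂volume.restrict D, DifferentiableAt ℝ (mapV σ ψ y) x := by
    intro y hy
    obtain ⟨h1, M, hM, -⟩ := hreg y hy
    filter_upwards [ae_differentiableAt_of_c1Norm hd hD (h1.congr fun x hx => hE y hy hx) hM,
      ae_restrict_mem hD.measurableSet] with x hx hxD
    exact (hev hxD (hE y hy)).differentiableAt_iff.1 hx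
  have hdall : ∀ y ∈ box, τ ≠ 0 → ∀ x ∈ D, DifferentiableAt ℝ (mapV σ ψ y) x := fun y hy hτ x hx =>
    differentiableAt_of_contDiffOn hD (hreg y hy).1 hτ hx
  have hsub : ∀ y ∈ box, ∀ y' ∈ box, ∀ x ∈ D, DifferentiableAt ℝ (mapV σ ψ y) x →
      DifferentiableAt ℝ (mapV σ ψ y') x →
      DifferentiableAt ℝ (fun z => mapV σ ψ y' z - mapV σ ψ y z) x ∧
      jet (fun z => mapV σ ψ y' z - mapV σ ψ y z) x
        = jet (mapV σ ψ y') x - jet (mapV σ ψ y) x := by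
    intro y _ y' _ x _ h h'
    have := jet_add_smul (u := fun z => mapV σ ψ y' z - mapV σ ψ y z) (s := -1)
      (Eventually.of_forall fun z => by simp only [neg_one_smul, sub_eq_add_neg]) h' h
    rwa [neg_one_smul, ← sub_eq_add_neg] at this
  -- A point on the segment between two jets is the jet of the domain mapping for an intermediate
  -- parameter.
  have hseg : ∀ y ∈ box, ∀ y' ∈ box, ∀ x ∈ D, DifferentiableAt ℝ (mapV σ ψ y) x →
      DifferentiableAt ℝ (mapV σ ψ y') x → ∀ s ∈ Icc (0 : ℝ) 1,
      jet (mapV σ ψ y) x + s • (jet (mapV σ ψ y') x - jet (mapV σ ψ y) x)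
        ∈ H ×ˢ matSet d σlow σup := by
    intro y hy y' hy' x hx h h' s hs01
    have hys := box_segment hy hy' hs01
    obtain ⟨h1, h2⟩ := hsub y hy y' hy' x hx h h'
    obtain ⟨h3, h4⟩ := jet_add_smul (hev hx fun z hz => mapV_segment hΓ hs hy hy' hys hz) h h1
    rw [← h2, ← h4]
    exact ⟨hHold _ hys hx, fderiv_mem_matSet hD (biLipschitz_mapV hΓ hs hLip hys) hx h3⟩
  refine ⟨(NNReal.summable_comp_injective hs PNat.coe_injective).mul_left L, ?_, ?_, ?_, ?_, ?_, ?_⟩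
  · intro y hy
    obtain ⟨h1, M, hM, hM'⟩ := hreg y hy
    obtain ⟨p, hp, hpM⟩ := exists_majorant_jet hd hD (h1.congr fun x hx => hE y hy hx) hM
    exact ⟨p, hp.congr hD (hjetE (hE y hy)), hpM.trans (mul_le_mul' le_rfl hM')⟩
  · exact fun k => exists_majorant_jet hd hD (hφ k) (hΓ k)
  · intro y hy y' hy'
    obtain ⟨hsum, hdist⟩ := tsum_coef_sub Γ L hs hy hy'
    obtain ⟨h1, h2⟩ := c1Norm_expansion_le hD hφ hΓ (ζ := fun k => coef y' k - coef y k) hsum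
    obtain ⟨p, hp, hpM⟩ := exists_majorant_jet hd hD h1 h2
    have hEq : EqOn (expansion (fun k x => σ k • ψ k x) fun k => coef y' k - coef y k)
        (fun z => mapV σ ψ y' z - mapV σ ψ y z) D := fun x hx => by
      simp only
      rw [← hE y hy hx, ← hE y' hy' hx, expansion, expansion, expansion,
        ← (summable_expansion hΓ hs (norm_coef_le hy') hx).tsum_sub
          (summable_expansion hΓ hs (norm_coef_le hy) hx)]
      exact tsum_congr fun k => sub_smul _ _ _
    refine ⟨p, (hp.congr hD (hjetE hEq)).congr_of_eqOn hD ?_ ?_, hpM.trans hdist.le⟩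
    · filter_upwards [hdae y hy, hdae y' hy', ae_restrict_mem hD.measurableSet] with x h h' hx
      exact (hsub y hy y' hy' x hx h h').2
    · exact fun hτ x hx => (hsub y hy y' hy' x hx (hdall y hy hτ x hx) (hdall y' hy' hτ x hx)).2
  · intro y hy i t hyt
    filter_upwards [hdae y hy, ae_differentiableAt_of_c1Norm hd hD (hφ i) (hΓ i),
      ae_restrict_mem hD.measurableSet] with x h h' hx
    exact (jet_add_smul (hev hx fun z hz => mapV_add_single hΓ hs hy hyt hz) h h').2
  · intro y hy y' hy'
    filter_upwards [hdae y hy, hdae y' hy', ae_restrict_mem hD.measurableSet] with x h h' hx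
    exact hseg y hy y' hy' x hx h h'
  · intro hτ y hy x hx
    have := hseg y hy y hy x hx (hdall y hy hτ x hx) (hdall y hy hτ x hx) 0 ⟨le_rfl, zero_le_one⟩
    simpa only [zero_smul, add_zero] using this

end Mapping

/-! ### Comparison of the constants -/

section Constants

variable {d : ℕ}

theorem prod_const_mul_pow (L : ℝ≥0) (Γ : ℕ → ℝ≥0) (α : ℕ+ →₀ ℕ) :
    (α.prod fun k a => (L * Γ k) ^ a) = L ^ α.degree * α.prod fun k a => Γ k ^ a := by
  simp only [Finsupp.prod, mul_pow, Finset.prod_mul_distrib, Finset.prod_pow_eq_pow_sum]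
  rfl

/-- The bound of `AffineFamily.sobolevNorm_paramDeriv_le` in the form in which the constants are
stated; `c'` bounds the doubled rate, and `v` stands for `kVJ`. -/
theorem derivBound_le {k c P L : ℝ≥0} {Γ : ℕ → ℝ≥0} {c' v : ℝ} (hc : 2 * (c : ℝ) ≤ c')
    (hL : (L : ℝ) ≤ v) (hP : (P : ℝ) ≤ v) (τ : ℕ) (α : ℕ+ →₀ ℕ) :
    ((α.degree.factorial * k * (2 * c) ^ α.degree * (∑ r ∈ Finset.range (τ + 1), (2 * c * P) ^ r)
      * α.prod fun k a => (L * Γ k) ^ a : ℝ≥0) : ℝ)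
      ≤ α.degree.factorial * (k * ∑ r ∈ Finset.range (τ + 1), c' ^ r * v ^ r)
        * (2 * c' * v + 1) ^ α.degree * gpow (fun k => (Γ k : ℝ)) α := by
  have hc0 : 0 ≤ c' := le_trans (by positivity) hc
  have hv0 : 0 ≤ v := L.2.trans hL
  have hg : ((α.prod fun k a => Γ k ^ a : ℝ≥0) : ℝ) = gpow (fun k => (Γ k : ℝ)) α := by
    simp [gpow, Finsupp.prod, NNReal.coe_prod]
  have hg0 : 0 ≤ gpow (fun k => (Γ k : ℝ)) α := hg ▸ NNReal.coe_nonneg _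
  rw [prod_const_mul_pow]
  push_cast [hg]
  calc _ = α.degree.factorial * (k * ∑ r ∈ Finset.range (τ + 1), (2 * (c : ℝ) * P) ^ r)
        * (2 * (c : ℝ) * L) ^ α.degree * gpow (fun k => (Γ k : ℝ)) α := by
        rw [mul_pow (2 * (c : ℝ)) (L : ℝ)]; ring
    _ ≤ α.degree.factorial * (k * ∑ r ∈ Finset.range (τ + 1), (c' * v) ^ r)
        * (2 * c' * v + 1) ^ α.degree * gpow (fun k => (Γ k : ℝ)) α := by
        have h2 : 2 * (c : ℝ) * L ≤ 2 * c' * v + 1 := by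
          calc 2 * (c : ℝ) * L ≤ c' * v := by gcongr
            _ ≤ 2 * c' * v + 1 := by nlinarith [mul_nonneg hc0 hv0]
        gcongr
    _ = _ := by simp_rw [mul_pow c' v]

/-- Here `2 σlow⁻¹` is the rate of the diffusion matrix. -/
theorem two_mul_le_cT {σlow σup : ℝ} (h0 : 0 < σlow) (h1 : σlow ≤ 1) (h2 : 1 ≤ σup) :
    2 * (2 * σlow⁻¹) ≤ cT σlow σup := by
  have hi : 1 ≤ σlow⁻¹ := (one_le_inv₀ h0).2 h1
  have h3 : σlow⁻¹ ≤ (σlow ^ 2)⁻¹ * σup ^ 2 := by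
    rw [← inv_pow]
    calc σlow⁻¹ = σlow⁻¹ * 1 * 1 := by ring
      _ ≤ σlow⁻¹ * σlow⁻¹ * σup ^ 2 := by
          gcongr
          exact one_le_pow₀ h2
      _ = _ := by ring
  rw [cT]
  linarith

/-- The rate of the loading is `max cf 1`. -/
theorem two_mul_le_cS (H : Set (Rd d)) {σup : ℝ} (cf : ℝ) (h2 : 1 ≤ σup) :
    2 * max cf 1 ≤ cS H σup cf := by
  have h3 : 1 ≤ max (cf * max 1 (sSup ((fun x => ‖x‖) '' H))) σup := h2.trans (le_max_right _ _)
  rw [cS]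
  rcases le_total cf 1 with h | h
  · rw [max_eq_right h]; linarith
  · rw [max_eq_left h]
    have h4 : cf ≤ cf * max 1 (sSup ((fun x => ‖x‖) '' H)) :=
      le_mul_of_one_le_right (by linarith) (le_max_left _ _)
    linarith [le_max_left (cf * max 1 (sSup ((fun x => ‖x‖) '' H))) σup]

/-- The bounds for the coefficients of the jets and for the jets themselves, in terms of `kVJ`. -/
theorem le_kVJ {D : Set (Rd d)} {τ : ℕ} (he : 1 ≤ cEmb D τ) (γ : ℕ → ℝ) :
    1 + ((τ : ℝ) + 1) * d ≤ kVJ D τ γ ∧ (1 + ((τ : ℝ) + 1) * d) * ∑' k, γ k ≤ kVJ D τ γ := by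
  have hg1 : 1 ≤ cGam γ := le_max_right _ _
  have hg2 : ∑' k, γ k ≤ cGam γ := le_max_left _ _
  have hL : 0 ≤ 1 + ((τ : ℝ) + 1) * d := by positivity
  have he0 : 0 ≤ cEmb D τ := by linarith
  rw [kVJ]
  have h1 : 1 + ((τ : ℝ) + 1) * d ≤ (1 + ((τ : ℝ) + 1) * d) * cEmb D τ :=
    le_mul_of_one_le_right hL he
  constructor
  · exact h1.trans (le_mul_of_one_le_right (by positivity) hg1)
  · calc _ ≤ (1 + ((τ : ℝ) + 1) * d) * cGam γ := by gcongr
      _ ≤ _ := by gcongr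

end Constants

/-! ### Cauchy estimates for the data -/

section Data

variable {d : ℕ} {H : Set (Rd d)} {σlow σup : ℝ}

theorem cauchyBound_diffusion (h0 : 0 < σlow) (h1 : σlow ≤ 1) (h2 : 1 ≤ σup) :
    CauchyBound (H ×ˢ matSet d σlow σup) (fun a : Rd d × Mat d => diffusion a.2)
      (kT d σlow σup).toNNReal (2 * σlow⁻¹).toNNReal := by
  intro a ha
  obtain ⟨u, hu, -⟩ := exists_unit_of_mem_matSet h0 ha.2
  have han : AnalyticAt ℝ (diffusion : Mat d → Mat d) a.2 := hu ▸ analyticAt_diffusion u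
  refine ⟨han.comp (f := fun a : Rd d × Mat d => a.2) analyticAt_snd, fun n => ?_⟩
  have hkT : 0 ≤ kT d σlow σup := by rw [kT]; positivity
  rw [Real.coe_toNNReal _ hkT, Real.coe_toNNReal _ (by positivity)]
  exact (norm_iteratedFDeriv_comp_clm_le (ContinuousLinearMap.snd ℝ (Rd d) (Mat d))
    (ContinuousLinearMap.norm_snd_le ..) han n).trans
    (norm_iteratedFDeriv_diffusion_le h0 h1 h2 ha.2 n)

/-- A negative constant `cf` is possible only if `kf = 0`, and then `f = 0`. -/
theorem cauchyBound_loading (hne : H.Nonempty) (h2 : 1 ≤ σup) {f : Rd d → ℝ}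
    (hf : AnalyticOnNhd ℝ f H) {kf cf : ℝ}
    (hfb : ∀ r : ℕ, ∀ v ∈ H, ‖iteratedFDeriv ℝ r f v‖ ≤ (r.factorial : ℝ) * kf * cf ^ r) :
    0 ≤ kf ∧ CauchyBound (H ×ˢ matSet d σlow σup) (loading f) (kS d σup kf).toNNReal
      (max cf 1).toNNReal := by
  obtain ⟨v, hv⟩ := hne
  have hkf : 0 ≤ kf := by simpa using (norm_nonneg _).trans (hfb 0 v hv)
  refine ⟨hkf, fun a ha => ⟨analyticAt_loading (hf _ ha.1), fun n => ?_⟩⟩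
  have hkS : 0 ≤ kS d σup kf := by rw [kS]; positivity
  rw [Real.coe_toNNReal _ hkS, Real.coe_toNNReal _ (by positivity)]
  refine norm_iteratedFDeriv_loading_le (hf _ ha.1) hkf (le_max_right _ _) h2 (fun r => ?_)
    (norm_le_of_mem_matSet h2 ha.2) n
  refine (hfb r _ ha.1).trans ?_
  rw [mul_assoc]
  refine mul_le_mul_of_nonneg_left ?_ (Nat.cast_nonneg _)
  rcases le_or_gt 0 cf with hc | hc
  · gcongr
    exact le_max_left _ _
  · have h1 : 0 ≤ kf * cf := by simpa using (norm_nonneg _).trans (hfb 1 v hv)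
    have : kf = 0 := le_antisymm (by nlinarith) hkf
    simp [this]

theorem volume_rpow_half_le {D : Set (Rd d)} (h0 : 0 < σlow) (hH : volume H ≠ ∞)
    (h : volume D ≤ ENNReal.ofReal ((σlow ^ d)⁻¹) * volume H) :
    volume D ^ (1 / 2 : ℝ) ≤ ENNReal.ofReal √((volume H).toReal / σlow ^ d) := by
  rw [Real.sqrt_eq_rpow, ← ENNReal.ofReal_rpow_of_nonneg (by positivity) (by norm_num)]
  gcongr
  rw [div_eq_inv_mul, ENNReal.ofReal_mul (by positivity), ENNReal.ofReal_toReal hH]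
  exact h

end Data

end DomainMapping

end

open DomainMapping in
theorem theorem3p4 (d τ : ℕ) (hd : 0 < d)
    (D : Set (DomainMapping.Rd d)) (hD : IsOpen D) (hDne : D.Nonempty)
    (H : Set (DomainMapping.Rd d)) (hH : IsOpen H) (hHb : Bornology.IsBounded H)
    (σlow σup : ℝ) (hσ0 : 0 < σlow) (hσ1 : σlow ≤ 1) (hσ2 : 1 ≤ σup)
    (σ : ℕ → ℝ) (ψ : ℕ → DomainMapping.Rd d → DomainMapping.Rd d)
    (hσzero : σ 0 = 1)
    (hψ : ∀ k, DomainMapping.MemC1 D τ (ψ k))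
    (hγ : Summable (DomainMapping.gam D τ σ ψ))
    (hLip : ∀ᵐ y ∂DomainMapping.law, ∀ x ∈ D, ∀ x' ∈ D,
      σlow * ‖x - x'‖ ≤ ‖DomainMapping.mapV σ ψ y x - DomainMapping.mapV σ ψ y x'‖ ∧
        ‖DomainMapping.mapV σ ψ y x - DomainMapping.mapV σ ψ y x'‖ ≤ σup * ‖x - x'‖)
    (hHold : ∀ y ∈ DomainMapping.box, MapsTo (DomainMapping.mapV σ ψ y) D H)
    (f : DomainMapping.Rd d → ℝ) (hf : AnalyticOnNhd ℝ f H) (kf cf : ℝ)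
    (hfb : ∀ r : ℕ, ∀ v ∈ H, ‖iteratedFDeriv ℝ r f v‖ ≤ (r.factorial : ℝ) * kf * cf ^ r) :
    (∃ U : (ℕ+ →₀ ℕ) → DomainMapping.Param → DomainMapping.Rd d → DomainMapping.Mat d,
      DomainMapping.IsParamDeriv (DomainMapping.sobolevNorm D τ ∞) (DomainMapping.hatA σ ψ) U ∧
      (∀ α, ∀ y ∈ DomainMapping.box, ∀ x ∈ D, IsSelfAdjoint (U α y x)) ∧
      ∀ α, DomainMapping.bochnerNorm (DomainMapping.sobolevNorm D τ ∞) (U α) ≤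
        ENNReal.ofReal ((α.degree.factorial : ℝ) *
          DomainMapping.kA D τ (DomainMapping.gam D τ σ ψ) σlow σup *
          DomainMapping.cA D τ (DomainMapping.gam D τ σ ψ) σlow σup ^ α.degree *
          DomainMapping.gpow (DomainMapping.gam D τ σ ψ) α)) ∧
    (∃ U : (ℕ+ →₀ ℕ) → DomainMapping.Param → DomainMapping.Rd d → ℝ,
      DomainMapping.IsParamDeriv (DomainMapping.predSobolevNorm D τ)
        (DomainMapping.hatF f σ ψ) U ∧
      ∀ α, DomainMapping.bochnerNorm (DomainMapping.predSobolevNorm D τ) (U α) ≤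
        ENNReal.ofReal ((α.degree.factorial : ℝ) *
          DomainMapping.kF D H τ (DomainMapping.gam D τ σ ψ) σlow σup kf cf *
          DomainMapping.cF D H τ (DomainMapping.gam D τ σ ψ) σup cf ^ α.degree *
          DomainMapping.gpow (DomainMapping.gam D τ σ ψ) α)) := by
  have hfin : ∀ k, c1Norm D τ (fun x => σ k • ψ k x) ≠ ∞ := fun k => by
    have h := c1Norm_const_smul (D := D) (σ k) τ (ψ k)
    change c1Norm D τ (fun x => σ k • ψ k x) = _ at h
    rw [h]
    exact ENNReal.mul_ne_top enorm_ne_top (hψ k).norm_lt_top.ne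
  have hφ : ∀ k, ContDiffOn ℝ τ (fun x => σ k • ψ k x) D := fun k =>
    (hψ k).contDiffOn.const_smul (σ k)
  set Γ : ℕ → NNReal := fun k => (c1Norm D τ (fun x => σ k • ψ k x)).toNNReal with hΓdef
  have hΓ : ∀ k, c1Norm D τ (fun x => σ k • ψ k x) ≤ Γ k := fun k =>
    (ENNReal.coe_toNNReal (hfin k)).ge
  have hgam : (fun k => (Γ k : ℝ)) = gam D τ σ ψ := rfl
  have hs : Summable Γ := NNReal.summable_coe.1 hγ
  have hfam := affineFamily_jet_mapV hd hD hφ hΓ hs hLip hHold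
  obtain ⟨hL, hP⟩ := le_kVJ (one_le_cEmb hd hD hDne τ) (gam D τ σ ψ)
  have hL' : ((1 + (τ + 1) * d : NNReal) : ℝ) ≤ kVJ D τ (gam D τ σ ψ) := by
    push_cast; exact hL
  have hP' : (((1 + (τ + 1) * d) * ∑' k, Γ k : NNReal) : ℝ) ≤ kVJ D τ (gam D τ σ ψ) := by
    rw [NNReal.coe_mul, NNReal.coe_tsum, hgam]
    push_cast; exact hP
  have hHfin : volume H ≠ ∞ := hHb.measure_lt_top.ne
  have h0box : (0 : Param) ∈ box := fun _ _ => by constructor <;> norm_num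
  -- `D` need not be bounded, but has finite volume since `V[0]` maps it into the bounded set `H`.
  have hvol := volume_le_of_antilipschitz (hHold 0 h0box) hσ0
    fun x hx x' hx' => (biLipschitz_mapV hΓ hs hLip h0box x hx x' hx').1
  have hDfin : volume D ≠ ∞ :=
    ne_top_of_le_ne_top (ENNReal.mul_ne_top ENNReal.ofReal_ne_top hHfin) hvol
  constructor
  · have hg := cauchyBound_diffusion (d := d) (H := H) hσ0 hσ1 hσ2
    refine ⟨_, hfam.isParamDeriv hD hg, fun α y _ x _ =>
      isSelfAdjoint_dirDeriv_diffusion _ _ (ContinuousLinearMap.snd ℝ (Rd d) (Mat d)) _,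
      fun α => ?_⟩
    refine (bochnerNorm_le (hfam.stronglyMeas hD hg α) fun y hy =>
      hfam.sobolevNorm_paramDeriv_le hD hg α hy).trans ?_
    rw [← ENNReal.ofReal_coe_nnreal]
    refine ENNReal.ofReal_le_ofReal ?_
    have hkT : 0 ≤ kT d σlow σup := by rw [kT]; positivity
    have hc : 2 * (((2 * σlow⁻¹).toNNReal : NNReal) : ℝ) ≤ cT σlow σup := by
      rw [Real.coe_toNNReal _ (by positivity)]
      exact two_mul_le_cT hσ0 hσ1 hσ2
    refine (derivBound_le hc hL' hP' τ α).trans (le_of_eq ?_)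
    rw [Real.coe_toNNReal _ hkT, hgam, kA, cA]
  · have hHne : H.Nonempty := let ⟨x, hx⟩ := hDne; ⟨_, hHold 0 h0box hx⟩
    obtain ⟨hkf, hg⟩ := cauchyBound_loading (σlow := σlow) hHne hσ2 hf hfb
    have hCfin : volume D ^ (1 / 2 : ℝ) ≠ ∞ :=
      ENNReal.rpow_ne_top_of_nonneg (by norm_num) hDfin
    have hN := predSobolevNorm_le hD hDne hDfin τ
    refine ⟨_, (hfam.isParamDeriv hD hg).of_le hCfin hN, fun α => ?_⟩
    refine (bochnerNorm_le ((hfam.stronglyMeas hD hg α).of_le hCfin hN) fun y hy =>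
      (hN _).trans (mul_le_mul' (volume_rpow_half_le hσ0 hHfin hvol)
        (hfam.sobolevNorm_paramDeriv_le hD hg α hy))).trans ?_
    rw [← ENNReal.ofReal_coe_nnreal, ← ENNReal.ofReal_mul (Real.sqrt_nonneg _)]
    refine ENNReal.ofReal_le_ofReal ?_
    have hkS : 0 ≤ kS d σup kf := by rw [kS]; positivity
    have hc : 2 * (((max cf 1).toNNReal : NNReal) : ℝ) ≤ cS H σup cf := by
      rw [Real.coe_toNNReal _ (by positivity)]
      exact two_mul_le_cS H cf hσ2
    refine (mul_le_mul_of_nonneg_left (derivBound_le hc hL' hP' τ α)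
      (Real.sqrt_nonneg _)).trans (le_of_eq ?_)
    rw [Real.coe_toNNReal _ hkS, hgam, kF, cF]
    ring
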